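/- Let $w:\mathbb{R}\to[0,\infty)$ be a bounded measurable function with $w(t)=w(-t)$ for all $t$, $\int_{\mathbb{R}}w(t)\,dt<\infty$ and $\int_{\mathbb{R}}t^2w(t)\,dt<\infty$, and let $L^2=L^2(\mathbb{R},w(t)\,dt)$ be the Hilbert space of (classes of) real measurable functions that are square integrable with respect to $w(t)\,dt$. Let $X_1,X_2,\dots$ be independent random variables on a probability space, all with the same normal distribution $N(\mu,\sigma^2)$, where $\mu\in\mathbb{R}$ and $\sigma^2>0$. For $n\ge1$ put $\overline X_n=\frac1n\sum_{j=1}^nX_j$, $S_n=\bigl(\frac1n\sum_{j=1}^n(X_j-\overline X_n)^2\bigr)^{1/2}$, $Y_{n,j}=(X_j-\overline X_n)/S_n$ (with $Y_{n,j}=0$ if $S_n=0$), and $$W_n(t)=\frac1{\sqrt n}\sum_{j=1}^n\Bigl[(Y_{n,j}+t)\cos(tY_{n,j})+(t-Y_{n,j})\sin(tY_{n,j})\Bigr],\qquad t\in\mathbb{R},$$ which is a random element of $L^2$. Then there is a centred Gaussian random element $W$ of $L^2$ with covariance kernel $$K_Z(s,t)=(st+1)\exp\Bigl(-\frac{(s-t)^2}2\Bigr)-(2st+1)\exp\Bigl(-\frac{s^2+t^2}2\Bigr),\qquad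 s,t\in\mathbb{R},$$ that is, $\operatorname{Cov}\bigl(\langle f,W\rangle,\langle g,W\rangle\bigr)=\iint K_Z(s,t)f(s)g(t)w(s)w(t)\,ds\,dt$ for all $f,g\in L^2$, such that $W_n$ converges in distribution to $W$ in $L^2$ as $n\to\infty$. -/

import Mathlib

open MeasureTheory ProbabilityTheory Filter
open scoped NNReal ENNReal RealInnerProductSpace

noncomputable section

namespace SteinNormality

/-- Admissible weight functions: nonnegative, measurable, bounded, even and integrable, with
`t ↦ t` in the weighted `L²` space (so that the processes below take values in that space). -/
structure IsWeight (w : ℝ → ℝ) : Prop where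
  measurable : Measurable w
  nonneg : ∀ t, 0 ≤ w t
  bounded : ∃ C, ∀ t, w t ≤ C
  even : ∀ t, w (-t) = w t
  integrable : Integrable w
  integrable_sq_mul : Integrable (fun t => t ^ 2 * w t)

/-- The measure `w(t) dt` on the real line. -/
def weightMeasure (w : ℝ → ℝ) : Measure ℝ :=
  volume.withDensity (fun t => ENNReal.ofReal (w t))

/-- The Hilbert space `L²(ℝ, w(t) dt)` of (classes of) real functions. -/
abbrev WeightedL2 (w : ℝ → ℝ) : Type := Lp ℝ 2 (weightMeasure w)

instance instMeasurableSpaceWeightedL2 (w : ℝ → ℝ) : MeasurableSpace (WeightedL2 w) := borel _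

instance instBorelSpaceWeightedL2 (w : ℝ → ℝ) : BorelSpace (WeightedL2 w) := ⟨rfl⟩

/-- The mean of `x 0, …, x (n - 1)`. -/
def sampleMean (x : ℕ → ℝ) (n : ℕ) : ℝ := (∑ j ∈ Finset.range n, x j) / n

/-- The standard deviation `S_n` of `x 0, …, x (n - 1)`, with normalization `1 / n`. -/
def sampleSD (x : ℕ → ℝ) (n : ℕ) : ℝ :=
  √((∑ j ∈ Finset.range n, (x j - sampleMean x n) ^ 2) / n)

/-- The scaled residual `Y_{n,j}`. -/
def scaledResidual (x : ℕ → ℝ) (n j : ℕ) : ℝ := (x j - sampleMean x n) / sampleSD x n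

/-- The value `W_n(t)` computed from the data `x 0, …, x (n - 1)`. -/
def residualProcess (x : ℕ → ℝ) (n : ℕ) (t : ℝ) : ℝ :=
  (√(n : ℝ))⁻¹ * ∑ j ∈ Finset.range n,
    ((scaledResidual x n j + t) * Real.cos (t * scaledResidual x n j)
      + (t - scaledResidual x n j) * Real.sin (t * scaledResidual x n j))

theorem IsWeight.isFiniteMeasure {w : ℝ → ℝ} (hw : IsWeight w) :
    IsFiniteMeasure (weightMeasure w) :=
  isFiniteMeasure_withDensity_ofReal hw.integrable.2

theorem IsWeight.memLp_id {w : ℝ → ℝ} (hw : IsWeight w) :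
    MemLp (fun t : ℝ => t) 2 (weightMeasure w) := by
  rw [memLp_two_iff_integrable_sq (by fun_prop), weightMeasure,
    integrable_withDensity_iff (by have := hw.measurable; fun_prop) (by simp)]
  simpa [ENNReal.toReal_ofReal, hw.nonneg] using hw.integrable_sq_mul

theorem IsWeight.memLp_residualProcess {w : ℝ → ℝ} (hw : IsWeight w) (x : ℕ → ℝ) (n : ℕ) :
    MemLp (residualProcess x n) 2 (weightMeasure w) := by
  have := hw.isFiniteMeasure
  suffices h : ∀ y : ℝ, MemLp (fun t : ℝ => (y + t) * Real.cos (t * y) + (t - y) * Real.sin (t * y))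
      2 (weightMeasure w) from
    (memLp_finsetSum (Finset.range n) fun j _ => h (scaledResidual x n j)).const_mul
      (√(n : ℝ))⁻¹
  intro y
  have h1 : MemLp (fun t : ℝ => 2 * (|y| + |t|)) 2 (weightMeasure w) :=
    ((memLp_const |y|).add hw.memLp_id.abs).const_mul 2
  refine h1.of_le (by fun_prop) (ae_of_all _ fun t => ?_)
  have hc := Real.abs_cos_le_one (t * y)
  have hs := Real.abs_sin_le_one (t * y)
  have e1 : |(y + t) * Real.cos (t * y)| ≤ |y| + |t| := by
    rw [abs_mul]
    exact (mul_le_of_le_one_right (abs_nonneg _) hc).trans (abs_add_le _ _)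
  have e2 : |(t - y) * Real.sin (t * y)| ≤ |y| + |t| := by
    rw [abs_mul]
    exact (mul_le_of_le_one_right (abs_nonneg _) hs).trans ((abs_sub t y).trans_eq (add_comm _ _))
  rw [Real.norm_eq_abs, Real.norm_eq_abs, abs_of_nonneg (by positivity : 0 ≤ 2 * (|y| + |t|))]
  exact (abs_add_le _ _).trans (by linarith)

/-- `W_n` as an element of the Hilbert space `L²(ℝ, w(t) dt)`. -/
def residualElement {w : ℝ → ℝ} (hw : IsWeight w) (x : ℕ → ℝ) (n : ℕ) : WeightedL2 w :=
  (hw.memLp_residualProcess x n).toLp (residualProcess x n)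

/-- The covariance kernel `K_Z` of the limit. -/
def limitKernel (s t : ℝ) : ℝ :=
  (s * t + 1) * Real.exp (-(s - t) ^ 2 / 2) - (2 * s * t + 1) * Real.exp (-(s ^ 2 + t ^ 2) / 2)

/-- The random element `W` of `L²(ℝ, w(t) dt)` has covariance kernel `K`:
`Cov(⟪f, W⟫, ⟪g, W⟫) = ∫∫ K(s,t) f(s) g(t) w(s) w(t) ds dt` for all `f`, `g` in the space,
the inner products being square integrable and the double integral absolutely convergent. -/
def HasCovarianceKernel {w : ℝ → ℝ} {Ω : Type*} [MeasurableSpace Ω] (P : Measure Ω)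
    (W : Ω → WeightedL2 w) (K : ℝ → ℝ → ℝ) : Prop :=
  ∀ f g : WeightedL2 w,
    MemLp (fun ω => ⟪f, W ω⟫) 2 P ∧
    Integrable (fun p : ℝ × ℝ => K p.1 p.2 * f p.1 * g p.2)
      ((weightMeasure w).prod (weightMeasure w)) ∧
    cov[fun ω => ⟪f, W ω⟫, fun ω => ⟪g, W ω⟫; P] =
      ∫ p : ℝ × ℝ, K p.1 p.2 * f p.1 * g p.2 ∂((weightMeasure w).prod (weightMeasure w))

end SteinNormality

end

/-!
The process is invariant under positive affine maps of the data, so the sample may be taken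
standard normal, `U_1, U_2, …`.

Write `h_t(y) = (y + t) cos (t y) + (t - y) sin (t y)`, which is `f' - y f` for
`f y = sin (t y) - cos (t y)`. The residuals are `Y_j = (U_j - a) / S` with `a` and `S` the sample
mean and standard deviation. By Stein's identity, the means of `h_t'(U)` and `U h_t'(U)` are `e`
and `-2 t e` with `e = exp (-t ^ 2 / 2)`, so a Taylor expansion suggests that `W_n(t)` is close to
`n^{-1/2} ∑ Z_t(U_j)` with `Z_t(u) = h_t(u) - e (u - t (u ^ 2 - 1))`. The function `Z_t` is again
of the form `φ' - u φ`, and the Gaussian inner product of two functions of this form is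
`E[φ ψ + φ' ψ']` (`integral_deriv_sub_mul_deriv_sub`); hence `Z_t(U)` is centred with covariance
function `limitKernel` (`integral_linearTerm_mul_linearTerm`).

The sums `n^{-1/2} ∑ Z(U_j)` are normalized sums of i.i.d. square integrable elements of the
weighted `L²` space, so they converge to a Gaussian element with that covariance by the central
limit theorem in a Hilbert space (`exists_isGaussian_tendsto_inv_sqrt_smul_sum`): tightness comes
from approximating one summand by a simple function, and the limit is identified through
characteristic functions and the one-dimensional theorem.

It remains to see that the linearization error `R_n` tends to zero in the weighted `L²` space in
probability. On the event that `√n a` and `√n (n^{-1} ∑ U_j ^ 2 - 1)` are bounded by `B`,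
`E[R_n(t) ^ 2]` is `O (1 / n)` for each `t` (`exists_lintegral_linearizationError_le`), but with a
constant growing too fast in `t` to be integrated against a weight which only has a second moment.
The integration over `t` is by dominated convergence instead, which needs
`E[W_n(t) ^ 2] ≤ C (1 + t ^ 2)` uniformly in `n` (`integral_residualProcess_sq_le`). The residual
vector is `√n` times a uniformly distributed direction orthogonal to the vector of ones. The square
`W_n(t) ^ 2` is at most `2 / n` times a double sum over pairs of residuals
(`residualProcess_sq_le`); the expectation of an off-diagonal term is a sum of terms of order one,
and integration by parts on the sphere shows that they cancel up to order `(1 + t ^ 2) / n`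
(`abs_integral_dirCoord_cos_le`).
-/

namespace SteinNormality

open scoped Topology

/-! ### The central limit theorem in a separable Hilbert space -/

section Tightness

/-- A set of measures on a complete metric space is tight as soon as, for each `η > 0`, all but an
arbitrarily small mass lies within distance `η` of a compact set: intersect such thickenings. -/
theorem isTightMeasureSet_of_cthickening {E : Type*} [MetricSpace E] [CompleteSpace E]
    [MeasurableSpace E] {S : Set (Measure E)}
    (h : ∀ ε : ℝ≥0∞, 0 < ε → ∀ η : ℝ, 0 < η →
      ∃ C : Set E, IsCompact C ∧ ∀ μ ∈ S, μ (Metric.cthickening η C)ᶜ ≤ ε) :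
    IsTightMeasureSet S := by
  rw [isTightMeasureSet_iff_exists_isCompact_measure_compl_le]
  intro ε hε
  obtain ⟨δ, hδ, hsum⟩ := ENNReal.exists_pos_sum_of_countable' hε.ne' ℕ
  have hη : ∀ m : ℕ, (0 : ℝ) < 1 / ((m : ℝ) + 1) := fun m => by positivity
  choose C hC hCS using fun m : ℕ => h (δ m) (hδ m) (1 / ((m : ℝ) + 1)) (hη m)
  refine ⟨⋂ m : ℕ, Metric.cthickening (1 / ((m : ℝ) + 1)) (C m), ?_, fun μ hμ => ?_⟩
  · refine TotallyBounded.isCompact_of_isClosed ?_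
      (isClosed_iInter fun m => Metric.isClosed_cthickening)
    rw [Metric.totallyBounded_iff]
    intro r hr
    obtain ⟨m, hm⟩ := exists_nat_one_div_lt (half_pos hr)
    obtain ⟨t, -, htf, ht⟩ := (hC m).finite_cover_balls (half_pos hr)
    refine ⟨t, htf, fun x hx => ?_⟩
    have hx' := Set.mem_iInter.1 hx m
    rw [(hC m).cthickening_eq_biUnion_closedBall (hη m).le] at hx'
    obtain ⟨y, hy, hxy⟩ := Set.mem_iUnion₂.1 hx'
    obtain ⟨z, hz, hyz⟩ := Set.mem_iUnion₂.1 (ht hy)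
    refine Set.mem_iUnion₂.2 ⟨z, hz, ?_⟩
    rw [Metric.mem_ball] at hyz ⊢
    rw [Metric.mem_closedBall] at hxy
    linarith [dist_triangle x y z]
  · rw [Set.compl_iInter]
    calc μ (⋃ m : ℕ, (Metric.cthickening (1 / ((m : ℝ) + 1)) (C m))ᶜ)
        ≤ ∑' m : ℕ, μ (Metric.cthickening (1 / ((m : ℝ) + 1)) (C m))ᶜ := measure_iUnion_le _
      _ ≤ ∑' m, δ m := ENNReal.tsum_le_tsum fun m : ℕ => hCS m μ hμ
      _ ≤ ε := hsum.le

variable {Ω : Type*} [MeasurableSpace Ω] {P : Measure Ω} {H : Type*} [NormedAddCommGroup H]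

/-- Markov's inequality for the square of the norm. -/
theorem measure_lt_norm_le {X : Ω → H} {c r : ℝ} (hX : MemLp X 2 P) [IsFiniteMeasure P]
    (hc : ∫ ω, ‖X ω‖ ^ 2 ∂P ≤ c) (hr : 0 < r) :
    P {ω | r < ‖X ω‖} ≤ ENNReal.ofReal (c / r ^ 2) := by
  have h1 := mul_meas_ge_le_integral_of_nonneg (μ := P) (f := fun ω => ‖X ω‖ ^ 2)
    (ae_of_all _ fun ω => by positivity) hX.norm.integrable_sq (r ^ 2)
  have h2 : P.real {ω | r < ‖X ω‖} ≤ P.real {ω | r ^ 2 ≤ ‖X ω‖ ^ 2} := by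
    refine measureReal_mono fun ω (hω : r < ‖X ω‖) => ?_
    exact pow_le_pow_left₀ hr.le hω.le 2
  rw [← ENNReal.ofReal_toReal (measure_ne_top P _)]
  refine ENNReal.ofReal_le_ofReal ?_
  rw [le_div_iff₀ (by positivity)]
  change P.real _ * _ ≤ _
  nlinarith [sq_nonneg r]

variable [InnerProductSpace ℝ H] [CompleteSpace H] [MeasurableSpace H] [BorelSpace H]

/-- The normalized sum of pairwise independent centred vectors has the second moment of one
summand (and vanishes for `n = 0`). -/
theorem integral_norm_sq_inv_sqrt_smul_sum_le [IsProbabilityMeasure P] {ξ : ℕ → Ω → H} {c : ℝ}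
    (hindep : Pairwise fun i j => IndepFun (ξ i) (ξ j) P) (hL : ∀ j, MemLp (ξ j) 2 P)
    (h0 : ∀ j, ∫ ω, ξ j ω ∂P = 0) (hc : ∀ j, ∫ ω, ‖ξ j ω‖ ^ 2 ∂P = c) (n : ℕ) :
    ∫ ω, ‖(√(n : ℝ))⁻¹ • ∑ j ∈ Finset.range n, ξ j ω‖ ^ 2 ∂P ≤ c := by
  have hc0 : 0 ≤ c := hc 0 ▸ integral_nonneg fun ω => by positivity
  have hint : ∀ i j, Integrable (fun ω => ⟪ξ i ω, ξ j ω⟫) P := fun i j =>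
    ((hL i).norm.integrable_mul (hL j).norm).mono' ((hL i).1.inner (hL j).1)
      (ae_of_all _ fun ω => norm_inner_le_norm _ _)
  have hexp : ∀ ω, ‖(√(n : ℝ))⁻¹ • ∑ j ∈ Finset.range n, ξ j ω‖ ^ 2 =
      (n : ℝ)⁻¹ * ∑ i ∈ Finset.range n, ∑ j ∈ Finset.range n, ⟪ξ i ω, ξ j ω⟫ := by
    intro ω
    rw [norm_smul, mul_pow, ← real_inner_self_eq_norm_sq (∑ j ∈ Finset.range n, ξ j ω), sum_inner,
      Real.norm_eq_abs, sq_abs, inv_pow, Real.sq_sqrt n.cast_nonneg]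
    simp_rw [inner_sum]
  simp_rw [hexp]
  rw [integral_const_mul,
    integral_finsetSum _ fun i _ => integrable_finsetSum _ fun j _ => hint i j]
  have hi : ∀ i ∈ Finset.range n, ∫ ω, ∑ j ∈ Finset.range n, ⟪ξ i ω, ξ j ω⟫ ∂P = c := by
    intro i hi
    rw [integral_finsetSum _ fun j _ => hint i j, Finset.sum_eq_single_of_mem i hi]
    · simp_rw [real_inner_self_eq_norm_sq]
      exact hc i
    · intro j _ hji
      have := (hindep hji.symm).integral_bilin ((hL i).integrable (by norm_num))
        ((hL j).integrable (by norm_num)) (innerSL ℝ)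
      simp only [h0, map_zero] at this
      exact this
  rw [Finset.sum_congr rfl hi, Finset.sum_const, Finset.card_range, nsmul_eq_mul]
  rcases n.eq_zero_or_pos with rfl | hn
  · simpa using hc0
  · rw [inv_mul_cancel_left₀ (by positivity)]

end Tightness

section CentralLimit

variable {Ω : Type*} [MeasurableSpace Ω] {P : Measure Ω} [IsProbabilityMeasure P]
  {H : Type*} [NormedAddCommGroup H] [InnerProductSpace ℝ H] [CompleteSpace H]
  [MeasurableSpace H] [BorelSpace H]

/-- The laws of the normalized sums of i.i.d. centred square integrable vectors are tight. A simple
function close to the first summand spans a finite-dimensional subspace, and the part of each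
normalized sum orthogonal to that subspace is uniformly small in mean square. -/
theorem isTightMeasureSet_inv_sqrt_smul_sum {ξ : ℕ → Ω → H} (hindep : iIndepFun ξ P)
    (hident : ∀ j, IdentDistrib (ξ j) (ξ 0) P P) (hL : MemLp (ξ 0) 2 P)
    (h0 : ∫ ω, ξ 0 ω ∂P = 0) :
    IsTightMeasureSet (Set.range fun n : ℕ =>
      P.map fun ω => (√(n : ℝ))⁻¹ • ∑ j ∈ Finset.range n, ξ j ω) := by
  have hLj : ∀ j, MemLp (ξ j) 2 P := fun j => (hident j).memLp_iff.2 hL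
  have hm : ∀ j, AEMeasurable (ξ j) P := fun j => (hident j).aemeasurable_fst
  -- second moments of normalized sums of images under a continuous linear map
  have key : ∀ (A : H →L[ℝ] H) (n : ℕ),
      ∫ ω, ‖A ((√(n : ℝ))⁻¹ • ∑ j ∈ Finset.range n, ξ j ω)‖ ^ 2 ∂P ≤ ∫ ω, ‖A (ξ 0 ω)‖ ^ 2 ∂P := by
    intro A n
    have hA : ∀ j, ∫ ω, A (ξ j ω) ∂P = 0 := fun j => by
      rw [A.integral_comp_comm ((hLj j).integrable (by norm_num)), (hident j).integral_eq, h0,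
        map_zero]
    have := integral_norm_sq_inv_sqrt_smul_sum_le (P := P) (ξ := fun j ω => A (ξ j ω))
      (c := ∫ ω, ‖A (ξ 0 ω)‖ ^ 2 ∂P)
      (fun i j hij => (hindep.indepFun hij).comp A.measurable A.measurable)
      (fun j => A.comp_memLp' (hLj j)) hA
      (fun j => ((hident j).comp
        (u := fun x => ‖A x‖ ^ 2) (by fun_prop)).integral_eq) n
    simpa [map_smul, map_sum] using this
  have hG : ∀ n : ℕ, MemLp (fun ω => (√(n : ℝ))⁻¹ • ∑ j ∈ Finset.range n, ξ j ω) 2 P := fun n =>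
    (memLp_finsetSum _ fun j _ => hLj j).const_smul _
  refine isTightMeasureSet_of_cthickening fun ε hε η hη => ?_
  wlog hεt : ε ≠ ∞ generalizing ε
  · obtain ⟨C, hC, h⟩ := this 1 one_pos ENNReal.one_ne_top
    exact ⟨C, hC, fun μ hμ => by rw [not_not.1 hεt]; exact le_top⟩
  have hεr : 0 < ε.toReal := ENNReal.toReal_pos hε.ne' hεt
  obtain ⟨g, hg, -⟩ := hL.exists_simpleFunc_eLpNorm_sub_lt (by norm_num)
    (ε := ENNReal.ofReal (η * √(ε.toReal / 2))) (by positivity)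
  let V : Submodule ℝ H := Submodule.span ℝ (Set.range g)
  have : FiniteDimensional ℝ V := FiniteDimensional.span_of_finite ℝ g.finite_range
  let Q : H →L[ℝ] H := ContinuousLinearMap.id ℝ H - V.starProjection
  set a := ∫ ω, ‖ξ 0 ω‖ ^ 2 ∂P with ha
  have ha0 : 0 ≤ a := integral_nonneg fun ω => by positivity
  have hb : ∫ ω, ‖Q (ξ 0 ω)‖ ^ 2 ∂P ≤ η ^ 2 * (ε.toReal / 2) := by
    have hle : ∀ ω, ‖Q (ξ 0 ω)‖ ≤ ‖ξ 0 ω - g ω‖ := fun ω => by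
      have h := V.starProjection_minimal (ξ 0 ω)
      have h' : BddBelow (Set.range fun x : V => ‖ξ 0 ω - x‖) :=
        ⟨0, by rintro _ ⟨x, rfl⟩; exact norm_nonneg _⟩
      exact h.trans_le (ciInf_le h' ⟨g ω, Submodule.subset_span ⟨ω, rfl⟩⟩)
    have hgL : MemLp (ξ 0 - ⇑g) 2 P := hL.sub ((g.memLp_of_isFiniteMeasure) 2 P)
    rw [hgL.eLpNorm_eq_integral_rpow_norm (by norm_num) (by norm_num),
      ENNReal.ofReal_lt_ofReal_iff (by positivity)] at hg
    have hI : 0 ≤ ∫ ω, ‖(ξ 0 - ⇑g) ω‖ ^ 2 ∂P := integral_nonneg fun ω => by positivity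
    calc ∫ ω, ‖Q (ξ 0 ω)‖ ^ 2 ∂P ≤ ∫ ω, ‖(ξ 0 - ⇑g) ω‖ ^ 2 ∂P :=
          integral_mono (Q.comp_memLp' hL).norm.integrable_sq hgL.norm.integrable_sq fun ω =>
            pow_le_pow_left₀ (norm_nonneg _) (hle ω) 2
      _ ≤ (η * √(ε.toReal / 2)) ^ 2 := by
          simp only [ENNReal.toReal_ofNat, Real.rpow_ofNat] at hg
          rw [show ((2 : ℝ)⁻¹) = 1 / 2 by norm_num, ← Real.sqrt_eq_rpow] at hg
          exact (Real.sqrt_le_left (by positivity)).1 hg.le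
      _ = η ^ 2 * (ε.toReal / 2) := by rw [mul_pow, Real.sq_sqrt (by positivity)]
  let r : ℝ := √(2 * (a + 1) / ε.toReal)
  have hr : 0 < r := by positivity
  refine ⟨(fun v : V => (v : H)) '' Metric.closedBall 0 r,
    (isCompact_closedBall (0 : V) r).image continuous_subtype_val, ?_⟩
  rintro _ ⟨n, rfl⟩
  dsimp only
  rw [Measure.map_apply_of_aemeasurable (hG n).aestronglyMeasurable.aemeasurable
    Metric.isClosed_cthickening.measurableSet.compl]
  set G : Ω → H := fun ω => (√(n : ℝ))⁻¹ • ∑ j ∈ Finset.range n, ξ j ω with hGdef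
  have hsub : G ⁻¹' (Metric.cthickening η ((fun v : V => (v : H)) '' Metric.closedBall 0 r))ᶜ ⊆
      {ω | r < ‖G ω‖} ∪ {ω | η < ‖Q (G ω)‖} := by
    intro ω hω
    by_contra hcon
    simp only [Set.mem_union, Set.mem_ofPred_eq, not_or, not_lt] at hcon
    refine hω (Metric.mem_cthickening_of_dist_le (G ω) (V.orthogonalProjectionOnto (G ω) : H) η _
      ⟨V.orthogonalProjectionOnto (G ω), ?_, rfl⟩ ?_)
    · rw [mem_closedBall_zero_iff]
      exact (V.norm_orthogonalProjectionOnto_apply_le _).trans hcon.1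
    · rw [dist_eq_norm]
      exact hcon.2
  calc P _ ≤ P {ω | r < ‖G ω‖} + P {ω | η < ‖Q (G ω)‖} :=
        (measure_mono hsub).trans (measure_union_le _ _)
    _ ≤ ENNReal.ofReal (a / r ^ 2) + ENNReal.ofReal (η ^ 2 * (ε.toReal / 2) / η ^ 2) := by
        gcongr
        · exact measure_lt_norm_le (hG n) (by simpa using key (ContinuousLinearMap.id ℝ H) n) hr
        · exact measure_lt_norm_le (Q.comp_memLp' (hG n)) ((key Q n).trans hb) hη
    _ ≤ ENNReal.ofReal (ε.toReal / 2) + ENNReal.ofReal (ε.toReal / 2) := by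
        refine add_le_add (ENNReal.ofReal_le_ofReal ?_) (ENNReal.ofReal_le_ofReal ?_)
        · rw [Real.sq_sqrt (by positivity), div_div_eq_mul_div, div_le_iff₀ (by positivity)]
          nlinarith
        · rw [mul_div_cancel_left₀ _ (by positivity)]
    _ = ε := by
        rw [← ENNReal.ofReal_add (by positivity) (by positivity), add_halves,
          ENNReal.ofReal_toReal hεt]

variable [SecondCountableTopology H]

/-- The central limit theorem in a separable Hilbert space: the normalized sums of i.i.d. centred
square integrable vectors converge in law to a centred Gaussian measure with the same covariance. -/
theorem exists_isGaussian_tendsto_inv_sqrt_smul_sum {ξ : ℕ → Ω → H} (hindep : iIndepFun ξ P)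
    (hident : ∀ j, IdentDistrib (ξ j) (ξ 0) P P) (hL : MemLp (ξ 0) 2 P)
    (h0 : ∫ ω, ξ 0 ω ∂P = 0) :
    ∃ (ν : Measure H) (_ : IsProbabilityMeasure ν), IsGaussian ν ∧ ∫ x, x ∂ν = 0 ∧
      covarianceBilin ν = covarianceBilin (P.map (ξ 0)) ∧
      TendstoInDistribution (fun (n : ℕ) ω => (√(n : ℝ))⁻¹ • ∑ j ∈ Finset.range n, ξ j ω)
        atTop id (fun _ => P) ν := by
  have hm : ∀ j, AEMeasurable (ξ j) P := fun j => (hident j).aemeasurable_fst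
  have hGm : ∀ n : ℕ, AEMeasurable (fun ω => (√(n : ℝ))⁻¹ • ∑ j ∈ Finset.range n, ξ j ω) P :=
    fun n => (Finset.aemeasurable_fun_sum _ fun j _ => hm j).const_smul _
  have : IsProbabilityMeasure (P.map (ξ 0)) := Measure.isProbabilityMeasure_map (hm 0)
  have hρ : MemLp id 2 (P.map (ξ 0)) :=
    (memLp_map_measure_iff aestronglyMeasurable_id (hm 0)).2 hL
  let μ : ℕ → ProbabilityMeasure H := fun n =>
    ⟨P.map fun ω => (√(n : ℝ))⁻¹ • ∑ j ∈ Finset.range n, ξ j ω,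
      Measure.isProbabilityMeasure_map (hGm n)⟩
  have htight : IsTightMeasureSet {((μ n : ProbabilityMeasure H) : Measure H) | n} :=
    isTightMeasureSet_inv_sqrt_smul_sum hindep hident hL h0
  -- the one-dimensional central limit theorem applied to each linear functional
  have hchar : ∀ f : H, Tendsto (fun n => charFun (μ n : Measure H) f) atTop
      (𝓝 (Complex.exp (⟪f, (0 : H)⟫ * Complex.I - covarianceBilin (P.map (ξ 0)) f f / 2))) := by
    intro f
    have hf : Measurable fun x : H => ⟪f, x⟫ := by fun_prop
    have hint0 : ∫ ω, ⟪f, ξ 0 ω⟫ ∂P = 0 := by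
      rw [integral_inner (hL.integrable (by norm_num)), h0, inner_zero_right]
    have hvar : covarianceBilin (P.map (ξ 0)) f f = Var[fun ω => ⟪f, ξ 0 ω⟫; P] := by
      rw [covarianceBilin_self hρ, variance_map hf.aemeasurable (hm 0)]
      rfl
    have hclt := tendstoInDistribution_inv_sqrt_mul_sum_sub (P := P)
      (X := fun j ω => ⟪f, ξ j ω⟫) (Y := id)
      (P' := gaussianReal 0 Var[fun ω => ⟪f, ξ 0 ω⟫; P].toNNReal)
      ⟨aemeasurable_id, Measure.map_id⟩ (hL.const_inner f)
      (hindep.comp (fun _ x => ⟪f, x⟫) fun _ => hf) (fun j => (hident j).comp hf)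
    have h1 := ProbabilityMeasure.tendsto_iff_tendsto_charFun.1 hclt.tendsto 1
    simp only [ProbabilityMeasure.coe_mk, Measure.map_id, charFun_gaussianReal] at h1
    have h2 : ∀ n : ℕ, charFun (μ n : Measure H) f = charFun
        (P.map fun ω => (√(n : ℝ))⁻¹ * (∑ j ∈ Finset.range n, ⟪f, ξ j ω⟫ -
          n * ∫ ω, ⟪f, ξ 0 ω⟫ ∂P)) 1 := by
      intro n
      have hm' : AEMeasurable (fun ω => (√(n : ℝ))⁻¹ * (∑ j ∈ Finset.range n, ⟪f, ξ j ω⟫ -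
          n * ∫ ω, ⟪f, ξ 0 ω⟫ ∂P)) P := hclt.forall_aemeasurable n
      rw [charFun_apply_real, integral_map hm' (by fun_prop), charFun_apply]
      change ∫ x, _ ∂(P.map _) = _
      rw [integral_map (hGm n) (by fun_prop)]
      refine integral_congr_ae (ae_of_all _ fun ω => ?_)
      simp only [hint0, mul_zero, sub_zero, Complex.ofReal_one, one_mul]
      rw [real_inner_comm, inner_smul_right, inner_sum]
    simp_rw [h2]
    convert h1 using 2
    rw [hvar, Real.coe_toNNReal _ (variance_nonneg _ _), inner_zero_right]
    simp
  obtain ⟨ν, -, φ, hφ, hν⟩ := (isCompact_closure_of_isTightMeasureSet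
    (S := Set.range μ) (by simpa using htight)).tendsto_subseq
    fun n => subset_closure (Set.mem_range_self n)
  have hchar' : ∀ f : H, charFun (ν : Measure H) f =
      Complex.exp (⟪f, (0 : H)⟫ * Complex.I - covarianceBilin (P.map (ξ 0)) f f / 2) := by
    intro f
    refine tendsto_nhds_unique ?_ ((hchar f).comp hφ.tendsto_atTop)
    have := (ProbabilityMeasure.tendsto_iff_forall_integral_rclike_tendsto ℂ).1 hν
      (BoundedContinuousFunction.innerProbChar f)
    simp only [charFun_eq_integral_innerProbChar]
    exact this
  have hcongr := gaussian_charFun_congr (μ := (ν : Measure H)) 0 _ isPosSemidef_covarianceBilin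
    hchar'
  refine ⟨ν, inferInstance, ?_, hcongr.1.symm, hcongr.2.symm, hGm, aemeasurable_id, ?_⟩
  · exact isGaussian_iff_gaussian_charFun.2 ⟨0, _, isPosSemidef_covarianceBilin, hchar'⟩
  · have hconv : Tendsto μ atTop (𝓝 ν) := by
      refine ProbabilityMeasure.tendsto_of_tight_of_separatesPoints htight (𝕜 := ℂ)
        (A := BoundedContinuousFunction.charPoly Real.continuous_probChar
          (L := innerₗ H) continuous_inner) ?_ ?_
      · refine BoundedContinuousFunction.separatesPoints_charPoly
          Real.continuous_probChar
          Real.probChar_ne_one _ ?_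
        exact fun v hv => DFunLike.ne_iff.mpr ⟨v, inner_self_ne_zero.mpr hv⟩
      · exact fun g => ProbabilityMeasure.tendsto_charPoly_of_tendsto_charFun fun f => by
          rw [hchar' f]
          exact hchar f
    have hid : (⟨(ν : Measure H).map id, Measure.isProbabilityMeasure_map aemeasurable_id⟩ :
        ProbabilityMeasure H) = ν := Subtype.ext Measure.map_id
    rw [hid]
    exact hconv

end CentralLimit

/-! ### Integration by parts for the direction of a Gaussian vector -/

section Sphere

variable {E : Type*} [NormedAddCommGroup E] [InnerProductSpace ℝ E]

/-- The coordinate along `p` of the unit vector in the direction of the component of `u` orthogonal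
to the unit vector `e` (zero if that component vanishes). -/
noncomputable def dirCoord (e p u : E) : ℝ := ⟪p, u⟫ / ‖u - ⟪e, u⟫ • e‖

theorem abs_dirCoord_le_one {e p : E} (hp : ‖p‖ = 1) (hep : ⟪e, p⟫ = 0) (u : E) :
    |dirCoord e p u| ≤ 1 := by
  rw [dirCoord, abs_div, abs_norm]
  refine div_le_one_of_le₀ ?_ (norm_nonneg _)
  have h : ⟪p, u⟫ = ⟪p, u - ⟪e, u⟫ • e⟫ := by
    rw [inner_sub_right, inner_smul_right, real_inner_comm e p, hep, mul_zero, sub_zero]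
  rw [h]
  simpa [hp] using abs_real_inner_le_norm p (u - ⟪e, u⟫ • e)

theorem norm_sub_inner_smul_sq {e : E} (he : ‖e‖ = 1) (u : E) :
    ‖u - ⟪e, u⟫ • e‖ ^ 2 = ‖u‖ ^ 2 - ⟪e, u⟫ ^ 2 := by
  rw [norm_sub_sq_real, inner_smul_right, norm_smul, he, real_inner_comm, Real.norm_eq_abs,
    mul_one, sq_abs]
  ring

/-- The linear map rotating the oriented plane spanned by the orthonormal vectors `p`, `q` and
fixing its orthogonal complement. -/
theorem exists_rotation [FiniteDimensional ℝ E] {p q : E} (hp : ‖p‖ = 1) (hq : ‖q‖ = 1)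
    (hpq : ⟪p, q⟫ = 0) (θ : ℝ) :
    ∃ T : E ≃ₗᵢ[ℝ] E, (∀ u, ⟪p, T u⟫ = Real.cos θ * ⟪p, u⟫ + Real.sin θ * ⟪q, u⟫) ∧
      (∀ u, ⟪q, T u⟫ = Real.cos θ * ⟪q, u⟫ - Real.sin θ * ⟪p, u⟫) ∧
      ∀ e, ⟪e, p⟫ = 0 → ⟪e, q⟫ = 0 → T e = e ∧ ∀ u, ⟪e, T u⟫ = ⟪e, u⟫ := by
  have hqp : ⟪q, p⟫ = 0 := by rw [real_inner_comm]; exact hpq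
  have hpp : ⟪p, p⟫ = 1 := by rw [real_inner_self_eq_norm_sq, hp, one_pow]
  have hqq : ⟪q, q⟫ = 1 := by rw [real_inner_self_eq_norm_sq, hq, one_pow]
  let a : E →ₗ[ℝ] ℝ := (Real.cos θ - 1) • (innerₗ E p) + Real.sin θ • (innerₗ E q)
  let b : E →ₗ[ℝ] ℝ := (Real.cos θ - 1) • (innerₗ E q) - Real.sin θ • (innerₗ E p)
  let T₀ : E →ₗ[ℝ] E := LinearMap.id + a.smulRight p + b.smulRight q
  have ha : ∀ u, a u = (Real.cos θ - 1) * ⟪p, u⟫ + Real.sin θ * ⟪q, u⟫ := fun u => rfl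
  have hb : ∀ u, b u = (Real.cos θ - 1) * ⟪q, u⟫ - Real.sin θ * ⟪p, u⟫ := fun u => rfl
  have hT : ∀ u, T₀ u = u + a u • p + b u • q := fun u => rfl
  have hnorm : ∀ u, ‖T₀ u‖ = ‖u‖ := by
    intro u
    refine (pow_left_inj₀ (norm_nonneg _) (norm_nonneg _) two_ne_zero).1 ?_
    rw [← real_inner_self_eq_norm_sq, ← real_inner_self_eq_norm_sq, hT]
    simp only [inner_add_left, inner_add_right, inner_smul_left, inner_smul_right, hpq, hqp, hpp,
      hqq, real_inner_comm p u, real_inner_comm q u, RCLike.conj_to_real]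
    rw [ha, hb]
    have := Real.sin_sq_add_cos_sq θ
    linear_combination (⟪p, u⟫ ^ 2 + ⟪q, u⟫ ^ 2) * this
  let T₁ : E →ₗᵢ[ℝ] E := ⟨T₀, hnorm⟩
  refine ⟨T₁.toLinearIsometryEquiv rfl, fun u => ?_, fun u => ?_,
    fun e hep heq => ⟨?_, fun u => ?_⟩⟩
  · change ⟪p, T₀ u⟫ = _
    rw [hT, inner_add_right, inner_add_right, inner_smul_right, inner_smul_right, hpp, hpq, ha]
    ring
  · change ⟪q, T₀ u⟫ = _
    rw [hT, inner_add_right, inner_add_right, inner_smul_right, inner_smul_right, hqp, hqq, hb]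
    ring
  · change T₀ e = e
    rw [hT, ha, hb, real_inner_comm e p, real_inner_comm e q, hep, heq]
    simp
  · change ⟪e, T₀ u⟫ = _
    rw [hT, inner_add_right, inner_add_right, inner_smul_right, inner_smul_right, hep, heq]
    ring

variable [FiniteDimensional ℝ E] [MeasurableSpace E] [BorelSpace E]

@[fun_prop]
theorem measurable_dirCoord (e p : E) : Measurable (dirCoord e p) := by
  unfold dirCoord
  fun_prop

/-- Two coordinates of the direction of a standard Gaussian vector are jointly rotation
invariant. -/
theorem integral_dirCoord_rotation {e p q : E} (hp : ‖p‖ = 1) (hq : ‖q‖ = 1) (hpq : ⟪p, q⟫ = 0)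
    (hep : ⟪e, p⟫ = 0) (heq : ⟪e, q⟫ = 0) (f : ℝ → ℝ → ℝ) (θ : ℝ) :
    ∫ u, f (Real.cos θ * dirCoord e p u + Real.sin θ * dirCoord e q u)
        (Real.cos θ * dirCoord e q u - Real.sin θ * dirCoord e p u) ∂(stdGaussian E) =
      ∫ u, f (dirCoord e p u) (dirCoord e q u) ∂(stdGaussian E) := by
  obtain ⟨T, hTp, hTq, hTe⟩ := exists_rotation hp hq hpq θ
  obtain ⟨hTe1, hTe2⟩ := hTe e hep heq
  have hR : ∀ u, ‖T u - ⟪e, T u⟫ • e‖ = ‖u - ⟪e, u⟫ • e‖ := by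
    intro u
    rw [hTe2, ← T.norm_map (u - _), map_sub, map_smul, hTe1]
  conv_rhs => rw [← stdGaussian_map T]
  rw [show ⇑T = T.toHomeomorph.toMeasurableEquiv from rfl,
    T.toHomeomorph.toMeasurableEquiv.measurableEmbedding.integral_map]
  refine integral_congr_ae (ae_of_all _ fun u => ?_)
  change _ = f (dirCoord e p (T u)) (dirCoord e q (T u))
  simp only [dirCoord, hR, hTp, hTq]
  congr 1 <;> ring

theorem integrable_of_abs_le {Ω : Type*} [MeasurableSpace Ω] {P : Measure Ω} [IsFiniteMeasure P]
    {f : Ω → ℝ} (hf : Measurable f) {C : ℝ} (hC : ∀ ω, |f ω| ≤ C) : Integrable f P :=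
  Integrable.of_bound hf.aestronglyMeasurable C (ae_of_all _ hC)

/-- The infinitesimal form of rotation invariance. -/
theorem integral_sq_mul_deriv_dirCoord {e p q : E} (hp : ‖p‖ = 1) (hq : ‖q‖ = 1)
    (hpq : ⟪p, q⟫ = 0) (hep : ⟪e, p⟫ = 0) (heq : ⟪e, q⟫ = 0) {φ φ' : ℝ → ℝ}
    (hφ : ∀ x, HasDerivAt φ (φ' x) x) (hφ' : Continuous φ') :
    ∫ u, dirCoord e q u ^ 2 * φ' (dirCoord e p u) ∂(stdGaussian E) =
      ∫ u, dirCoord e p u * φ (dirCoord e p u) ∂(stdGaussian E) := by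
  set x := dirCoord e p
  set z := dirCoord e q
  have hx : ∀ u, |x u| ≤ 1 := abs_dirCoord_le_one hp hep
  have hz : ∀ u, |z u| ≤ 1 := abs_dirCoord_le_one hq heq
  have hxm : Measurable x := measurable_dirCoord e p
  have hzm : Measurable z := measurable_dirCoord e q
  have hφc : Continuous φ := continuous_iff_continuousAt.2 fun x => (hφ x).continuousAt
  obtain ⟨M, hM⟩ := (isCompact_Icc (a := (-2 : ℝ)) (b := 2)).exists_bound_of_continuousOn
    hφc.continuousOn
  obtain ⟨M', hM'⟩ := (isCompact_Icc (a := (-2 : ℝ)) (b := 2)).exists_bound_of_continuousOn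
    hφ'.continuousOn
  have hbd : ∀ a b u v : ℝ, |a| ≤ 1 → |b| ≤ 1 → |u| ≤ 1 → |v| ≤ 1 → |a * u + b * v| ≤ 2 := by
    intro a b u v ha hb hu hv
    calc |a * u + b * v| ≤ |a * u| + |b * v| := abs_add_le _ _
      _ ≤ 1 + 1 := by
          rw [abs_mul, abs_mul]
          exact add_le_add (mul_le_one₀ ha (abs_nonneg _) hu) (mul_le_one₀ hb (abs_nonneg _) hv)
      _ = 2 := by norm_num
  have hbd' : ∀ a b u v : ℝ, |a| ≤ 1 → |b| ≤ 1 → |u| ≤ 1 → |v| ≤ 1 → |a * u - b * v| ≤ 2 := by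
    intro a b u v ha hb hu hv
    have := hbd a (-b) u v ha (by rwa [abs_neg]) hu hv
    rwa [neg_mul, ← sub_eq_add_neg] at this
  have hc := Real.abs_cos_le_one
  have hs := Real.abs_sin_le_one
  have hM0 : ∀ θ u, |φ (Real.cos θ * x u + Real.sin θ * z u)| ≤ M := fun θ u =>
    hM _ (abs_le.1 (hbd _ _ _ _ (hc θ) (hs θ) (hx u) (hz u)))
  have hM0' : ∀ θ u, |φ' (Real.cos θ * x u + Real.sin θ * z u)| ≤ M' := fun θ u =>
    hM' _ (abs_le.1 (hbd _ _ _ _ (hc θ) (hs θ) (hx u) (hz u)))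
  have hMn : 0 ≤ M := (abs_nonneg _).trans (hM0 0 0)
  have hMn' : 0 ≤ M' := (abs_nonneg _).trans (hM0' 0 0)
  let F : ℝ → E → ℝ := fun θ u =>
    (Real.cos θ * z u - Real.sin θ * x u) * φ (Real.cos θ * x u + Real.sin θ * z u)
  let F' : ℝ → E → ℝ := fun θ u =>
    (-Real.sin θ * z u - Real.cos θ * x u) * φ (Real.cos θ * x u + Real.sin θ * z u) +
    (Real.cos θ * z u - Real.sin θ * x u) *
      (φ' (Real.cos θ * x u + Real.sin θ * z u) * (-Real.sin θ * x u + Real.cos θ * z u))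
  have hFm : ∀ θ, Measurable (F θ) := fun θ => by
    have := hφc.measurable
    fun_prop
  have hF'm : ∀ θ, Measurable (F' θ) := fun θ => by
    have := hφc.measurable
    have := hφ'.measurable
    fun_prop
  have hder : HasDerivAt (fun θ => ∫ u, F θ u ∂(stdGaussian E))
      (∫ u, F' 0 u ∂(stdGaussian E)) 0 := by
    refine (hasDerivAt_integral_of_dominated_loc_of_deriv_le
      (bound := fun _ => 2 * M + 2 * (M' * 2))
      (s := Set.univ) Filter.univ_mem (Eventually.of_forall fun θ => (hFm θ).aestronglyMeasurable)
      ?_ (hF'm 0).aestronglyMeasurable ?_ (integrable_const _) ?_).2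
    · refine integrable_of_abs_le (hFm 0) (C := 2 * M) fun u => ?_
      rw [abs_mul]
      exact mul_le_mul (hbd' _ _ _ _ (hc 0) (hs 0) (hz u) (hx u)) (hM0 0 u) (abs_nonneg _)
        (by norm_num)
    · refine ae_of_all _ fun u θ _ => ?_
      have hs' : |-Real.sin θ| ≤ 1 := by rw [abs_neg]; exact hs θ
      refine (abs_add_le _ _).trans (add_le_add ?_ ?_)
      · rw [abs_mul]
        exact mul_le_mul (hbd' _ _ _ _ hs' (hc θ) (hz u) (hx u)) (hM0 θ u) (abs_nonneg _)
          (by norm_num)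
      · rw [abs_mul, abs_mul]
        exact mul_le_mul (hbd' _ _ _ _ (hc θ) (hs θ) (hz u) (hx u))
          (mul_le_mul (hM0' θ u) (hbd _ _ _ _ hs' (hc θ) (hx u) (hz u)) (abs_nonneg _) hMn')
          (by positivity) (by norm_num)
    · refine ae_of_all _ fun u θ _ => ?_
      have hin : HasDerivAt (fun θ => Real.cos θ * x u + Real.sin θ * z u)
          (-Real.sin θ * x u + Real.cos θ * z u) θ :=
        ((Real.hasDerivAt_cos θ).mul_const _).add ((Real.hasDerivAt_sin θ).mul_const _)
      exact (((Real.hasDerivAt_cos θ).mul_const _).sub ((Real.hasDerivAt_sin θ).mul_const _)).mul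
        ((hφ _).comp θ hin)
  have hconst : (fun θ => ∫ u, F θ u ∂(stdGaussian E)) = fun _ =>
      ∫ u, z u * φ (x u) ∂(stdGaussian E) := by
    funext θ
    exact integral_dirCoord_rotation hp hq hpq hep heq (fun a b => b * φ a) θ
  rw [hconst] at hder
  have h0 : ∫ u, F' 0 u ∂(stdGaussian E) = 0 := hder.unique (hasDerivAt_const _ _)
  have hF'0 : ∀ u, F' 0 u = z u ^ 2 * φ' (x u) - x u * φ (x u) := by
    intro u
    simp only [F', Real.sin_zero, Real.cos_zero, one_mul, zero_mul, neg_zero, add_zero, sub_zero,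
      zero_add, zero_sub]
    ring
  have hMx : ∀ u, |φ (x u)| ≤ M := fun u => by simpa using hM0 0 u
  have hMx' : ∀ u, |φ' (x u)| ≤ M' := fun u => by simpa using hM0' 0 u
  simp_rw [hF'0] at h0
  have hm1 := hφc.measurable
  have hm2 := hφ'.measurable
  rw [integral_sub, sub_eq_zero] at h0
  · exact h0
  · refine integrable_of_abs_le (by fun_prop) (C := M') fun u => ?_
    rw [abs_mul, abs_pow]
    exact (mul_le_of_le_one_left (abs_nonneg _) (pow_le_one₀ (abs_nonneg _) (hz u))).trans (hMx' u)
  · refine integrable_of_abs_le (by fun_prop) (C := M) fun u => ?_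
    rw [abs_mul]
    exact (mul_le_of_le_one_left (abs_nonneg _) (hx u)).trans (hMx u)

/-- A standard Gaussian vector is almost surely not parallel to `e`. -/
theorem ae_norm_sub_inner_smul_ne_zero {e p : E} (hp : ‖p‖ = 1) (hep : ⟪e, p⟫ = 0) :
    ∀ᵐ u ∂(stdGaussian E), ‖u - ⟪e, u⟫ • e‖ ≠ 0 := by
  have hlaw : (stdGaussian E).map (fun u => ⟪p, u⟫) = gaussianReal 0 1 := by
    have h := IsGaussian.map_eq_gaussianReal (μ := stdGaussian E) (innerSL ℝ p)
    rw [integral_strongDual_stdGaussian, variance_dual_stdGaussian, innerSL_apply_norm, hp] at h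
    simpa using h
  have h0 : (stdGaussian E) ((fun u => ⟪p, u⟫) ⁻¹' {0}) = 0 := by
    have := nullSingletonClass_gaussianReal (μ := 0) (v := 1) one_ne_zero
    rw [← Measure.map_apply (by fun_prop) (measurableSet_singleton 0), hlaw]
    exact measure_singleton 0
  have : ∀ᵐ u ∂(stdGaussian E), ⟪p, u⟫ ≠ 0 := measure_eq_zero_iff_ae_notMem.1 h0
  filter_upwards [this] with u hu h
  refine hu ?_
  rw [sub_eq_zero.1 (norm_eq_zero.1 h), inner_smul_right, real_inner_comm e p, hep, mul_zero]

/-- The Stein identity for one coordinate of a uniformly distributed direction orthogonal to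
`e`. -/
theorem integral_dirCoord_mul {e p : E} (he : ‖e‖ = 1) (hp : ‖p‖ = 1) (hep : ⟪e, p⟫ = 0)
    {φ φ' : ℝ → ℝ} (hφ : ∀ x, HasDerivAt φ (φ' x) x) (hφ' : Continuous φ') :
    ((Module.finrank ℝ E : ℝ) - 2) *
        ∫ u, dirCoord e p u * φ (dirCoord e p u) ∂(stdGaussian E) =
      ∫ u, (1 - dirCoord e p u ^ 2) * φ' (dirCoord e p u) ∂(stdGaussian E) := by
  classical
  have hv : Orthonormal ℝ ((↑) : ({e, p} : Set E) → E) := by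
    have hne : e ≠ p := by
      rintro rfl
      rw [real_inner_self_eq_norm_sq, he] at hep
      norm_num at hep
    rw [orthonormal_subtype_iff_ite]
    rintro a (rfl | rfl) b (rfl | rfl)
    · simp [he]
    · simp [hne, hep]
    · rw [real_inner_comm]
      simp [hne.symm, hep]
    · simp [hp]
  obtain ⟨s, b, hs, hb⟩ := hv.exists_orthonormalBasis_extension
  have hne : e ≠ p := by
    rintro rfl
    rw [real_inner_self_eq_norm_sq, he] at hep
    norm_num at hep
  let ie : s := ⟨e, hs (by simp)⟩
  let ip : s := ⟨p, hs (by simp)⟩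
  have hbe : b ie = e := by rw [hb]
  have hbp : b ip = p := by rw [hb]
  have hie : ie ≠ ip := fun h => hne (congrArg Subtype.val h)
  let S : Finset s := (Finset.univ.erase ie).erase ip
  have hcard : (S.card : ℝ) = (Module.finrank ℝ E : ℝ) - 2 := by
    have h1 : S.card + 2 = Module.finrank ℝ E := by
      rw [Module.finrank_eq_card_basis b.toBasis, Finset.card_erase_of_mem (by simp [hie.symm]),
        Finset.card_erase_of_mem (Finset.mem_univ _), Finset.card_univ]
      have : 1 < Fintype.card s := Fintype.one_lt_card_iff.2 ⟨ie, ip, hie⟩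
      omega
    rw [← h1]
    push_cast
    ring
  have hφc : Continuous φ := continuous_iff_continuousAt.2 fun x => (hφ x).continuousAt
  obtain ⟨M', hM'⟩ := (isCompact_Icc (a := (-1 : ℝ)) (b := 1)).exists_bound_of_continuousOn
    hφ'.continuousOn
  have hM : ∀ u, |φ' (dirCoord e p u)| ≤ M' := fun u =>
    hM' _ (abs_le.1 (abs_dirCoord_le_one hp hep u))
  have hpoint : ∀ i ∈ S, ∫ u, dirCoord e (b i) u ^ 2 * φ' (dirCoord e p u) ∂(stdGaussian E) =
      ∫ u, dirCoord e p u * φ (dirCoord e p u) ∂(stdGaussian E) := by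
    intro i hi
    simp only [S, Finset.mem_erase, Finset.mem_univ, and_true] at hi
    refine integral_sq_mul_deriv_dirCoord hp (b.norm_eq_one i) ?_ hep ?_ hφ hφ'
    · rw [← hbp]
      exact b.orthonormal.2 (Ne.symm hi.1)
    · conv_lhs => rw [← hbe]
      exact b.orthonormal.2 (Ne.symm hi.2)
  rw [← hcard, ← nsmul_eq_mul, ← Finset.sum_const, ← Finset.sum_congr rfl hpoint,
    ← integral_finsetSum]
  · refine integral_congr_ae ?_
    filter_upwards [ae_norm_sub_inner_smul_ne_zero hp hep] with u hu
    rw [← Finset.sum_mul]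
    congr 1
    have hpars : ∑ i, ⟪b i, u⟫ ^ 2 = ‖u‖ ^ 2 := by
      have := b.sum_sq_norm_inner_right u
      simpa using this
    rw [← Finset.add_sum_erase _ _ (Finset.mem_univ ie),
      ← Finset.add_sum_erase _ _ (show ip ∈ Finset.univ.erase ie by simp [hie.symm]), hbe,
      hbp] at hpars
    have hR := norm_sub_inner_smul_sq he u
    simp only [dirCoord, div_pow]
    rw [← Finset.sum_div]
    field_simp
    change ∑ i ∈ S, _ = _
    linarith
  · intro i hi
    simp only [S, Finset.mem_erase, Finset.mem_univ, and_true] at hi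
    have hm := hφ'.measurable
    have hib : ⟪e, b i⟫ = 0 := by
      conv_lhs => rw [← hbe]
      exact b.orthonormal.2 (Ne.symm hi.2)
    refine integrable_of_abs_le (by fun_prop) (C := M') fun u => ?_
    rw [abs_mul, abs_pow]
    exact (mul_le_of_le_one_left (abs_nonneg _) (pow_le_one₀ (abs_nonneg _)
      (abs_dirCoord_le_one (b.norm_eq_one i) hib u))).trans (hM u)

/-- Conditionally on one coordinate of the direction, the square of an orthogonal one has the same
mean as the average over an orthonormal basis. -/
theorem integral_dirCoord_sq_mul {e p q : E} (he : ‖e‖ = 1) (hp : ‖p‖ = 1) (hq : ‖q‖ = 1)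
    (hpq : ⟪p, q⟫ = 0) (hep : ⟪e, p⟫ = 0) (heq : ⟪e, q⟫ = 0) {g : ℝ → ℝ} (hg : Continuous g) :
    ((Module.finrank ℝ E : ℝ) - 2) *
        ∫ u, dirCoord e q u ^ 2 * g (dirCoord e p u) ∂(stdGaussian E) =
      ∫ u, (1 - dirCoord e p u ^ 2) * g (dirCoord e p u) ∂(stdGaussian E) := by
  have hG : ∀ y, HasDerivAt (fun y => ∫ s in (0 : ℝ)..y, g s) (g y) y := fun y =>
    (hg.integral_hasStrictDerivAt 0 y).hasDerivAt
  rw [integral_sq_mul_deriv_dirCoord hp hq hpq hep heq hG hg,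
    integral_dirCoord_mul he hp hep hG hg]

theorem integral_linear_combination {Ω : Type*} [MeasurableSpace Ω] {P : Measure Ω}
    {f₁ f₂ f₃ f₄ : Ω → ℝ} (h₁ : Integrable f₁ P) (h₂ : Integrable f₂ P) (h₃ : Integrable f₃ P)
    (h₄ : Integrable f₄ P) (a b c d : ℝ) :
    ∫ ω, (a * f₁ ω + b * f₂ ω + c * f₃ ω + d * f₄ ω) ∂P =
      a * ∫ ω, f₁ ω ∂P + b * ∫ ω, f₂ ω ∂P + c * ∫ ω, f₃ ω ∂P + d * ∫ ω, f₄ ω ∂P := by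
  have h12 : Integrable (fun ω => a * f₁ ω + b * f₂ ω) P := (h₁.const_mul a).add (h₂.const_mul b)
  have h123 : Integrable (fun ω => a * f₁ ω + b * f₂ ω + c * f₃ ω) P := h12.add (h₃.const_mul c)
  rw [integral_add h123 (h₄.const_mul d), integral_add h12 (h₃.const_mul c),
    integral_add (h₁.const_mul a) (h₂.const_mul b), integral_const_mul, integral_const_mul,
    integral_const_mul, integral_const_mul]

/-- The exact second and the estimated fourth moment of a coordinate of the direction. -/
theorem integral_dirCoord_sq_and_pow_four {e p : E} (he : ‖e‖ = 1) (hp : ‖p‖ = 1)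
    (hep : ⟪e, p⟫ = 0) (hd : 3 ≤ Module.finrank ℝ E) :
    ∫ u, dirCoord e p u ^ 2 ∂(stdGaussian E) = 1 / ((Module.finrank ℝ E : ℝ) - 1) ∧
    ∫ u, dirCoord e p u ^ 4 ∂(stdGaussian E) ≤
      3 / ((Module.finrank ℝ E : ℝ) * ((Module.finrank ℝ E : ℝ) - 1)) := by
  have hd3 : (3 : ℝ) ≤ Module.finrank ℝ E := mod_cast hd
  set d : ℝ := (Module.finrank ℝ E : ℝ) with hd_def
  have hx := abs_dirCoord_le_one hp hep
  have hi : ∀ k : ℕ, Integrable (fun u => dirCoord e p u ^ k) (stdGaussian E) := fun k =>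
    integrable_of_abs_le (by fun_prop) (C := 1) fun u => by
      rw [abs_pow]
      exact pow_le_one₀ (abs_nonneg _) (hx u)
  have h1 := integral_dirCoord_mul he hp hep (φ := fun x => x) (φ' := fun _ => 1)
    (fun x => hasDerivAt_id x) continuous_const
  have h2 := integral_dirCoord_mul he hp hep (φ := fun x => x ^ 3) (φ' := fun x => 3 * x ^ 2)
    (fun x => by simpa using hasDerivAt_pow 3 x) (by fun_prop)
  simp only [mul_one, ← pow_two] at h1
  rw [integral_sub (integrable_const 1) (hi 2)] at h1
  have e2 : ∀ u : E, dirCoord e p u * dirCoord e p u ^ 3 = dirCoord e p u ^ 4 := fun u => by ring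
  have e3 : ∀ u : E, (1 - dirCoord e p u ^ 2) * (3 * dirCoord e p u ^ 2) =
    3 * dirCoord e p u ^ 2 - 3 * dirCoord e p u ^ 4 := fun u => by ring
  simp_rw [e2, e3] at h2
  rw [integral_sub ((hi 2).const_mul 3) ((hi 4).const_mul 3), integral_const_mul,
    integral_const_mul] at h2
  simp only [integral_const, probReal_univ, smul_eq_mul, mul_one] at h1
  rw [← hd_def] at h1 h2
  set A := ∫ u, dirCoord e p u ^ 2 ∂(stdGaussian E)
  set B := ∫ u, dirCoord e p u ^ 4 ∂(stdGaussian E)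
  have hA : A * (d - 1) = 1 := by linarith
  have hB : B * (d + 1) = 3 * A := by linarith
  have hB0 : 0 ≤ B := integral_nonneg fun u => by positivity
  refine ⟨by rw [eq_div_iff (by linarith)]; exact hA, ?_⟩
  rw [le_div_iff₀ (by nlinarith)]
  nlinarith

/-- The key cancellation: with `x`, `z` two orthogonal coordinates of the direction, the left-hand
side is a difference of terms of order one, but integration by parts on the sphere turns it into
an expression of second and fourth order in `x`, hence of order `1 / d`. -/
theorem abs_integral_dirCoord_cos_le {e p q : E} (he : ‖e‖ = 1) (hp : ‖p‖ = 1) (hq : ‖q‖ = 1)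
    (hpq : ⟪p, q⟫ = 0) (hep : ⟪e, p⟫ = 0) (heq : ⟪e, q⟫ = 0) (hd : 3 ≤ Module.finrank ℝ E)
    {t r d : ℝ} (hdd : d = Module.finrank ℝ E) (hr : r ^ 2 = 2 * d * t ^ 2) :
    |∫ u, ((t ^ 2 + ((d - 2) * dirCoord e q u ^ 2 - d * dirCoord e p u ^ 2) / 2) *
        Real.cos (r * dirCoord e p u) - r * dirCoord e p u * Real.sin (r * dirCoord e p u))
        ∂(stdGaussian E)| ≤ (1 + 6 * t ^ 2) / (d - 1) := by
  obtain ⟨hm2, hm4⟩ := integral_dirCoord_sq_and_pow_four he hp hep hd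
  rw [← hdd] at hm2 hm4
  have hd3 : 3 ≤ d := hdd ▸ mod_cast hd
  set x := dirCoord e p with hx_def
  set z := dirCoord e q with hz_def
  have hx : ∀ u, |x u| ≤ 1 := abs_dirCoord_le_one hp hep
  have hz : ∀ u, |z u| ≤ 1 := abs_dirCoord_le_one hq heq
  have hxm : Measurable x := measurable_dirCoord e p
  have hzm : Measurable z := measurable_dirCoord e q
  have hc := Real.abs_cos_le_one
  have hs := Real.abs_sin_le_one
  have hxk : ∀ (k : ℕ) u, |x u ^ k| ≤ 1 := fun k u => by
    rw [abs_pow]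
    exact pow_le_one₀ (abs_nonneg _) (hx u)
  have hik : ∀ k : ℕ, Integrable (fun u => x u ^ k) (stdGaussian E) := fun k =>
    integrable_of_abs_le (by fun_prop) (hxk k)
  have hic : ∀ k : ℕ, Integrable (fun u => x u ^ k * Real.cos (r * x u)) (stdGaussian E) :=
    fun k => integrable_of_abs_le (by fun_prop) (C := 1) fun u => by
      rw [abs_mul]
      exact mul_le_one₀ (hxk k u) (abs_nonneg _) (hc _)
  have his : ∀ k : ℕ, Integrable (fun u => x u ^ k * Real.sin (r * x u)) (stdGaussian E) :=
    fun k => integrable_of_abs_le (by fun_prop) (C := 1) fun u => by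
      rw [abs_mul]
      exact mul_le_one₀ (hxk k u) (abs_nonneg _) (hs _)
  have hizc : Integrable (fun u => z u ^ 2 * Real.cos (r * x u)) (stdGaussian E) :=
    integrable_of_abs_le (by fun_prop) (C := 1) fun u => by
      rw [abs_mul, abs_pow]
      exact mul_le_one₀ (pow_le_one₀ (abs_nonneg _) (hz u)) (abs_nonneg _) (hc _)
  -- integration by parts with `x ↦ sin (r x)` and `x ↦ x cos (r x)`
  have hdsin : ∀ y, HasDerivAt (fun y => Real.sin (r * y)) (Real.cos (r * y) * r) y := fun y => by
    simpa using ((hasDerivAt_id y).const_mul r).sin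
  have hdcos : ∀ y, HasDerivAt (fun y => y * Real.cos (r * y))
      (1 * Real.cos (r * y) + y * (-Real.sin (r * y) * r)) y := fun y => by
    have h : HasDerivAt (fun y => Real.cos (r * y)) (-Real.sin (r * y) * r) y := by
      simpa using ((hasDerivAt_id y).const_mul r).cos
    exact (hasDerivAt_id y).mul h
  have h1 := integral_dirCoord_mul he hp hep hdsin (by fun_prop)
  have h2 := integral_dirCoord_mul he hp hep hdcos (by fun_prop)
  rw [← hx_def, ← hdd] at h1 h2
  have h3 : (d - 2) * ∫ u, z u ^ 2 * Real.cos (r * x u) ∂(stdGaussian E) =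
      ∫ u, (1 - x u ^ 2) * Real.cos (r * x u) ∂(stdGaussian E) := by
    rw [hdd]
    exact integral_dirCoord_sq_mul he hp hq hpq hep heq (g := fun y => Real.cos (r * y))
      (by fun_prop)
  set C0 := ∫ u, Real.cos (r * x u) ∂(stdGaussian E) with hC0
  set C2 := ∫ u, x u ^ 2 * Real.cos (r * x u) ∂(stdGaussian E) with hC2
  set S1 := ∫ u, x u * Real.sin (r * x u) ∂(stdGaussian E) with hS1
  set S3 := ∫ u, x u ^ 3 * Real.sin (r * x u) ∂(stdGaussian E) with hS3
  set Z2 := ∫ u, z u ^ 2 * Real.cos (r * x u) ∂(stdGaussian E) with hZ2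
  have hi0 : Integrable (fun u => Real.cos (r * x u)) (stdGaussian E) := by simpa using hic 0
  have hi1 : Integrable (fun u => x u * Real.sin (r * x u)) (stdGaussian E) := by
    simpa using his 1
  have k1 : (d - 2) * S1 = r * (C0 - C2) := by
    rw [h1, ← integral_sub hi0 (hic 2), ← integral_const_mul]
    refine integral_congr_ae (ae_of_all _ fun u => ?_)
    ring
  have k2 : (d - 2) * C2 = C0 - C2 - r * S1 + r * S3 := by
    have e1 : C2 = ∫ u, x u * (x u * Real.cos (r * x u)) ∂(stdGaussian E) :=
      integral_congr_ae (ae_of_all _ fun u => by ring)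
    conv_lhs => rw [e1, h2]
    trans 1 * C0 + (-1) * C2 + (-r) * S1 + r * S3
    · rw [hC0, hC2, hS1, hS3, ← integral_linear_combination hi0 (hic 2) hi1 (his 3)]
      refine integral_congr_ae (ae_of_all _ fun u => ?_)
      ring
    · ring
  have k3 : (d - 2) * Z2 = C0 - C2 := by
    rw [h3, ← integral_sub hi0 (hic 2)]
    refine integral_congr_ae (ae_of_all _ fun u => ?_)
    ring
  have hT : ∫ u, ((t ^ 2 + ((d - 2) * z u ^ 2 - d * x u ^ 2) / 2) *
        Real.cos (r * x u) - r * x u * Real.sin (r * x u)) ∂(stdGaussian E) =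
      t ^ 2 * C0 + (d - 2) / 2 * Z2 - d / 2 * C2 - r * S1 := by
    trans t ^ 2 * C0 + (d - 2) / 2 * Z2 + (-(d / 2)) * C2 + (-r) * S1
    · rw [hC0, hC2, hS1, hZ2, ← integral_linear_combination hi0 hizc (hic 2) hi1]
      refine integral_congr_ae (ae_of_all _ fun u => ?_)
      ring
    · ring
  have hT' : t ^ 2 * C0 + (d - 2) / 2 * Z2 - d / 2 * C2 - r * S1 =
      ∫ u, ((t ^ 2 - 1) * (x u ^ 2 * Real.cos (r * x u)) - r / d * (x u * Real.sin (r * x u)) -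
        r / 2 * (x u ^ 3 * Real.sin (r * x u))) ∂(stdGaussian E) := by
    have hlin : ∫ u, ((t ^ 2 - 1) * (x u ^ 2 * Real.cos (r * x u)) -
        r / d * (x u * Real.sin (r * x u)) - r / 2 * (x u ^ 3 * Real.sin (r * x u)))
        ∂(stdGaussian E) = 0 * C0 + (t ^ 2 - 1) * C2 + (-(r / d)) * S1 + (-(r / 2)) * S3 := by
      rw [hC0, hC2, hS1, hS3, ← integral_linear_combination hi0 (hic 2) hi1 (his 3)]
      refine integral_congr_ae (ae_of_all _ fun u => ?_)
      ring
    rw [hlin]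
    have k1' : 2 * d * (t ^ 2 * C0) = (d - 2) * (r * S1) + 2 * d * t ^ 2 * C2 := by
      rw [← hr]
      linear_combination (-1) * r * k1 - C0 * hr
    field_simp
    linear_combination k1' + d * k3 - d * k2
  rw [hT, hT']
  have hbound : ∀ u, |(t ^ 2 - 1) * (x u ^ 2 * Real.cos (r * x u)) -
      r / d * (x u * Real.sin (r * x u)) - r / 2 * (x u ^ 3 * Real.sin (r * x u))| ≤
      (1 + 3 * t ^ 2) * x u ^ 2 + d * t ^ 2 * x u ^ 4 := by
    intro u
    have hsin : |Real.sin (r * x u)| ≤ |r * x u| := Real.abs_sin_le_abs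
    have b1 : |(t ^ 2 - 1) * (x u ^ 2 * Real.cos (r * x u))| ≤ (1 + t ^ 2) * x u ^ 2 := by
      rw [abs_mul, abs_mul, abs_pow, sq_abs]
      refine mul_le_mul ?_ (mul_le_of_le_one_right (sq_nonneg _) (hc _)) (by positivity)
        (by positivity)
      rw [abs_le]
      constructor <;> nlinarith [sq_nonneg t]
    have b2 : |r / d * (x u * Real.sin (r * x u))| ≤ 2 * t ^ 2 * x u ^ 2 := by
      have : |r * x u * Real.sin (r * x u)| ≤ r ^ 2 * x u ^ 2 := by
        rw [abs_mul]
        calc _ ≤ |r * x u| * |r * x u| := mul_le_mul_of_nonneg_left hsin (abs_nonneg _)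
          _ = _ := by rw [abs_mul_abs_self]; ring
      rw [hr] at this
      rw [show r / d * (x u * Real.sin (r * x u)) = (r * x u * Real.sin (r * x u)) / d by ring,
        abs_div, abs_of_pos (by linarith : 0 < d), div_le_iff₀ (by linarith)]
      linarith
    have b3 : |r / 2 * (x u ^ 3 * Real.sin (r * x u))| ≤ d * t ^ 2 * x u ^ 4 := by
      have : |r * x u * Real.sin (r * x u)| ≤ r ^ 2 * x u ^ 2 := by
        rw [abs_mul]
        calc _ ≤ |r * x u| * |r * x u| := mul_le_mul_of_nonneg_left hsin (abs_nonneg _)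
          _ = _ := by rw [abs_mul_abs_self]; ring
      rw [hr] at this
      rw [show r / 2 * (x u ^ 3 * Real.sin (r * x u)) =
        (x u ^ 2 / 2) * (r * x u * Real.sin (r * x u)) by ring, abs_mul,
        abs_of_nonneg (by positivity : 0 ≤ x u ^ 2 / 2)]
      calc _ ≤ x u ^ 2 / 2 * (2 * d * t ^ 2 * x u ^ 2) := by gcongr
        _ = _ := by ring
    calc _ ≤ |(t ^ 2 - 1) * (x u ^ 2 * Real.cos (r * x u)) -
          r / d * (x u * Real.sin (r * x u))| + |r / 2 * (x u ^ 3 * Real.sin (r * x u))| :=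
          abs_sub _ _
      _ ≤ |(t ^ 2 - 1) * (x u ^ 2 * Real.cos (r * x u))| +
          |r / d * (x u * Real.sin (r * x u))| + |r / 2 * (x u ^ 3 * Real.sin (r * x u))| := by
          gcongr
          exact abs_sub _ _
      _ ≤ _ := by linarith
  calc _ ≤ ∫ u, ((1 + 3 * t ^ 2) * x u ^ 2 + d * t ^ 2 * x u ^ 4) ∂(stdGaussian E) := by
        refine (abs_integral_le_integral_abs).trans (integral_mono ?_ ?_ hbound)
        · exact ((((hic 2).const_mul _).sub (hi1.const_mul _)).sub ((his 3).const_mul _)).abs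
        · exact ((hik 2).const_mul _).add ((hik 4).const_mul _)
    _ = (1 + 3 * t ^ 2) * (1 / (d - 1)) + d * t ^ 2 * ∫ u, x u ^ 4 ∂(stdGaussian E) := by
        rw [integral_add ((hik 2).const_mul _) ((hik 4).const_mul _), integral_const_mul,
          integral_const_mul, hm2]
    _ ≤ (1 + 3 * t ^ 2) * (1 / (d - 1)) + d * t ^ 2 * (3 / (d * (d - 1))) := by
        gcongr
    _ = (1 + 6 * t ^ 2) / (d - 1) := by
        have : d - 1 ≠ 0 := by linarith
        field_simp
        ring

end Sphere

/-! ### Scaled residuals and the uniform second moment bound -/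

section ScaledResiduals

theorem sampleSD_nonneg (x : ℕ → ℝ) (n : ℕ) : 0 ≤ sampleSD x n := Real.sqrt_nonneg _

theorem sampleSD_sq (x : ℕ → ℝ) (n : ℕ) :
    sampleSD x n ^ 2 = (∑ j ∈ Finset.range n, (x j - sampleMean x n) ^ 2) / n :=
  Real.sq_sqrt (div_nonneg (Finset.sum_nonneg fun _ _ => sq_nonneg _) n.cast_nonneg)

theorem sampleSD_sq_eq (x : ℕ → ℝ) {n : ℕ} (hn : n ≠ 0) :
    sampleSD x n ^ 2 = (∑ j ∈ Finset.range n, x j ^ 2) / n - sampleMean x n ^ 2 := by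
  have hn' : (n : ℝ) ≠ 0 := Nat.cast_ne_zero.2 hn
  have hs : ∑ j ∈ Finset.range n, x j = n * sampleMean x n := by
    rw [sampleMean, mul_div_cancel₀ _ hn']
  have h : ∑ j ∈ Finset.range n, (x j - sampleMean x n) ^ 2 =
      ∑ j ∈ Finset.range n, x j ^ 2 - n * sampleMean x n ^ 2 := by
    simp only [sub_sq, Finset.sum_add_distrib, Finset.sum_sub_distrib, Finset.sum_const,
      Finset.card_range, nsmul_eq_mul]
    rw [← Finset.sum_mul, ← Finset.mul_sum, hs]
    ring
  rw [sampleSD_sq, h, sub_div, mul_div_cancel_left₀ _ hn']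

theorem sum_scaledResidual_sq_le (x : ℕ → ℝ) (n : ℕ) :
    ∑ j ∈ Finset.range n, scaledResidual x n j ^ 2 ≤ n := by
  simp only [scaledResidual, div_pow, ← Finset.sum_div]
  rcases n.eq_zero_or_pos with rfl | hn
  · simp
  refine div_le_of_le_mul₀ (sq_nonneg _) n.cast_nonneg ?_
  rw [sampleSD_sq, mul_div_cancel₀ _ (by positivity)]

theorem abs_scaledResidual_le (x : ℕ → ℝ) {n j : ℕ} (hj : j < n) :
    |scaledResidual x n j| ≤ n := by
  have h1 : scaledResidual x n j ^ 2 ≤ n :=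
    (Finset.single_le_sum (f := fun j => scaledResidual x n j ^ 2) (fun _ _ => sq_nonneg _)
      (Finset.mem_range.2 hj)).trans (sum_scaledResidual_sq_le x n)
  have h2 : (1 : ℝ) ≤ n := by exact_mod_cast (by omega : 1 ≤ n)
  refine abs_le_of_sq_le_sq (h1.trans ?_) n.cast_nonneg
  nlinarith

theorem sampleMean_affine (x : ℕ → ℝ) (a b : ℝ) {n : ℕ} (hn : n ≠ 0) :
    sampleMean (fun j => a + b * x j) n = a + b * sampleMean x n := by
  have hn' : (n : ℝ) ≠ 0 := Nat.cast_ne_zero.2 hn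
  simp only [sampleMean, Finset.sum_add_distrib, Finset.sum_const, Finset.card_range, nsmul_eq_mul,
    ← Finset.mul_sum]
  field_simp

/-- Scaled residuals are invariant under positive affine transformations of the data. -/
theorem scaledResidual_affine (x : ℕ → ℝ) (a : ℝ) {b : ℝ} (hb : 0 < b) (n j : ℕ) (hj : j < n) :
    scaledResidual (fun j => a + b * x j) n j = scaledResidual x n j := by
  have hn : n ≠ 0 := by omega
  have hdiff : ∀ j, a + b * x j - sampleMean (fun j => a + b * x j) n =
      b * (x j - sampleMean x n) := fun j => by
    rw [sampleMean_affine x a b hn]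
    ring
  have hSD : sampleSD (fun j => a + b * x j) n = b * sampleSD x n := by
    simp only [sampleSD, hdiff, mul_pow]
    rw [← Finset.mul_sum, mul_div_assoc, Real.sqrt_mul (by positivity), Real.sqrt_sq hb.le]
  rw [scaledResidual, hSD, hdiff, mul_div_mul_left _ _ hb.ne', scaledResidual]

theorem residualProcess_affine (x : ℕ → ℝ) (a : ℝ) {b : ℝ} (hb : 0 < b) (n : ℕ) (t : ℝ) :
    residualProcess (fun j => a + b * x j) n t = residualProcess x n t := by
  rw [residualProcess, residualProcess]
  congr 1
  refine Finset.sum_congr rfl fun j hj => ?_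
  rw [scaledResidual_affine x a hb n j (Finset.mem_range.1 hj)]

theorem measurable_sampleMean (n : ℕ) : Measurable fun x : ℕ → ℝ => sampleMean x n := by
  unfold sampleMean
  fun_prop

theorem measurable_sampleSD (n : ℕ) : Measurable fun x : ℕ → ℝ => sampleSD x n := by
  have := measurable_sampleMean n
  unfold sampleSD
  fun_prop

theorem measurable_scaledResidual (n j : ℕ) :
    Measurable fun x : ℕ → ℝ => scaledResidual x n j := by
  have := measurable_sampleMean n
  have := measurable_sampleSD n
  unfold scaledResidual
  fun_prop

theorem measurable_residualProcess (n : ℕ) :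
    Measurable fun p : (ℕ → ℝ) × ℝ => residualProcess p.1 n p.2 := by
  have := measurable_scaledResidual n
  unfold residualProcess
  fun_prop

/-- The summand of the squared modulus of the complex process
`∑ j, (t + i Y_j) exp (i t Y_j)`, whose real and imaginary parts add up to `√n W_n(t)`. -/
noncomputable def pairTerm (t y y' : ℝ) : ℝ :=
  (t ^ 2 + y * y') * Real.cos (t * (y - y')) - t * (y - y') * Real.sin (t * (y - y'))

theorem residualProcess_sq_le (x : ℕ → ℝ) (n : ℕ) (t : ℝ) :
    residualProcess x n t ^ 2 ≤ 2 / n * ∑ j ∈ Finset.range n, ∑ k ∈ Finset.range n,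
      pairTerm t (scaledResidual x n j) (scaledResidual x n k) := by
  set Y := scaledResidual x n
  set A : ℕ → ℝ := fun j => t * Real.cos (t * Y j) - Y j * Real.sin (t * Y j) with hA
  set B : ℕ → ℝ := fun j => t * Real.sin (t * Y j) + Y j * Real.cos (t * Y j) with hB
  have h1 : residualProcess x n t = (√(n : ℝ))⁻¹ *
      (∑ j ∈ Finset.range n, A j + ∑ j ∈ Finset.range n, B j) := by
    rw [residualProcess, ← Finset.sum_add_distrib]
    congr 1
    refine Finset.sum_congr rfl fun j _ => ?_
    simp only [hA, hB]
    ring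
  have h2 : ∑ j ∈ Finset.range n, ∑ k ∈ Finset.range n, pairTerm t (Y j) (Y k) =
      (∑ j ∈ Finset.range n, A j) ^ 2 + (∑ j ∈ Finset.range n, B j) ^ 2 := by
    rw [pow_two, pow_two, Finset.sum_mul_sum, Finset.sum_mul_sum, ← Finset.sum_add_distrib]
    refine Finset.sum_congr rfl fun j _ => ?_
    rw [← Finset.sum_add_distrib]
    refine Finset.sum_congr rfl fun k _ => ?_
    simp only [hA, hB, pairTerm, mul_sub, Real.cos_sub, Real.sin_sub]
    ring
  rw [h1, h2, mul_pow, inv_pow, Real.sq_sqrt n.cast_nonneg, div_eq_mul_inv, mul_comm (2 : ℝ),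
    mul_assoc]
  refine mul_le_mul_of_nonneg_left ?_ (by positivity)
  nlinarith [sq_nonneg (∑ j ∈ Finset.range n, A j - ∑ j ∈ Finset.range n, B j)]

/-- The residuals of a sample, seen as a vector in Euclidean space, are `√n` times the direction of
the component orthogonal to the vector of ones; a pair of them is expressed by two orthogonal
coordinates of that direction. -/
theorem exists_dirCoord_eq_scaledResidual {n : ℕ} (hn : 3 ≤ n) {j k : Fin n} (hjk : j ≠ k) :
    ∃ e p q : EuclideanSpace ℝ (Fin n), ‖e‖ = 1 ∧ ‖p‖ = 1 ∧ ‖q‖ = 1 ∧ ⟪p, q⟫ = 0 ∧ ⟪e, p⟫ = 0 ∧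
      ⟪e, q⟫ = 0 ∧ ∀ x : ℕ → ℝ,
        scaledResidual x n j - scaledResidual x n k =
          √(2 * n) * dirCoord e p (WithLp.toLp 2 fun i : Fin n => x i) ∧
        scaledResidual x n j + scaledResidual x n k =
          √(2 * n - 4) * dirCoord e q (WithLp.toLp 2 fun i : Fin n => x i) := by
  have hn3 : (3 : ℝ) ≤ n := by exact_mod_cast hn
  set a : EuclideanSpace ℝ (Fin n) := EuclideanSpace.single j 1 with ha
  set b : EuclideanSpace ℝ (Fin n) := EuclideanSpace.single k 1 with hb
  set o : EuclideanSpace ℝ (Fin n) := WithLp.toLp 2 fun _ => 1 with ho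
  have hav : ∀ v : EuclideanSpace ℝ (Fin n), ⟪a, v⟫ = v j := fun v => by
    rw [ha, EuclideanSpace.inner_single_left]
    simp
  have hbv : ∀ v : EuclideanSpace ℝ (Fin n), ⟪b, v⟫ = v k := fun v => by
    rw [hb, EuclideanSpace.inner_single_left]
    simp
  have hov : ∀ v : EuclideanSpace ℝ (Fin n), ⟪o, v⟫ = ∑ i, v i := fun v => by
    simp [ho, PiLp.inner_apply]
  have haa : ⟪a, a⟫ = 1 := by rw [hav]; simp [ha]
  have hbb : ⟪b, b⟫ = 1 := by rw [hbv]; simp [hb]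
  have hab : ⟪a, b⟫ = 0 := by rw [hav]; simp [hb, hjk]
  have hba : ⟪b, a⟫ = 0 := by rw [real_inner_comm]; exact hab
  have hao : ⟪a, o⟫ = 1 := hav o
  have hbo : ⟪b, o⟫ = 1 := hbv o
  have hoa : ⟪o, a⟫ = 1 := by rw [real_inner_comm]; exact hao
  have hob : ⟪o, b⟫ = 1 := by rw [real_inner_comm]; exact hbo
  have hoo : ⟪o, o⟫ = (n : ℝ) := by rw [hov]; simp [ho]
  have hnorm : ∀ v : EuclideanSpace ℝ (Fin n), ⟪v, v⟫ = 1 → ‖v‖ = 1 := fun v hv => by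
    rw [norm_eq_sqrt_real_inner, hv, Real.sqrt_one]
  have s1 : √(n : ℝ) ^ 2 = n := Real.sq_sqrt n.cast_nonneg
  have s2 : √(2 : ℝ) ^ 2 = 2 := Real.sq_sqrt (by norm_num)
  have s3 : √(2 - 4 / (n : ℝ)) ^ 2 = 2 - 4 / n := Real.sq_sqrt (by
    rw [sub_nonneg, div_le_iff₀ (by linarith)]
    linarith)
  have p1 : 0 < √(n : ℝ) := Real.sqrt_pos.2 (by linarith)
  have p2 : 0 < √(2 : ℝ) := by positivity
  have p3 : 0 < √(2 - 4 / (n : ℝ)) := Real.sqrt_pos.2 (by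
    rw [sub_pos, div_lt_iff₀ (by linarith)]
    linarith)
  set c := √(2 - 4 / (n : ℝ)) with hc
  clear_value c
  set e : EuclideanSpace ℝ (Fin n) := (√(n : ℝ))⁻¹ • o with he_def
  set p : EuclideanSpace ℝ (Fin n) := (√(2 : ℝ))⁻¹ • (a - b) with hp_def
  set q : EuclideanSpace ℝ (Fin n) := c⁻¹ • (a + b - (2 / (n : ℝ)) • o)
    with hq_def
  have he : ‖e‖ = 1 := hnorm e <| by
    simp only [he_def, inner_smul_left, inner_smul_right, hoo, RCLike.conj_to_real]
    field_simp
    exact s1.symm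
  refine ⟨e, p, q, he, hnorm p ?_, hnorm q ?_, ?_, ?_, ?_, fun x => ?_⟩
  · simp only [hp_def, inner_smul_left, inner_smul_right, inner_sub_left, inner_sub_right, haa, hab,
      hba, hbb, RCLike.conj_to_real]
    field_simp
    linarith
  · simp only [hq_def, inner_smul_left, inner_smul_right, inner_sub_left, inner_sub_right,
      inner_add_left, inner_add_right, haa, hab, hba, hbb, hao, hoa, hbo, hob, hoo,
      RCLike.conj_to_real]
    field_simp
    rw [s3]
    field_simp
    ring
  · simp only [hp_def, hq_def, inner_smul_left, inner_smul_right, inner_sub_left, inner_sub_right,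
      inner_add_right, haa, hab, hba, hbb, hao, hbo, RCLike.conj_to_real]
    ring
  · simp only [he_def, hp_def, inner_smul_left, inner_smul_right, inner_sub_right, hoa, hob,
      RCLike.conj_to_real]
    ring
  · simp only [he_def, hq_def, inner_smul_left, inner_smul_right, inner_sub_right,
      inner_add_right, hoa, hob, hoo, RCLike.conj_to_real]
    field_simp
    ring
  · set v : EuclideanSpace ℝ (Fin n) := WithLp.toLp 2 fun i : Fin n => x i with hv
    have hvi : ∀ i : Fin n, v i = x i := fun i => rfl
    have hmean : ∑ i, v i = n * sampleMean x n := by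
      rw [sampleMean, mul_div_cancel₀ _ (by linarith), Finset.sum_range]
    have hR : ‖v - ⟪e, v⟫ • e‖ = √(n : ℝ) * sampleSD x n := by
      rw [← Real.sqrt_sq (norm_nonneg (v - ⟪e, v⟫ • e)), norm_sub_inner_smul_sq he,
        ← Real.sqrt_sq (sampleSD_nonneg x n), ← Real.sqrt_mul n.cast_nonneg,
        sampleSD_sq_eq x (by omega)]
      congr 1
      rw [he_def, inner_smul_left, hov, hmean, EuclideanSpace.norm_sq_eq, Finset.sum_range]
      simp only [hvi, Real.norm_eq_abs, sq_abs, RCLike.conj_to_real, mul_pow, inv_pow, s1]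
      field_simp
    constructor
    · rw [dirCoord, hR, hp_def, inner_smul_left, inner_sub_left, hav, hbv, hvi, hvi,
        scaledResidual, scaledResidual, Real.sqrt_mul (by norm_num)]
      rcases eq_or_ne (sampleSD x n) 0 with h0 | h0
      · simp [h0]
      simp only [RCLike.conj_to_real]
      field_simp
      ring
    · have hs : √(2 * (n : ℝ) - 4) = √(n : ℝ) * c := by
        rw [hc, ← Real.sqrt_mul n.cast_nonneg]
        congr 1
        field_simp
      rw [dirCoord, hR, hq_def, inner_smul_left, inner_sub_left, inner_add_left, inner_smul_left,
        hav, hbv, hov, hmean, hvi, hvi, scaledResidual, scaledResidual, hs]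
      rcases eq_or_ne (sampleSD x n) 0 with h0 | h0
      · simp [h0]
      simp only [RCLike.conj_to_real]
      field_simp
      ring

variable {Ω : Type*} [MeasurableSpace Ω] {P : Measure Ω} [IsProbabilityMeasure P]

theorem map_toLp_eq_stdGaussian {U : ℕ → Ω → ℝ} (hindep : iIndepFun U P)
    (hlaw : ∀ j, HasLaw (U j) (gaussianReal 0 1) P) (n : ℕ) :
    P.map (fun ω => (WithLp.toLp 2 fun i : Fin n => U i ω : EuclideanSpace ℝ (Fin n))) =
      stdGaussian (EuclideanSpace ℝ (Fin n)) := by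
  have h1 : iIndepFun (fun (i : Fin n) => U i) P := hindep.precomp Fin.val_injective
  have hm : ∀ i : Fin n, AEMeasurable (U i) P := fun i => (hlaw i).aemeasurable
  have h2 := (iIndepFun_iff_map_fun_eq_pi_map hm).1 h1
  simp_rw [(hlaw _).map_eq] at h2
  have hL : Measurable (WithLp.toLp 2 : (Fin n → ℝ) → EuclideanSpace ℝ (Fin n)) := by fun_prop
  rw [← map_pi_eq_stdGaussian (ι := Fin n), ← h2,
    AEMeasurable.map_map_of_aemeasurable hL.aemeasurable (aemeasurable_pi_lambda _ hm)]
  rfl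

/-- Distinct summands of the process are nearly uncorrelated, uniformly in `t` up to the factor
`1 + 6 t ^ 2`. -/
theorem abs_integral_pairTerm_le {U : ℕ → Ω → ℝ} (hindep : iIndepFun U P)
    (hlaw : ∀ j, HasLaw (U j) (gaussianReal 0 1) P) {n : ℕ} (hn : 3 ≤ n) {j k : ℕ} (hj : j < n)
    (hk : k < n) (hjk : j ≠ k) (t : ℝ) :
    |∫ ω, pairTerm t (scaledResidual (fun i => U i ω) n j) (scaledResidual (fun i => U i ω) n k)
        ∂P| ≤ (1 + 6 * t ^ 2) / (n - 1) := by
  obtain ⟨e, p, q, he, hp, hq, hpq, hep, heq, hY⟩ := exists_dirCoord_eq_scaledResidual hn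
    (j := ⟨j, hj⟩) (k := ⟨k, hk⟩) (by simpa using hjk)
  have hn3 : (3 : ℝ) ≤ n := by exact_mod_cast hn
  have hm : ∀ i : Fin n, AEMeasurable (U i) P := fun i => (hlaw i).aemeasurable
  have key := abs_integral_dirCoord_cos_le he hp hq hpq hep heq (by simpa using hn)
    (t := t) (r := t * √(2 * n)) (d := n) (by simp)
    (by rw [mul_pow, Real.sq_sqrt (by positivity)]; ring)
  have hint : ∀ f : EuclideanSpace ℝ (Fin n) → ℝ, Measurable f →
      ∫ v, f v ∂(stdGaussian (EuclideanSpace ℝ (Fin n))) =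
        ∫ ω, f (WithLp.toLp 2 fun i : Fin n => U i ω) ∂P := fun f hf => by
    have hL : Measurable (WithLp.toLp 2 : (Fin n → ℝ) → EuclideanSpace ℝ (Fin n)) := by fun_prop
    rw [← map_toLp_eq_stdGaussian hindep hlaw n]
    exact integral_map (hL.comp_aemeasurable (aemeasurable_pi_lambda _ hm)) hf.aestronglyMeasurable
  rw [hint _ (by fun_prop)] at key
  refine (congrArg _ (integral_congr_ae (ae_of_all _ fun ω => ?_))).trans_le key
  · obtain ⟨h1, h2⟩ := hY fun i => U i ω
    simp only at h1 h2
    set Yj := scaledResidual (fun i => U i ω) n j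
    set Yk := scaledResidual (fun i => U i ω) n k
    set x := dirCoord e p (WithLp.toLp 2 fun i : Fin n => U i ω)
    set z := dirCoord e q (WithLp.toLp 2 fun i : Fin n => U i ω)
    have h3 : Yj * Yk = (((n : ℝ) - 2) * z ^ 2 - n * x ^ 2) / 2 := by
      have : Yj * Yk = ((Yj + Yk) ^ 2 - (Yj - Yk) ^ 2) / 4 := by ring
      rw [this, h1, h2, mul_pow, mul_pow, Real.sq_sqrt (by linarith), Real.sq_sqrt (by linarith)]
      ring
    rw [pairTerm, h3, h1, ← mul_assoc]

/-- The mean square of the process at `t` is bounded by a multiple of `1 + t ^ 2`, uniformly in the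
sample size. -/
theorem integral_residualProcess_sq_le {U : ℕ → Ω → ℝ} (hU : ∀ j, Measurable (U j))
    (hindep : iIndepFun U P) (hlaw : ∀ j, HasLaw (U j) (gaussianReal 0 1) P) {n : ℕ} (hn : 3 ≤ n)
    (t : ℝ) :
    Integrable (fun ω => residualProcess (fun i => U i ω) n t ^ 2) P ∧
    ∫ ω, residualProcess (fun i => U i ω) n t ^ 2 ∂P ≤ 4 + 14 * t ^ 2 := by
  have hn3 : (3 : ℝ) ≤ n := by exact_mod_cast hn
  have hUm : Measurable fun ω i => U i ω := measurable_pi_lambda _ hU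
  have hYm : ∀ j, Measurable fun ω => scaledResidual (fun i => U i ω) n j := fun j =>
    (measurable_scaledResidual n j).comp hUm
  have hpm : ∀ j k, Measurable fun ω => pairTerm t (scaledResidual (fun i => U i ω) n j)
      (scaledResidual (fun i => U i ω) n k) := fun j k => by
    unfold pairTerm
    fun_prop
  have hpb : ∀ j ∈ Finset.range n, ∀ k ∈ Finset.range n, ∀ ω,
      |pairTerm t (scaledResidual (fun i => U i ω) n j)
      (scaledResidual (fun i => U i ω) n k)| ≤ (t ^ 2 + n * n) + |t| * (n + n) := by
    intro j hj k hk ω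
    have h1 := abs_scaledResidual_le (fun i => U i ω) (Finset.mem_range.1 hj)
    have h2 := abs_scaledResidual_le (fun i => U i ω) (Finset.mem_range.1 hk)
    rw [pairTerm]
    refine (abs_sub _ _).trans (add_le_add ?_ ?_)
    · rw [abs_mul]
      refine (mul_le_of_le_one_right (abs_nonneg _) (Real.abs_cos_le_one _)).trans
        ((abs_add_le _ _).trans (add_le_add (by rw [abs_pow, sq_abs]) ?_))
      rw [abs_mul]
      exact mul_le_mul h1 h2 (abs_nonneg _) n.cast_nonneg
    · rw [abs_mul, abs_mul]
      refine (mul_le_of_le_one_right (by positivity) (Real.abs_sin_le_one _)).trans ?_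
      exact mul_le_mul_of_nonneg_left ((abs_sub _ _).trans (add_le_add h1 h2)) (abs_nonneg _)
  have hpi : ∀ j ∈ Finset.range n, ∀ k ∈ Finset.range n,
      Integrable (fun ω => pairTerm t (scaledResidual (fun i => U i ω) n j)
      (scaledResidual (fun i => U i ω) n k)) P := fun j hj k hk =>
    integrable_of_abs_le (hpm j k) (hpb j hj k hk)
  have hYi : ∀ j ∈ Finset.range n,
      Integrable (fun ω => scaledResidual (fun i => U i ω) n j ^ 2) P := fun j hj =>
    integrable_of_abs_le (by fun_prop) (C := (n : ℝ) ^ 2) fun ω => by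
      rw [abs_pow]
      exact pow_le_pow_left₀ (abs_nonneg _) (abs_scaledResidual_le _ (Finset.mem_range.1 hj)) 2
  have hsum : Integrable (fun ω => 2 / (n : ℝ) * ∑ j ∈ Finset.range n, ∑ k ∈ Finset.range n,
      pairTerm t (scaledResidual (fun i => U i ω) n j) (scaledResidual (fun i => U i ω) n k)) P :=
    (integrable_finsetSum _ fun j hj => integrable_finsetSum _ fun k hk =>
      hpi j hj k hk).const_mul _
  have hWm : Measurable fun ω => residualProcess (fun i => U i ω) n t ^ 2 :=
    ((measurable_residualProcess n).comp (hUm.prodMk measurable_const)).pow_const 2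
  have hWi : Integrable (fun ω => residualProcess (fun i => U i ω) n t ^ 2) P :=
    hsum.mono' hWm.aestronglyMeasurable (ae_of_all _ fun ω => by
      rw [Real.norm_of_nonneg (sq_nonneg _)]
      exact residualProcess_sq_le _ n t)
  refine ⟨hWi, (integral_mono hWi hsum fun ω => residualProcess_sq_le _ n t).trans ?_⟩
  rw [integral_const_mul, integral_finsetSum _ fun j hj => integrable_finsetSum _ fun k hk =>
      hpi j hj k hk]
  have hrow : ∀ j ∈ Finset.range n, ∫ ω, ∑ k ∈ Finset.range n,
      pairTerm t (scaledResidual (fun i => U i ω) n j) (scaledResidual (fun i => U i ω) n k) ∂P ≤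
      (t ^ 2 + ∫ ω, scaledResidual (fun i => U i ω) n j ^ 2 ∂P) + (1 + 6 * t ^ 2) := by
    intro j hj
    rw [integral_finsetSum _ fun k hk => hpi j hj k hk, ← Finset.add_sum_erase _ _ hj]
    refine add_le_add (le_of_eq ?_) ?_
    · have : ∀ ω, pairTerm t (scaledResidual (fun i => U i ω) n j)
          (scaledResidual (fun i => U i ω) n j) =
          t ^ 2 + scaledResidual (fun i => U i ω) n j ^ 2 := fun ω => by
        simp only [pairTerm, sub_self, mul_zero, Real.cos_zero, zero_mul, mul_one, sub_zero]
        ring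
      simp_rw [this]
      rw [integral_add (integrable_const _) (hYi j hj)]
      simp
    · calc _ ≤ ∑ k ∈ (Finset.range n).erase j, (1 + 6 * t ^ 2) / ((n : ℝ) - 1) := by
            refine Finset.sum_le_sum fun k hk => (le_abs_self _).trans ?_
            rw [Finset.mem_erase, Finset.mem_range] at hk
            exact abs_integral_pairTerm_le hindep hlaw hn (Finset.mem_range.1 hj) hk.2 hk.1.symm t
        _ = 1 + 6 * t ^ 2 := by
            rw [Finset.sum_const, Finset.card_erase_of_mem hj, Finset.card_range, nsmul_eq_mul,
              Nat.cast_sub (by omega), Nat.cast_one, mul_div_cancel₀ _ (by linarith)]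
  have hYsum : ∑ j ∈ Finset.range n, ∫ ω, scaledResidual (fun i => U i ω) n j ^ 2 ∂P ≤ n := by
    rw [← integral_finsetSum _ hYi]
    calc _ ≤ ∫ _, (n : ℝ) ∂P := integral_mono (integrable_finsetSum _ hYi) (integrable_const _)
          fun ω => sum_scaledResidual_sq_le _ n
      _ = n := by simp
  calc _ ≤ 2 / (n : ℝ) * ∑ j ∈ Finset.range n,
        ((t ^ 2 + ∫ ω, scaledResidual (fun i => U i ω) n j ^ 2 ∂P) + (1 + 6 * t ^ 2)) :=
        mul_le_mul_of_nonneg_left (Finset.sum_le_sum hrow) (by positivity)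
    _ ≤ 2 / (n : ℝ) * (n * t ^ 2 + n + n * (1 + 6 * t ^ 2)) := by
        refine mul_le_mul_of_nonneg_left ?_ (by positivity)
        simp only [Finset.sum_add_distrib, Finset.sum_const, Finset.card_range, nsmul_eq_mul]
        linarith
    _ = 4 + 14 * t ^ 2 := by
        field_simp
        ring

end ScaledResiduals

/-! ### Stein's identity -/

section GaussianIntegrals

theorem abs_iteratedDeriv_sin_cos_le_one (n : ℕ) (x : ℝ) :
    |iteratedDeriv n Real.sin x| ≤ 1 ∧ |iteratedDeriv n Real.cos x| ≤ 1 := by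
  induction n with
  | zero => simpa using ⟨Real.abs_sin_le_one x, Real.abs_cos_le_one x⟩
  | succ n ih =>
    rw [Real.iteratedDeriv_add_one_sin, Real.iteratedDeriv_add_one_cos]
    simpa using ih.symm

@[fun_prop]
theorem hasTemperateGrowth_sin : Real.sin.HasTemperateGrowth := by
  refine ⟨Real.contDiff_sin, fun n => ⟨0, 1, fun x => ?_⟩⟩
  simpa [norm_iteratedFDeriv_eq_norm_iteratedDeriv] using (abs_iteratedDeriv_sin_cos_le_one n x).1

@[fun_prop]
theorem hasTemperateGrowth_cos : Real.cos.HasTemperateGrowth := by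
  refine ⟨Real.contDiff_cos, fun n => ⟨0, 1, fun x => ?_⟩⟩
  simpa [norm_iteratedFDeriv_eq_norm_iteratedDeriv] using (abs_iteratedDeriv_sin_cos_le_one n x).2

@[fun_prop]
theorem hasTemperateGrowth_sin_comp {f : ℝ → ℝ} (hf : f.HasTemperateGrowth) :
    (fun x => Real.sin (f x)).HasTemperateGrowth := hasTemperateGrowth_sin.comp hf

@[fun_prop]
theorem hasTemperateGrowth_cos_comp {f : ℝ → ℝ} (hf : f.HasTemperateGrowth) :
    (fun x => Real.cos (f x)).HasTemperateGrowth := hasTemperateGrowth_cos.comp hf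

theorem integrable_one_add_abs_pow {μ : Measure ℝ} [IsFiniteMeasure μ] {k : ℕ}
    (h : MemLp (fun x : ℝ => x) k μ) : Integrable (fun x : ℝ => (1 + |x|) ^ k) μ := by
  have h1 : MemLp (fun _ : ℝ => (1 : ℝ)) k μ := memLp_const 1
  have h2 : MemLp (fun x : ℝ => 1 + ‖x‖) k μ := h1.add h.norm
  refine Integrable.congr h2.integrable_norm_pow' (ae_of_all _ fun x => ?_)
  simp only [Real.norm_eq_abs]
  rw [abs_of_nonneg (by positivity : 0 ≤ 1 + |x|)]

theorem integrable_one_add_abs_pow_gaussianReal (k : ℕ) :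
    Integrable (fun x : ℝ => (1 + |x|) ^ k) (gaussianReal 0 1) := by
  have hid := memLp_id_gaussianReal (μ := 0) (v := 1) (k : ℝ≥0)
  rw [ENNReal.coe_natCast] at hid
  exact integrable_one_add_abs_pow hid

theorem _root_.Function.HasTemperateGrowth.integrable_gaussianReal {f : ℝ → ℝ}
    (hf : f.HasTemperateGrowth) : Integrable f (gaussianReal 0 1) := by
  obtain ⟨k, C, h⟩ := hf.2 0
  refine ((integrable_one_add_abs_pow_gaussianReal k).const_mul C).mono'
    hf.1.continuous.aestronglyMeasurable (ae_of_all _ fun x => ?_)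
  simpa using h x

/-- The density of the standard normal law is, up to a constant, `exp (-x ^ 2 / 2)`. -/
theorem integral_gaussianReal_zero_one (f : ℝ → ℝ) :
    ∫ x, f x ∂(gaussianReal 0 1) = (√(2 * Real.pi))⁻¹ * ∫ x, f x * Real.exp (-x ^ 2 / 2) := by
  rw [integral_gaussianReal_eq_integral_smul one_ne_zero, ← integral_const_mul]
  refine integral_congr_ae (ae_of_all _ fun x => ?_)
  simp [gaussianPDFReal]
  ring

theorem _root_.Function.HasTemperateGrowth.integrable_mul_exp {f : ℝ → ℝ}
    (hf : f.HasTemperateGrowth) : Integrable fun x => f x * Real.exp (-x ^ 2 / 2) := by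
  have h := hf.integrable_gaussianReal
  rw [gaussianReal_of_var_ne_zero _ one_ne_zero, integrable_withDensity_iff_integrable_smul'
    (measurable_gaussianPDF _ _) (ae_of_all _ fun _ => gaussianPDF_lt_top)] at h
  refine (h.const_mul (√(2 * Real.pi))).congr (ae_of_all _ fun x => ?_)
  have : √Real.pi ≠ 0 := by positivity
  simp [gaussianPDFReal]
  field_simp

/-- Stein's identity for the standard normal law. -/
theorem integral_deriv_gaussianReal {g g' : ℝ → ℝ} (hg : g.HasTemperateGrowth)
    (hg' : g'.HasTemperateGrowth) (hd : ∀ x, HasDerivAt g (g' x) x) :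
    ∫ x, g' x ∂(gaussianReal 0 1) = ∫ x, x * g x ∂(gaussianReal 0 1) := by
  have hexp : ∀ x : ℝ, HasDerivAt (fun x : ℝ => Real.exp (-x ^ 2 / 2))
      (-(x * Real.exp (-x ^ 2 / 2))) x := fun x => by
    have h1 : HasDerivAt (fun x : ℝ => -x ^ 2 / 2) (-x) x := by
      have := ((hasDerivAt_pow 2 x).neg.div_const 2)
      exact this.congr_deriv (by push_cast; ring)
    convert h1.exp using 1
    ring
  have hxg : (fun x => x * g x).HasTemperateGrowth := by fun_prop
  have key := integral_mul_deriv_eq_deriv_mul_of_integrable (u := g) (u' := g')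
    (v := fun x : ℝ => Real.exp (-x ^ 2 / 2)) (v' := fun x => -(x * Real.exp (-x ^ 2 / 2)))
    (fun x _ => hd x) (fun x _ => hexp x)
    (hxg.integrable_mul_exp.neg.congr (ae_of_all _ fun x => by simp; ring))
    hg'.integrable_mul_exp hg.integrable_mul_exp
  rw [integral_gaussianReal_zero_one, integral_gaussianReal_zero_one, ← neg_neg (∫ x, g' x * _),
    ← key, ← integral_neg]
  congr 1
  refine integral_congr_ae (ae_of_all _ fun x => ?_)
  ring

/-- The Gaussian inner product of two functions of the form `φ' - x φ`. -/
theorem integral_deriv_sub_mul_deriv_sub {φ φ' ψ ψ' : ℝ → ℝ} (hφ : φ.HasTemperateGrowth)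
    (hφ' : φ'.HasTemperateGrowth) (hψ : ψ.HasTemperateGrowth) (hψ' : ψ'.HasTemperateGrowth)
    (hdφ : ∀ x, HasDerivAt φ (φ' x) x) (hdψ : ∀ x, HasDerivAt ψ (ψ' x) x) :
    ∫ x, (φ' x - x * φ x) * (ψ' x - x * ψ x) ∂(gaussianReal 0 1) =
      ∫ x, (φ x * ψ x + φ' x * ψ' x) ∂(gaussianReal 0 1) := by
  have hA : (fun x => x * (φ x * ψ x)).HasTemperateGrowth := by fun_prop
  have hA' : (fun x => 1 * (φ x * ψ x) + x * (φ' x * ψ x + φ x * ψ' x)).HasTemperateGrowth := by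
    fun_prop
  have hxA : (fun x => x * (x * (φ x * ψ x))).HasTemperateGrowth := by fun_prop
  -- the difference of the two sides is Stein's identity for `x φ ψ`
  have hS := integral_deriv_gaussianReal hA hA' fun x =>
    (hasDerivAt_id' x).fun_mul ((hdφ x).fun_mul (hdψ x))
  have h1 : (fun x => (φ' x - x * φ x) * (ψ' x - x * ψ x)).HasTemperateGrowth := by fun_prop
  have h2 : (fun x => φ x * ψ x + φ' x * ψ' x).HasTemperateGrowth := by fun_prop
  rw [← sub_eq_zero, ← integral_sub h1.integrable_gaussianReal h2.integrable_gaussianReal]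
  rw [← sub_eq_zero, ← integral_sub hA'.integrable_gaussianReal hxA.integrable_gaussianReal] at hS
  refine neg_eq_zero.1 (Eq.trans ?_ hS)
  rw [← integral_neg]
  refine integral_congr_ae (ae_of_all _ fun x => ?_)
  ring

/-- The Gaussian characteristic function, `E cos (t U)` for standard normal `U`. -/
noncomputable def gaussExp (t : ℝ) : ℝ := Real.exp (-t ^ 2 / 2)

theorem integral_cos_and_sin_gaussianReal (a : ℝ) :
    ∫ x, Real.cos (a * x) ∂(gaussianReal 0 1) = gaussExp a ∧
      ∫ x, Real.sin (a * x) ∂(gaussianReal 0 1) = 0 := by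
  rw [gaussExp]
  have h := charFun_gaussianReal (μ := 0) (v := 1) a
  rw [charFun_apply_real] at h
  have hi : Integrable (fun x : ℝ => Complex.exp (a * x * Complex.I)) (gaussianReal 0 1) := by
    refine (integrable_const (1 : ℝ)).mono' (by fun_prop) (ae_of_all _ fun x => ?_)
    rw [← Complex.ofReal_mul, Complex.norm_exp_ofReal_mul_I]
  have hrhs : Complex.exp (a * (0 : ℝ) * Complex.I - (1 : ℝ≥0) * a ^ 2 / 2) =
      (Real.exp (-a ^ 2 / 2) : ℂ) := by
    push_cast
    congr 1
    ring
  rw [hrhs] at h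
  have hre := congrArg Complex.re h
  have him := congrArg Complex.im h
  have e1 := integral_re (𝕜 := ℂ) hi
  have e2 := integral_im (𝕜 := ℂ) hi
  simp only [RCLike.re_to_complex, RCLike.im_to_complex] at e1 e2
  rw [← e1, Complex.ofReal_re] at hre
  rw [← e2, Complex.ofReal_im] at him
  constructor
  · rw [← hre]
    refine integral_congr_ae (ae_of_all _ fun x => ?_)
    simp only [← Complex.ofReal_mul, Complex.exp_ofReal_mul_I_re]
  · refine Eq.trans ?_ him
    refine integral_congr_ae (ae_of_all _ fun x => ?_)
    simp only [← Complex.ofReal_mul, Complex.exp_ofReal_mul_I_im]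

end GaussianIntegrals

/-! ### Gaussian expectations of the summands -/

section SteinTerm

/-- The summand of `W_n(t)` as a function of the residual: it is `f' - y f` for
`f y = sin (t y) - cos (t y)`. -/
noncomputable def steinTerm (t y : ℝ) : ℝ :=
  (y + t) * Real.cos (t * y) + (t - y) * Real.sin (t * y)

/-- The derivative of `steinTerm t`. -/
noncomputable def steinTermDeriv (t y : ℝ) : ℝ :=
  t * ((t - y) * Real.cos (t * y) - (y + t) * Real.sin (t * y)) +
    (Real.cos (t * y) - Real.sin (t * y))

/-- The summand of the linearization of `W_n(t)`: the last terms are the contributions of the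
estimated mean and standard deviation. -/
noncomputable def linearTerm (t y : ℝ) : ℝ :=
  steinTerm t y - gaussExp t * (y - t * (y ^ 2 - 1))

/-- `linearTerm t` is `φ' - y φ` for this `φ`. -/
noncomputable def linearPotential (t y : ℝ) : ℝ :=
  Real.sin (t * y) - Real.cos (t * y) + gaussExp t * (1 - t * y)

/-- The derivative of `linearPotential t`. -/
noncomputable def linearPotentialDeriv (t y : ℝ) : ℝ :=
  t * (Real.cos (t * y) + Real.sin (t * y)) - t * gaussExp t

theorem hasDerivAt_sin_mul (t y : ℝ) :
    HasDerivAt (fun y => Real.sin (t * y)) (t * Real.cos (t * y)) y := by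
  have h := ((hasDerivAt_id' y).const_mul t).sin
  exact h.congr_deriv (by ring)

theorem hasDerivAt_cos_mul (t y : ℝ) :
    HasDerivAt (fun y => Real.cos (t * y)) (-(t * Real.sin (t * y))) y := by
  have h := ((hasDerivAt_id' y).const_mul t).cos
  exact h.congr_deriv (by ring)

theorem hasDerivAt_steinTerm (t y : ℝ) :
    HasDerivAt (steinTerm t) (steinTermDeriv t y) y := by
  have h := (((hasDerivAt_id' y).add_const t).fun_mul (hasDerivAt_cos_mul t y)).fun_add
    (((hasDerivAt_id' y).const_sub t).fun_mul (hasDerivAt_sin_mul t y))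
  exact h.congr_deriv (by rw [steinTermDeriv]; ring)

theorem hasDerivAt_linearPotential (t y : ℝ) :
    HasDerivAt (linearPotential t) (linearPotentialDeriv t y) y := by
  have h := ((hasDerivAt_sin_mul t y).fun_sub (hasDerivAt_cos_mul t y)).fun_add
    ((((hasDerivAt_id' y).const_mul t).const_sub 1).const_mul (gaussExp t))
  exact h.congr_deriv (by rw [linearPotentialDeriv]; ring)

@[fun_prop]
theorem hasTemperateGrowth_steinTerm (t : ℝ) : (steinTerm t).HasTemperateGrowth := by
  unfold steinTerm
  fun_prop

@[fun_prop]
theorem hasTemperateGrowth_steinTermDeriv (t : ℝ) : (steinTermDeriv t).HasTemperateGrowth := by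
  unfold steinTermDeriv
  fun_prop

@[fun_prop]
theorem hasTemperateGrowth_linearTerm (t : ℝ) : (linearTerm t).HasTemperateGrowth := by
  unfold linearTerm
  fun_prop

@[fun_prop]
theorem hasTemperateGrowth_linearPotential (t : ℝ) :
    (linearPotential t).HasTemperateGrowth := by
  unfold linearPotential
  fun_prop

@[fun_prop]
theorem hasTemperateGrowth_linearPotentialDeriv (t : ℝ) :
    (linearPotentialDeriv t).HasTemperateGrowth := by
  unfold linearPotentialDeriv
  fun_prop

theorem linearTerm_eq (t y : ℝ) :
    linearTerm t y = linearPotentialDeriv t y - y * linearPotential t y := by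
  rw [linearTerm, steinTerm, linearPotential, linearPotentialDeriv]
  ring

theorem integral_linearTerm (t : ℝ) : ∫ x, linearTerm t x ∂(gaussianReal 0 1) = 0 := by
  have h1 : (fun x => x * linearPotential t x).HasTemperateGrowth := by fun_prop
  simp_rw [linearTerm_eq]
  rw [integral_sub (hasTemperateGrowth_linearPotentialDeriv t).integrable_gaussianReal
    h1.integrable_gaussianReal, integral_deriv_gaussianReal
    (hasTemperateGrowth_linearPotential t) (hasTemperateGrowth_linearPotentialDeriv t)
    (hasDerivAt_linearPotential t), sub_self]

theorem integral_id_gaussianReal_zero_one : ∫ x, x ∂(gaussianReal 0 1) = 0 := by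
  simp

theorem integral_sq_gaussianReal_zero_one : ∫ x, x ^ 2 ∂(gaussianReal 0 1) = 1 := by
  have h := integral_deriv_gaussianReal (g := fun x => x) (g' := fun _ => 1) (by fun_prop)
    (by fun_prop) fun x => hasDerivAt_id' x
  simpa [pow_two] using h.symm

theorem exp_neg_half_mul_gaussExp (s t : ℝ) :
    Real.exp (-(s ^ 2 + t ^ 2) / 2) = gaussExp s * gaussExp t := by
  rw [gaussExp, gaussExp, ← Real.exp_add]
  congr 1
  ring

/-- The covariance of the linearized summands is the limit kernel. -/
theorem integral_linearTerm_mul_linearTerm (s t : ℝ) :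
    ∫ x, linearTerm s x * linearTerm t x ∂(gaussianReal 0 1) = limitKernel s t := by
  simp_rw [linearTerm_eq]
  rw [integral_deriv_sub_mul_deriv_sub (hasTemperateGrowth_linearPotential s)
    (hasTemperateGrowth_linearPotentialDeriv s) (hasTemperateGrowth_linearPotential t)
    (hasTemperateGrowth_linearPotentialDeriv t) (hasDerivAt_linearPotential s)
    (hasDerivAt_linearPotential t)]
  have exc : ∀ r, ∫ x, x * Real.cos (r * x) ∂(gaussianReal 0 1) = 0 := fun r => by
    rw [← integral_deriv_gaussianReal (g := fun x => Real.cos (r * x))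
      (g' := fun x => -(r * Real.sin (r * x))) (by fun_prop) (by fun_prop)
      (hasDerivAt_cos_mul r), integral_neg, integral_const_mul,
      (integral_cos_and_sin_gaussianReal r).2, mul_zero, neg_zero]
  have exs : ∀ r, ∫ x, x * Real.sin (r * x) ∂(gaussianReal 0 1) = r * gaussExp r := fun r => by
    rw [← integral_deriv_gaussianReal (g := fun x => Real.sin (r * x))
      (g' := fun x => r * Real.cos (r * x)) (by fun_prop) (by fun_prop)
      (hasDerivAt_sin_mul r), integral_const_mul,
      (integral_cos_and_sin_gaussianReal r).1]
  -- products of trigonometric functions as sums; the grouping is that of nested four-term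
  -- linear combinations
  have e1 : ∀ x, linearPotential s x * linearPotential t x +
      linearPotentialDeriv s x * linearPotentialDeriv t x =
      1 * (1 * ((1 + s * t) * Real.cos ((s - t) * x) + (s * t - 1) * Real.sin ((s + t) * x) +
          (gaussExp t - s * t * gaussExp t) * Real.sin (s * x) +
          (-gaussExp t - s * t * gaussExp t) * Real.cos (s * x)) +
        1 * ((gaussExp s - s * t * gaussExp s) * Real.sin (t * x) +
          (-gaussExp s - s * t * gaussExp s) * Real.cos (t * x) +
          (- (gaussExp t * t)) * (x * Real.sin (s * x)) +
          (gaussExp t * t) * (x * Real.cos (s * x))) +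
        (- (gaussExp s * s)) * (x * Real.sin (t * x)) +
        (gaussExp s * s) * (x * Real.cos (t * x))) +
        (gaussExp s * gaussExp t * (1 + s * t)) * 1 +
        (- (gaussExp s * gaussExp t * (s + t))) * x +
        (gaussExp s * gaussExp t * (s * t)) * x ^ 2 := fun x => by
    rw [linearPotential, linearPotential, linearPotentialDeriv, linearPotentialDeriv, sub_mul s t x,
      add_mul s t x, Real.cos_sub, Real.sin_add]
    ring
  simp_rw [e1]
  rw [integral_linear_combination, integral_linear_combination, integral_linear_combination,
    integral_linear_combination]
  · simp only [exc, exs, integral_cos_and_sin_gaussianReal, integral_id_gaussianReal_zero_one,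
      integral_sq_gaussianReal_zero_one, integral_const, probReal_univ, smul_eq_mul]
    rw [limitKernel, exp_neg_half_mul_gaussExp, ← gaussExp]
    ring
  all_goals exact Function.HasTemperateGrowth.integrable_gaussianReal (by fun_prop)

/-- The Gaussian expectations that determine the linear effect of centring and of scaling. -/
theorem integral_steinTermDeriv (t : ℝ) :
    ∫ x, steinTermDeriv t x ∂(gaussianReal 0 1) = gaussExp t ∧
    ∫ x, x * steinTermDeriv t x ∂(gaussianReal 0 1) = -2 * t * gaussExp t := by
  have hf : ∀ x, HasDerivAt (fun y => Real.sin (t * y) - Real.cos (t * y))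
      (t * Real.cos (t * x) + t * Real.sin (t * x)) x := fun x =>
    ((hasDerivAt_sin_mul t x).fun_sub (hasDerivAt_cos_mul t x)).congr_deriv (by ring)
  have hc : ∀ r, Integrable (fun x => Real.cos (r * x)) (gaussianReal 0 1) := fun r =>
    Function.HasTemperateGrowth.integrable_gaussianReal (by fun_prop)
  have hs : ∀ r, Integrable (fun x => Real.sin (r * x)) (gaussianReal 0 1) := fun r =>
    Function.HasTemperateGrowth.integrable_gaussianReal (by fun_prop)
  have ef : ∫ x, (Real.sin (t * x) - Real.cos (t * x)) ∂(gaussianReal 0 1) = -gaussExp t := by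
    rw [integral_sub (hs t) (hc t), (integral_cos_and_sin_gaussianReal t).1,
      (integral_cos_and_sin_gaussianReal t).2, zero_sub]
  have ef' : ∫ x, (t * Real.cos (t * x) + t * Real.sin (t * x)) ∂(gaussianReal 0 1) =
      t * gaussExp t := by
    rw [integral_add ((hc t).const_mul t) ((hs t).const_mul t), integral_const_mul,
      integral_const_mul, (integral_cos_and_sin_gaussianReal t).1,
      (integral_cos_and_sin_gaussianReal t).2, mul_zero, add_zero]
  have exf := integral_deriv_gaussianReal (g := fun x => Real.sin (t * x) - Real.cos (t * x))
    (g' := fun x => t * Real.cos (t * x) + t * Real.sin (t * x)) (by fun_prop) (by fun_prop) hf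
  have hh : ∀ x, (t * Real.cos (t * x) + t * Real.sin (t * x)) -
      x * (Real.sin (t * x) - Real.cos (t * x)) = steinTerm t x := fun x => by
    rw [steinTerm]
    ring
  have ih : Integrable (steinTerm t) (gaussianReal 0 1) :=
    (hasTemperateGrowth_steinTerm t).integrable_gaussianReal
  have eh : ∫ x, steinTerm t x ∂(gaussianReal 0 1) = 0 := by
    simp_rw [← hh]
    rw [integral_sub, exf, sub_self] <;>
      exact Function.HasTemperateGrowth.integrable_gaussianReal (by fun_prop)
  constructor
  · rw [integral_deriv_gaussianReal (hasTemperateGrowth_steinTerm t)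
      (hasTemperateGrowth_steinTermDeriv t) (hasDerivAt_steinTerm t)]
    have h := integral_deriv_sub_mul_deriv_sub (φ := fun _ => 1) (φ' := fun _ => 0)
      (ψ := fun x => Real.sin (t * x) - Real.cos (t * x))
      (ψ' := fun x => t * Real.cos (t * x) + t * Real.sin (t * x)) (by fun_prop) (by fun_prop)
      (by fun_prop) (by fun_prop) (fun x => hasDerivAt_const x 1) hf
    simp only [hh, mul_one, zero_sub, one_mul, zero_mul, add_zero, neg_mul, integral_neg, ef] at h
    exact neg_inj.1 h
  · have h := integral_deriv_sub_mul_deriv_sub (φ := fun x => x) (φ' := fun _ => 1)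
      (ψ := fun x => Real.sin (t * x) - Real.cos (t * x))
      (ψ' := fun x => t * Real.cos (t * x) + t * Real.sin (t * x)) (by fun_prop) (by fun_prop)
      (by fun_prop) (by fun_prop) (fun x => hasDerivAt_id' x) hf
    simp only [hh, one_mul, sub_mul] at h
    have h2 := integral_deriv_gaussianReal (g := fun x => x * steinTerm t x)
      (g' := fun x => 1 * steinTerm t x + x * steinTermDeriv t x) (by fun_prop) (by fun_prop)
      fun x => (hasDerivAt_id' x).fun_mul (hasDerivAt_steinTerm t x)
    simp only [one_mul, ← mul_assoc] at h2
    rw [integral_sub ih (Function.HasTemperateGrowth.integrable_gaussianReal (by fun_prop)), ← h2,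
      integral_add, integral_add, ← exf, ef', eh] at h
    · linarith
    all_goals exact Function.HasTemperateGrowth.integrable_gaussianReal (by fun_prop)

end SteinTerm

/-! ### Linearization of the process -/

section Linearization

theorem abs_cos_sub_one_le_abs (θ : ℝ) : |Real.cos θ - 1| ≤ |θ| := by
  have h1 := Real.one_sub_sq_div_two_le_cos (x := θ)
  have h2 := Real.cos_le_one θ
  have h3 := Real.neg_one_le_cos θ
  rw [abs_of_nonpos (by linarith)]
  rcases le_total |θ| 2 with h | h
  · nlinarith [sq_abs θ, abs_nonneg θ]
  · linarith

theorem abs_cos_sub_one_le_sq (θ : ℝ) : |Real.cos θ - 1| ≤ θ ^ 2 := by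
  rw [abs_of_nonpos (by linarith [Real.cos_le_one θ])]
  nlinarith [Real.one_sub_sq_div_two_le_cos (x := θ)]

theorem abs_sin_sub_le_sq (θ : ℝ) : |Real.sin θ - θ| ≤ 2 * θ ^ 2 := by
  have key : ∀ θ : ℝ, 0 < θ → |Real.sin θ - θ| ≤ 2 * θ ^ 2 := fun θ h => by
    rw [abs_of_nonpos (by linarith [Real.sin_lt h])]
    rcases le_total θ 1 with h1 | h1
    · have := Real.sin_gt_sub_cube h
      have h2 : θ ^ 3 ≤ θ ^ 2 := pow_le_pow_of_le_one h.le h1 (by norm_num)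
      nlinarith
    · nlinarith [Real.neg_one_le_sin θ]
  rcases lt_trichotomy θ 0 with h | rfl | h
  · have := key (-θ) (by linarith)
    rwa [Real.sin_neg, neg_sq, neg_sub_neg, abs_sub_comm] at this
  · simp
  · exact key θ h

theorem abs_add_mul_cos_sin_le (a b c θ : ℝ) (ha : |a| ≤ c) (hb : |b| ≤ c) :
    |a * Real.cos θ + b * Real.sin θ| ≤ 2 * c := by
  refine (abs_add_le _ _).trans ?_
  rw [abs_mul, abs_mul, two_mul]
  exact add_le_add ((mul_le_of_le_one_right (abs_nonneg _) (Real.abs_cos_le_one _)).trans ha)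
    ((mul_le_of_le_one_right (abs_nonneg _) (Real.abs_sin_le_one _)).trans hb)

/-- Second-order Taylor estimate for the summands of `W_n(t)`. -/
theorem abs_steinTerm_add_sub_le (t y δ : ℝ) :
    |steinTerm t (y + δ) - steinTerm t y - δ * steinTermDeriv t y| ≤
      (10 * t ^ 2 * (1 + |t|) + 4 * |t|) * (1 + |y|) * δ ^ 2 := by
  set k := (t - y) * Real.cos (t * y) + (-(y + t)) * Real.sin (t * y) with hk
  set g := 1 * Real.cos (t * y) + (-1) * Real.sin (t * y) with hg
  set g' := 1 * Real.cos (t * y) + 1 * Real.sin (t * y) with hg'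
  -- exact expansion by the addition formulas, with remainders of cosine and sine at `t * δ`
  have e : steinTerm t (y + δ) - steinTerm t y - δ * steinTermDeriv t y =
      steinTerm t y * (Real.cos (t * δ) - 1) + k * (Real.sin (t * δ) - t * δ) +
        δ * g * (Real.cos (t * δ) - 1) - δ * g' * Real.sin (t * δ) := by
    rw [steinTerm, steinTerm, steinTermDeriv, mul_add t y δ, Real.cos_add, Real.sin_add, hk, hg,
      hg']
    ring
  have h1 : |steinTerm t y| ≤ 2 * (|t| + |y|) :=
    abs_add_mul_cos_sin_le _ _ _ _ ((abs_add_le _ _).trans_eq (add_comm _ _)) (abs_sub _ _)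
  have h2 : |k| ≤ 2 * (|t| + |y|) := abs_add_mul_cos_sin_le _ _ _ _ (abs_sub _ _) (by
    rw [abs_neg]
    exact (abs_add_le _ _).trans_eq (add_comm _ _))
  have h3 : |g| ≤ 2 * 1 := abs_add_mul_cos_sin_le _ _ _ _ (by simp) (by simp)
  have h4 : |g'| ≤ 2 * 1 := abs_add_mul_cos_sin_le _ _ _ _ (by simp) (by simp)
  have t1 : |steinTerm t y * (Real.cos (t * δ) - 1)| ≤ 2 * (|t| + |y|) * (t * δ) ^ 2 := by
    rw [abs_mul]
    exact mul_le_mul h1 (abs_cos_sub_one_le_sq _) (abs_nonneg _) (by positivity)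
  have t2 : |k * (Real.sin (t * δ) - t * δ)| ≤ 2 * (|t| + |y|) * (2 * (t * δ) ^ 2) := by
    rw [abs_mul]
    exact mul_le_mul h2 (abs_sin_sub_le_sq _) (abs_nonneg _) (by positivity)
  have t3 : |δ * g * (Real.cos (t * δ) - 1)| ≤ |δ| * (2 * 1) * |t * δ| := by
    rw [abs_mul, abs_mul]
    exact mul_le_mul (mul_le_mul_of_nonneg_left h3 (abs_nonneg _)) (abs_cos_sub_one_le_abs _)
      (abs_nonneg _) (by positivity)
  have t4 : |δ * g' * Real.sin (t * δ)| ≤ |δ| * (2 * 1) * |t * δ| := by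
    rw [abs_mul, abs_mul]
    exact mul_le_mul (mul_le_mul_of_nonneg_left h4 (abs_nonneg _)) Real.abs_sin_le_abs
      (abs_nonneg _) (by positivity)
  have h5 : |δ| * (2 * 1) * |t * δ| = 2 * |t| * δ ^ 2 := by
    rw [abs_mul, ← sq_abs δ]
    ring
  rw [h5] at t3 t4
  rw [e]
  have h6 : |t| + |y| ≤ (1 + |t|) * (1 + |y|) := by nlinarith [abs_nonneg t, abs_nonneg y]
  calc _ ≤ 2 * (|t| + |y|) * (t * δ) ^ 2 + 2 * (|t| + |y|) * (2 * (t * δ) ^ 2) +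
        2 * |t| * δ ^ 2 + 2 * |t| * δ ^ 2 :=
        (abs_sub _ _).trans (add_le_add ((abs_add_le _ _).trans
          (add_le_add ((abs_add_le _ _).trans (add_le_add t1 t2)) t3)) t4)
    _ = (6 * t ^ 2 * (|t| + |y|) + 4 * |t|) * δ ^ 2 := by ring
    _ ≤ (10 * t ^ 2 * ((1 + |t|) * (1 + |y|)) + 4 * |t| * (1 + |y|)) * δ ^ 2 := by
        refine mul_le_mul_of_nonneg_right (add_le_add ?_ ?_) (sq_nonneg _)
        · exact mul_le_mul (by nlinarith [sq_nonneg t]) h6 (by positivity) (by positivity)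
        · exact le_mul_of_one_le_right (by positivity) (by linarith [abs_nonneg y])
    _ = _ := by ring

theorem gaussExp_pos (t : ℝ) : 0 < gaussExp t := Real.exp_pos _

theorem gaussExp_le_one (t : ℝ) : gaussExp t ≤ 1 :=
  Real.exp_le_one_iff.2 (by nlinarith [sq_nonneg t])

/-- The difference between `W_n(t)`, computed from the data `x`, and its linearization. -/
noncomputable def linearizationError (x : ℕ → ℝ) (n : ℕ) (t : ℝ) : ℝ :=
  residualProcess x n t - (√(n : ℝ))⁻¹ * ∑ j ∈ Finset.range n, linearTerm t (x j)

/-- The linearization error is small when the sample mean and the sample standard deviation are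
within `B / √n` of `0` and `1`, and the empirical means of `steinTermDeriv t y` and
`y * steinTermDeriv t y` are close to their Gaussian expectations. -/
theorem abs_linearizationError_le {B : ℝ} (hB : 0 ≤ B) (t : ℝ) {x : ℕ → ℝ} {n : ℕ} (hn : 0 < n)
    (hS : 1 / 2 ≤ sampleSD x n) (ha : |√(n : ℝ) * sampleMean x n| ≤ B)
    (hS' : |√(n : ℝ) * (sampleSD x n - 1)| ≤ B) :
    |linearizationError x n t| ≤
      2 * B * |sampleMean (fun j => steinTermDeriv t (x j) - gaussExp t) n| +
      2 * B * |sampleMean (fun j => x j * steinTermDeriv t (x j) + 2 * t * gaussExp t) n| +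
      ((2 + 6 * |t| + 4 * (10 * t ^ 2 * (1 + |t|) + 4 * |t|)) * B ^ 2) * (√(n : ℝ))⁻¹ *
        sampleMean (fun j => (1 + |x j|) ^ 3) n := by
  set r := √(n : ℝ) with hr_def
  have hr : 0 < r := Real.sqrt_pos.2 (by exact_mod_cast hn)
  have hr2 : (n : ℝ) = r ^ 2 := (Real.sq_sqrt n.cast_nonneg).symm
  set S := sampleSD x n with hS_def
  set a := sampleMean x n with ha_def
  set e := gaussExp t with he_def
  set D := 10 * t ^ 2 * (1 + |t|) + 4 * |t| with hD_def
  have hD : 0 ≤ D := by positivity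
  have hS0 : 0 < S := by linarith
  have hsum : ∀ f : ℕ → ℝ, ∑ j ∈ Finset.range n, f j = r ^ 2 * sampleMean f n := fun f => by
    rw [sampleMean, hr2]
    field_simp
  set m1 := sampleMean (fun j => steinTermDeriv t (x j) - e) n with hm1
  set m2 := sampleMean (fun j => x j * steinTermDeriv t (x j) + 2 * t * e) n with hm2
  set m3 := sampleMean (fun j => (1 + |x j|) ^ 3) n with hm3
  have hm3_one : 1 ≤ m3 := by
    rw [hm3, sampleMean, le_div_iff₀ (by exact_mod_cast hn), one_mul]
    calc (n : ℝ) = ∑ j ∈ Finset.range n, (1 : ℝ) := by simp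
      _ ≤ _ := Finset.sum_le_sum fun j _ => one_le_pow₀ (by linarith [abs_nonneg (x j)])
  -- the residuals are the data shifted by `δ`, and `ρ` is the Taylor remainder
  set δ : ℕ → ℝ := fun j => -(a + (S - 1) * x j) / S with hδ
  have hY : ∀ j, scaledResidual x n j = x j + δ j := fun j => by
    rw [scaledResidual, hδ, ← ha_def, ← hS_def]
    field_simp
    ring
  set ρ : ℕ → ℝ := fun j =>
    steinTerm t (x j + δ j) - steinTerm t (x j) - δ j * steinTermDeriv t (x j) with hρ
  have hδ_le : ∀ j, δ j ^ 2 ≤ 4 * B ^ 2 / r ^ 2 * (1 + |x j|) ^ 2 := fun j => by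
    have h1 : |δ j| ≤ 2 * (B / r) * (1 + |x j|) := by
      have e1 : |a| ≤ B / r := by
        rw [le_div_iff₀ hr]
        rwa [abs_mul, abs_of_pos hr, mul_comm] at ha
      have e2 : |S - 1| ≤ B / r := by
        rw [le_div_iff₀ hr]
        rwa [abs_mul, abs_of_pos hr, mul_comm] at hS'
      rw [hδ, abs_div, abs_neg, abs_of_pos hS0, div_le_iff₀ hS0]
      have h2 : |a + (S - 1) * x j| ≤ B / r * (1 + |x j|) := by
        refine (abs_add_le _ _).trans ?_
        rw [mul_add, mul_one, abs_mul]
        exact add_le_add e1 (mul_le_mul_of_nonneg_right e2 (abs_nonneg _))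
      have h3 : 0 ≤ B / r * (1 + |x j|) := by positivity
      nlinarith
    calc δ j ^ 2 = |δ j| ^ 2 := (sq_abs _).symm
      _ ≤ (2 * (B / r) * (1 + |x j|)) ^ 2 := pow_le_pow_left₀ (abs_nonneg _) h1 2
      _ = _ := by ring
  have hρ_le : |∑ j ∈ Finset.range n, ρ j| ≤ 4 * D * B ^ 2 * m3 := by
    calc |∑ j ∈ Finset.range n, ρ j| ≤ ∑ j ∈ Finset.range n, |ρ j| :=
          Finset.abs_sum_le_sum_abs _ _
      _ ≤ ∑ j ∈ Finset.range n, 4 * D * B ^ 2 / r ^ 2 * (1 + |x j|) ^ 3 := by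
          refine Finset.sum_le_sum fun j _ => (abs_steinTerm_add_sub_le t (x j) (δ j)).trans ?_
          calc _ ≤ D * (1 + |x j|) * (4 * B ^ 2 / r ^ 2 * (1 + |x j|) ^ 2) :=
                mul_le_mul_of_nonneg_left (hδ_le j) (by positivity)
            _ = _ := by ring
      _ = 4 * D * B ^ 2 * m3 := by
          rw [← Finset.mul_sum, hsum, ← hm3]
          field_simp
  have hS2 := sampleSD_sq_eq x hn.ne'
  have hsq : ∑ j ∈ Finset.range n, x j ^ 2 = r ^ 2 * (S ^ 2 + a ^ 2) := by
    rw [hS_def, hS2, hr2]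
    field_simp
    ring
  have hsum_h : ∑ j ∈ Finset.range n, steinTermDeriv t (x j) = r ^ 2 * (m1 + e) := by
    have := hsum fun j => steinTermDeriv t (x j) - e
    rw [Finset.sum_sub_distrib, Finset.sum_const, Finset.card_range, nsmul_eq_mul, hr2] at this
    linarith
  have hsum_xh : ∑ j ∈ Finset.range n, x j * steinTermDeriv t (x j) =
      r ^ 2 * (m2 - 2 * t * e) := by
    have := hsum fun j => x j * steinTermDeriv t (x j) + 2 * t * e
    rw [Finset.sum_add_distrib, Finset.sum_const, Finset.card_range, nsmul_eq_mul, hr2] at this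
    linarith
  have hterm : ∀ j, steinTerm t (x j + δ j) - linearTerm t (x j) =
      (-a / S) * steinTermDeriv t (x j) + (-(S - 1) / S) * (x j * steinTermDeriv t (x j)) +
        e * x j - e * t * x j ^ 2 + e * t + ρ j := fun j => by
    simp only [hρ, hδ, linearTerm, ← he_def]
    field_simp
    ring
  -- `S ^ 2 = 1 + q - a ^ 2` with `q` the mean of `x ^ 2 - 1`, so `q - 2 (S - 1) / S` is quadratic
  -- in `a` and `S - 1`; everything linear in these cancels except for the terms with `m1` and `m2`
  have hexp : linearizationError x n t =
      -(r * a) * m1 / S + (r * a) * (r * (S - 1)) * e / S * r⁻¹ - (r * (S - 1)) * m2 / S -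
        t * e * ((r * a) ^ 2 + (r * (S - 1)) ^ 2 * (1 + 2 / S)) * r⁻¹ +
        r⁻¹ * ∑ j ∈ Finset.range n, ρ j := by
    have h0 : linearizationError x n t = r⁻¹ * ∑ j ∈ Finset.range n,
        (steinTerm t (x j + δ j) - linearTerm t (x j)) := by
      rw [linearizationError, residualProcess, ← mul_sub, ← Finset.sum_sub_distrib]
      simp only [hY, steinTerm, hr_def]
    rw [h0]
    simp only [hterm, Finset.sum_add_distrib, Finset.sum_sub_distrib, ← Finset.mul_sum, hsum_h,
      hsum_xh, hsq, Finset.sum_const, Finset.card_range, nsmul_eq_mul]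
    rw [hsum x, ← ha_def, hr2]
    field_simp
    ring
  have hiS : 1 / S ≤ 2 := by
    rw [div_le_iff₀ hS0]
    linarith
  have hiS0 : 0 ≤ 1 / S := by positivity
  have he1 : |e| ≤ 1 := by
    rw [abs_of_pos (gaussExp_pos t)]
    exact gaussExp_le_one t
  have b1 : |-(r * a) * m1 / S| ≤ 2 * B * |m1| := by
    rw [div_eq_mul_one_div, abs_mul, abs_mul, abs_neg, abs_of_nonneg hiS0]
    calc |r * a| * |m1| * (1 / S) ≤ B * |m1| * 2 :=
          mul_le_mul (mul_le_mul_of_nonneg_right ha (abs_nonneg _)) hiS hiS0 (by positivity)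
      _ = _ := by ring
  have b2 : |(r * a) * (r * (S - 1)) * e / S * r⁻¹| ≤ 2 * B ^ 2 * r⁻¹ := by
    rw [abs_mul, abs_of_pos (inv_pos.2 hr)]
    refine mul_le_mul_of_nonneg_right ?_ (inv_pos.2 hr).le
    rw [div_eq_mul_one_div, abs_mul, abs_mul, abs_mul (r * a), abs_of_nonneg hiS0]
    calc |r * a| * |r * (S - 1)| * |e| * (1 / S) ≤ B * B * 1 * 2 :=
          mul_le_mul (mul_le_mul (mul_le_mul ha hS' (abs_nonneg _) hB) he1 (abs_nonneg _)
            (by positivity)) hiS hiS0 (by positivity)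
      _ = _ := by ring
  have b3 : |(r * (S - 1)) * m2 / S| ≤ 2 * B * |m2| := by
    rw [div_eq_mul_one_div, abs_mul, abs_mul, abs_of_nonneg hiS0]
    calc |r * (S - 1)| * |m2| * (1 / S) ≤ B * |m2| * 2 :=
          mul_le_mul (mul_le_mul_of_nonneg_right hS' (abs_nonneg _)) hiS hiS0 (by positivity)
      _ = _ := by ring
  have b4 : |t * e * ((r * a) ^ 2 + (r * (S - 1)) ^ 2 * (1 + 2 / S)) * r⁻¹| ≤
      6 * |t| * B ^ 2 * r⁻¹ := by
    rw [abs_mul, abs_of_pos (inv_pos.2 hr)]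
    refine mul_le_mul_of_nonneg_right ?_ (inv_pos.2 hr).le
    have q1 : (r * a) ^ 2 ≤ B ^ 2 := by
      rw [← sq_abs]
      exact pow_le_pow_left₀ (abs_nonneg _) ha 2
    have q2 : (r * (S - 1)) ^ 2 ≤ B ^ 2 := by
      rw [← sq_abs]
      exact pow_le_pow_left₀ (abs_nonneg _) hS' 2
    have q3 : 1 + 2 / S ≤ 5 := by
      have : 2 / S = 2 * (1 / S) := by ring
      linarith
    have q4 : 0 ≤ 1 + 2 / S := by positivity
    rw [abs_mul, abs_mul, abs_of_nonneg (by positivity : 0 ≤ (r * a) ^ 2 +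
      (r * (S - 1)) ^ 2 * (1 + 2 / S))]
    calc |t| * |e| * ((r * a) ^ 2 + (r * (S - 1)) ^ 2 * (1 + 2 / S)) ≤
          |t| * 1 * (B ^ 2 + B ^ 2 * 5) :=
          mul_le_mul (mul_le_mul_of_nonneg_left he1 (abs_nonneg _))
            (add_le_add q1 (mul_le_mul q2 q3 q4 (by positivity))) (by positivity) (by positivity)
      _ = _ := by ring
  have b5 : |r⁻¹ * ∑ j ∈ Finset.range n, ρ j| ≤ r⁻¹ * (4 * D * B ^ 2 * m3) := by
    rw [abs_mul, abs_of_pos (inv_pos.2 hr)]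
    exact mul_le_mul_of_nonneg_left hρ_le (inv_pos.2 hr).le
  rw [hexp]
  calc _ ≤ 2 * B * |m1| + 2 * B ^ 2 * r⁻¹ + 2 * B * |m2| + 6 * |t| * B ^ 2 * r⁻¹ +
        r⁻¹ * (4 * D * B ^ 2 * m3) :=
        (abs_add_le _ _).trans (add_le_add ((abs_sub _ _).trans (add_le_add ((abs_sub _ _).trans
          (add_le_add ((abs_add_le _ _).trans (add_le_add b1 b2)) b3)) b4)) b5)
    _ = 2 * B * |m1| + 2 * B * |m2| + (2 + 6 * |t|) * B ^ 2 * r⁻¹ * 1 +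
        4 * D * B ^ 2 * r⁻¹ * m3 := by ring
    _ ≤ 2 * B * |m1| + 2 * B * |m2| + (2 + 6 * |t|) * B ^ 2 * r⁻¹ * m3 +
        4 * D * B ^ 2 * r⁻¹ * m3 := by
        have : 0 ≤ (2 + 6 * |t|) * B ^ 2 * r⁻¹ := by positivity
        gcongr
    _ = _ := by ring

end Linearization

/-! ### The linearization error tends to zero -/

section RemainderBound

variable {Ω : Type*} [MeasurableSpace Ω] {P : Measure Ω}

theorem sqrt_mul_sampleMean (x : ℕ → ℝ) (n : ℕ) :
    √(n : ℝ) * sampleMean x n = (√(n : ℝ))⁻¹ * ∑ j ∈ Finset.range n, x j := by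
  rcases n.eq_zero_or_pos with rfl | hn
  · simp
  have hr : 0 < √(n : ℝ) := Real.sqrt_pos.2 (by exact_mod_cast hn)
  rw [sampleMean]
  nth_rw 2 [← Real.mul_self_sqrt n.cast_nonneg]
  field_simp

theorem _root_.Function.HasTemperateGrowth.integrable_comp {f : ℝ → ℝ} (hf : f.HasTemperateGrowth)
    {X : Ω → ℝ} (hX : HasLaw X (gaussianReal 0 1) P) : Integrable (fun ω => f (X ω)) P := by
  have h := hf.integrable_gaussianReal
  rw [← hX.map_eq] at h
  exact h.comp_aemeasurable hX.aemeasurable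

theorem _root_.Function.HasTemperateGrowth.integral_comp {f : ℝ → ℝ} (hf : f.HasTemperateGrowth)
    {X : Ω → ℝ} (hX : HasLaw X (gaussianReal 0 1) P) :
    ∫ ω, f (X ω) ∂P = ∫ x, f x ∂(gaussianReal 0 1) :=
  hX.integral_comp hf.1.continuous.aestronglyMeasurable

theorem integrable_sampleMean_one_add_abs_pow {U : ℕ → Ω → ℝ}
    (hlaw : ∀ j, HasLaw (U j) (gaussianReal 0 1) P) (k : ℕ) {n : ℕ} (hn : 0 < n) :
    Integrable (fun ω => sampleMean (fun j => (1 + |U j ω|) ^ k) n) P ∧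
    ∫ ω, sampleMean (fun j => (1 + |U j ω|) ^ k) n ∂P =
      ∫ x, (1 + |x|) ^ k ∂(gaussianReal 0 1) := by
  have hn' : (0 : ℝ) < n := by exact_mod_cast hn
  have hi : ∀ j, Integrable (fun ω => (1 + |U j ω|) ^ k) P := fun j => by
    have h := integrable_one_add_abs_pow_gaussianReal k
    rw [← (hlaw j).map_eq] at h
    exact h.comp_aemeasurable (hlaw j).aemeasurable
  have he : ∀ j, ∫ ω, (1 + |U j ω|) ^ k ∂P = ∫ x, (1 + |x|) ^ k ∂(gaussianReal 0 1) := fun j =>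
    (hlaw j).integral_comp (integrable_one_add_abs_pow_gaussianReal k).aestronglyMeasurable
  unfold sampleMean
  refine ⟨(integrable_finsetSum _ fun j _ => hi j).div_const _, ?_⟩
  rw [integral_div, integral_finsetSum _ fun j _ => hi j]
  simp only [he, Finset.sum_const, Finset.card_range, nsmul_eq_mul]
  field_simp

theorem _root_.Function.HasTemperateGrowth.memLp_two_comp {f : ℝ → ℝ} (hf : f.HasTemperateGrowth)
    {X : Ω → ℝ} (hX : HasLaw X (gaussianReal 0 1) P) : MemLp (fun ω => f (X ω)) 2 P := by
  have hf2 : (fun x => f x ^ 2).HasTemperateGrowth := by fun_prop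
  exact (memLp_two_iff_integrable_sq (hf.integrable_comp hX).aestronglyMeasurable).2
    (hf2.integrable_comp hX)

variable [IsProbabilityMeasure P]

/-- Normalized sample means of a centred function of independent standard normal variables are
bounded in mean square. -/
theorem memLp_sqrt_mul_sampleMean {U : ℕ → Ω → ℝ} (hindep : iIndepFun U P)
    (hlaw : ∀ j, HasLaw (U j) (gaussianReal 0 1) P) {f : ℝ → ℝ} (hf : f.HasTemperateGrowth)
    (h0 : ∫ x, f x ∂(gaussianReal 0 1) = 0) (n : ℕ) :
    MemLp (fun ω => √(n : ℝ) * sampleMean (fun j => f (U j ω)) n) 2 P ∧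
    ∫ ω, (√(n : ℝ) * sampleMean (fun j => f (U j ω)) n) ^ 2 ∂P ≤
      ∫ x, f x ^ 2 ∂(gaussianReal 0 1) := by
  have hf2 : (fun x => f x ^ 2).HasTemperateGrowth := by fun_prop
  have hL : ∀ j, MemLp (fun ω => f (U j ω)) 2 P := fun j => hf.memLp_two_comp (hlaw j)
  have h := integral_norm_sq_inv_sqrt_smul_sum_le (ξ := fun j ω => f (U j ω))
    (c := ∫ x, f x ^ 2 ∂(gaussianReal 0 1))
    (fun i j hij => (hindep.indepFun hij).comp hf.1.continuous.measurable
      hf.1.continuous.measurable)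
    hL (fun j => by rw [hf.integral_comp (hlaw j), h0])
    (fun j => by simpa using hf2.integral_comp (hlaw j)) n
  simp only [smul_eq_mul, Real.norm_eq_abs, sq_abs] at h
  simp only [sqrt_mul_sampleMean]
  exact ⟨(memLp_finsetSum (Finset.range n) fun j _ => hL j).const_mul _, h⟩

/-- The event that the normalized first two sample moments are bounded by `B`. -/
def momentEvent (U : ℕ → Ω → ℝ) (B : ℝ) (n : ℕ) : Set Ω :=
  {ω | |√(n : ℝ) * sampleMean (fun j => U j ω) n| ≤ B ∧
    |√(n : ℝ) * sampleMean (fun j => U j ω ^ 2 - 1) n| ≤ B}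

theorem measurableSet_momentEvent {U : ℕ → Ω → ℝ} (hU : ∀ j, Measurable (U j)) (B : ℝ) (n : ℕ) :
    MeasurableSet (momentEvent U B n) := by
  have h1 : Measurable fun ω => sampleMean (fun j => U j ω) n := by
    unfold sampleMean
    fun_prop
  have h2 : Measurable fun ω => sampleMean (fun j => U j ω ^ 2 - 1) n := by
    unfold sampleMean
    fun_prop
  have h3 : Measurable fun ω => |√(n : ℝ) * sampleMean (fun j => U j ω) n| := by fun_prop
  have h4 : Measurable fun ω => |√(n : ℝ) * sampleMean (fun j => U j ω ^ 2 - 1) n| := by fun_prop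
  exact (measurableSet_le h3 measurable_const).inter (measurableSet_le h4 measurable_const)

theorem integral_sq_sub_one_gaussianReal :
    ∫ x, (x ^ 2 - 1) ∂(gaussianReal 0 1) = 0 := by
  rw [integral_sub (Function.HasTemperateGrowth.integrable_gaussianReal (by fun_prop))
    (integrable_const _), integral_sq_gaussianReal_zero_one]
  simp

/-- The normalized sample moments are bounded in probability. -/
theorem exists_measure_compl_momentEvent_le {U : ℕ → Ω → ℝ} (hindep : iIndepFun U P)
    (hlaw : ∀ j, HasLaw (U j) (gaussianReal 0 1) P) :
    ∃ c : ℝ, 0 ≤ c ∧ ∀ B : ℝ, 0 < B → ∀ n,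
      P (momentEvent U B n)ᶜ ≤ ENNReal.ofReal (c / B ^ 2) := by
  set c1 := ∫ x, x ^ 2 ∂(gaussianReal 0 1) with hc1
  set c2 := ∫ x, (x ^ 2 - 1) ^ 2 ∂(gaussianReal 0 1) with hc2
  have hc1' : 0 ≤ c1 := integral_nonneg fun x => sq_nonneg _
  have hc2' : 0 ≤ c2 := integral_nonneg fun x => sq_nonneg _
  refine ⟨c1 + c2, add_nonneg hc1' hc2', fun B hB n => ?_⟩
  obtain ⟨m1, e1⟩ := memLp_sqrt_mul_sampleMean hindep hlaw (f := fun x => x) (by fun_prop)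
    integral_id_gaussianReal_zero_one n
  obtain ⟨m2, e2⟩ := memLp_sqrt_mul_sampleMean hindep hlaw (f := fun x => x ^ 2 - 1) (by fun_prop)
    integral_sq_sub_one_gaussianReal n
  have h1 := measure_lt_norm_le m1 (by simpa only [Real.norm_eq_abs, sq_abs] using e1) hB
  have h2 := measure_lt_norm_le m2 (by simpa only [Real.norm_eq_abs, sq_abs] using e2) hB
  rw [add_div, ENNReal.ofReal_add (by positivity) (by positivity)]
  refine (measure_mono fun ω hω => ?_).trans ((measure_union_le _ _).trans (add_le_add h1 h2))
  rw [momentEvent, Set.mem_compl_iff, Set.mem_ofPred_eq, not_and_or, not_le, not_le] at hω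
  exact hω

/-- On the event of bounded moments the sample standard deviation is within `O (1 / √n)` of `1`:
the difference `S ^ 2 - 1` is the second sample moment minus `1` minus the squared sample mean. -/
theorem abs_sqrt_mul_sampleSD_sub_one_le {Ω : Type*} {U : ℕ → Ω → ℝ} {B : ℝ} {n : ℕ}
    (hn : 0 < n) {ω : Ω}
    (hω : ω ∈ momentEvent U B n) :
    |√(n : ℝ) * (sampleSD (fun j => U j ω) n - 1)| ≤ B + B ^ 2 := by
  obtain ⟨h1, h2⟩ := hω
  set r := √(n : ℝ) with hr
  have hr1 : 1 ≤ r := Real.one_le_sqrt.2 (by exact_mod_cast hn)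
  set a := sampleMean (fun j => U j ω) n
  set q := sampleMean (fun j => U j ω ^ 2 - 1) n with hq
  set S := sampleSD (fun j => U j ω) n with hS
  have hS0 : 0 ≤ S := sampleSD_nonneg _ _
  have hn' : (n : ℝ) ≠ 0 := by exact_mod_cast hn.ne'
  have hS2 : S ^ 2 - 1 = q - a ^ 2 := by
    have hq' : q = (∑ j ∈ Finset.range n, U j ω ^ 2) / n - 1 := by
      rw [hq, sampleMean, Finset.sum_sub_distrib, Finset.sum_const, Finset.card_range,
        nsmul_eq_mul, mul_one, sub_div, div_self hn']
    rw [hS, sampleSD_sq_eq _ hn.ne', hq']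
    ring
  have h3 : |S - 1| ≤ |q - a ^ 2| := by
    rw [← hS2, show S ^ 2 - 1 = (S - 1) * (S + 1) by ring, abs_mul]
    exact le_mul_of_one_le_right (abs_nonneg _) (by rw [abs_of_nonneg] <;> linarith)
  have h4 : r * a ^ 2 ≤ B ^ 2 := by
    calc r * a ^ 2 ≤ r * r * a ^ 2 := by
          refine mul_le_mul_of_nonneg_right ?_ (sq_nonneg _)
          nlinarith
      _ = |r * a| ^ 2 := by rw [sq_abs]; ring
      _ ≤ B ^ 2 := pow_le_pow_left₀ (abs_nonneg _) h1 2
  calc |r * (S - 1)| = r * |S - 1| := by rw [abs_mul, abs_of_nonneg (by linarith)]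
    _ ≤ r * |q - a ^ 2| := mul_le_mul_of_nonneg_left h3 (by linarith)
    _ = |r * q - r * a ^ 2| := by
        rw [← mul_sub, abs_mul, abs_of_nonneg (by linarith : 0 ≤ r)]
    _ ≤ |r * q| + |r * a ^ 2| := abs_sub _ _
    _ ≤ B + B ^ 2 := add_le_add h2 (by rwa [abs_of_nonneg (by positivity)])

theorem sampleMean_sq_le (x : ℕ → ℝ) {n : ℕ} (hn : 0 < n) :
    sampleMean x n ^ 2 ≤ sampleMean (fun j => x j ^ 2) n := by
  have hn' : (0 : ℝ) < n := by exact_mod_cast hn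
  have h := sq_sum_le_card_mul_sum_sq (s := Finset.range n) (f := x)
  rw [Finset.card_range] at h
  rw [sampleMean, sampleMean, div_pow, div_le_div_iff₀ (by positivity) hn']
  nlinarith

theorem measurable_linearizationError (n : ℕ) :
    Measurable fun p : (ℕ → ℝ) × ℝ => linearizationError p.1 n p.2 := by
  have := measurable_residualProcess n
  unfold linearizationError linearTerm steinTerm gaussExp
  fun_prop

/-- A pathwise bound of the squared linearization error on the event of bounded moments. -/
theorem linearizationError_sq_le {Ω : Type*} {U : ℕ → Ω → ℝ} {B b : ℝ} (hB : 0 ≤ B)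
    (hb : b = B + B ^ 2) (t : ℝ) {n : ℕ} (hn : 0 < n) (hr : 2 * b ≤ √(n : ℝ)) {ω : Ω}
    (hω : ω ∈ momentEvent U B n) :
    linearizationError (fun j => U j ω) n t ^ 2 ≤
      12 * b ^ 2 / n * (√(n : ℝ) *
        sampleMean (fun j => steinTermDeriv t (U j ω) - gaussExp t) n) ^ 2 +
      12 * b ^ 2 / n * (√(n : ℝ) *
        sampleMean (fun j => U j ω * steinTermDeriv t (U j ω) + 2 * t * gaussExp t) n) ^ 2 +
      3 * ((2 + 6 * |t| + 4 * (10 * t ^ 2 * (1 + |t|) + 4 * |t|)) * b ^ 2) ^ 2 / n *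
        sampleMean (fun j => (1 + |U j ω|) ^ 6) n := by
  have hb0 : 0 ≤ b := by rw [hb]; positivity
  have hBb : B ≤ b := by rw [hb]; nlinarith
  set r := √(n : ℝ) with hr_def
  have hr0 : 0 < r := Real.sqrt_pos.2 (by exact_mod_cast hn)
  have hn' : (0 : ℝ) < n := by exact_mod_cast hn
  have hr2 : r ^ 2 = n := Real.sq_sqrt n.cast_nonneg
  have hSD := abs_sqrt_mul_sampleSD_sub_one_le hn hω
  rw [← hb, ← hr_def] at hSD
  have hS : 1 / 2 ≤ sampleSD (fun j => U j ω) n := by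
    rw [abs_mul, abs_of_pos hr0] at hSD
    have h1 : |sampleSD (fun j => U j ω) n - 1| ≤ 1 / 2 := by
      by_contra! hcon
      nlinarith
    linarith [(abs_le.1 h1).1]
  have h := abs_linearizationError_le hb0 t hn hS (hω.1.trans hBb) hSD
  rw [← hr_def] at h
  set M := (2 + 6 * |t| + 4 * (10 * t ^ 2 * (1 + |t|) + 4 * |t|)) * b ^ 2
  set d1 := sampleMean (fun j => steinTermDeriv t (U j ω) - gaussExp t) n
  set d2 := sampleMean (fun j => U j ω * steinTermDeriv t (U j ω) + 2 * t * gaussExp t) n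
  set d3 := sampleMean (fun j => (1 + |U j ω|) ^ 3) n
  have h3 : d3 ^ 2 ≤ sampleMean (fun j => (1 + |U j ω|) ^ 6) n := by
    refine (sampleMean_sq_le _ hn).trans_eq ?_
    simp only [← pow_mul]
  calc linearizationError (fun j => U j ω) n t ^ 2 =
        |linearizationError (fun j => U j ω) n t| ^ 2 := (sq_abs _).symm
    _ ≤ (2 * b * |d1| + 2 * b * |d2| + M * r⁻¹ * d3) ^ 2 :=
        pow_le_pow_left₀ (abs_nonneg _) h 2
    _ ≤ 3 * ((2 * b * |d1|) ^ 2 + (2 * b * |d2|) ^ 2 + (M * r⁻¹ * d3) ^ 2) := by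
        nlinarith [sq_nonneg (2 * b * |d1| - 2 * b * |d2|),
          sq_nonneg (2 * b * |d1| - M * r⁻¹ * d3), sq_nonneg (2 * b * |d2| - M * r⁻¹ * d3)]
    _ = 12 * b ^ 2 / n * (r * d1) ^ 2 + 12 * b ^ 2 / n * (r * d2) ^ 2 +
        3 * M ^ 2 / n * d3 ^ 2 := by
        simp only [← hr2, mul_pow, sq_abs, inv_pow]
        field_simp
        ring
    _ ≤ _ := by gcongr

/-- On the event of bounded moments, the mean square of the linearization error is `O (1 / n)`, for
each `t`. -/
theorem exists_lintegral_linearizationError_le {U : ℕ → Ω → ℝ} (hU : ∀ j, Measurable (U j))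
    (hindep : iIndepFun U P) (hlaw : ∀ j, HasLaw (U j) (gaussianReal 0 1) P) {B : ℝ} (hB : 0 ≤ B)
    (t : ℝ) :
    ∃ K : ℝ, ∀ n : ℕ, 0 < n → 2 * (B + B ^ 2) ≤ √(n : ℝ) →
      ∫⁻ ω in momentEvent U B n,
        ENNReal.ofReal (linearizationError (fun j => U j ω) n t ^ 2) ∂P ≤
      ENNReal.ofReal (K / n) := by
  obtain ⟨b, hb⟩ : ∃ b, b = B + B ^ 2 := ⟨_, rfl⟩
  have hf1 : (fun x => steinTermDeriv t x - gaussExp t).HasTemperateGrowth := by fun_prop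
  have hf2 : (fun x => x * steinTermDeriv t x + 2 * t * gaussExp t).HasTemperateGrowth := by
    fun_prop
  have hf1_0 : ∫ x, (steinTermDeriv t x - gaussExp t) ∂(gaussianReal 0 1) = 0 := by
    rw [integral_sub (hasTemperateGrowth_steinTermDeriv t).integrable_gaussianReal
      (integrable_const _), (integral_steinTermDeriv t).1]
    simp
  have hf2_0 : ∫ x, (x * steinTermDeriv t x + 2 * t * gaussExp t) ∂(gaussianReal 0 1) = 0 := by
    rw [integral_add (Function.HasTemperateGrowth.integrable_gaussianReal (by fun_prop))
      (integrable_const _), (integral_steinTermDeriv t).2]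
    simp
  have l1 := fun n => memLp_sqrt_mul_sampleMean hindep hlaw hf1 hf1_0 n
  have l2 := fun n => memLp_sqrt_mul_sampleMean hindep hlaw hf2 hf2_0 n
  have l3 := fun (n : ℕ) (hn : 0 < n) => integrable_sampleMean_one_add_abs_pow hlaw 6 hn
  generalize (∫ x, (steinTermDeriv t x - gaussExp t) ^ 2 ∂(gaussianReal 0 1)) = c1 at l1
  generalize (∫ x, (x * steinTermDeriv t x + 2 * t * gaussExp t) ^ 2 ∂(gaussianReal 0 1)) = c2
    at l2
  generalize (∫ x, (1 + |x|) ^ 6 ∂(gaussianReal 0 1)) = c3 at l3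
  set M := (2 + 6 * |t| + 4 * (10 * t ^ 2 * (1 + |t|) + 4 * |t|)) * b ^ 2 with hM
  refine ⟨12 * b ^ 2 * c1 + 12 * b ^ 2 * c2 + 3 * M ^ 2 * c3, fun n hn hr => ?_⟩
  rw [← hb] at hr
  obtain ⟨i1, l1⟩ := l1 n
  obtain ⟨i2, l2⟩ := l2 n
  obtain ⟨i3, l3⟩ := l3 n hn
  have j1 := (i1.integrable_sq).const_mul (12 * b ^ 2 / n)
  have j2 := (i2.integrable_sq).const_mul (12 * b ^ 2 / n)
  have j3 := i3.const_mul (3 * M ^ 2 / n)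
  have j12 := j1.fun_add j2
  have j123 := j12.fun_add j3
  refine (setLIntegral_mono' (measurableSet_momentEvent hU B n) fun ω hω => ENNReal.ofReal_le_ofReal
    (linearizationError_sq_le hB hb t hn hr hω)).trans ((setLIntegral_le_lintegral _ _).trans ?_)
  rw [← hM, ← ofReal_integral_eq_lintegral_ofReal j123 (ae_of_all _ fun ω => ?_)]
  · refine ENNReal.ofReal_le_ofReal ?_
    rw [integral_add j12 j3, integral_add j1 j2, integral_const_mul, integral_const_mul,
      integral_const_mul, l3]
    calc _ ≤ 12 * b ^ 2 / n * c1 + 12 * b ^ 2 / n * c2 + 3 * M ^ 2 / n * c3 := by gcongr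
      _ = _ := by ring
  · have : 0 ≤ sampleMean (fun j => (1 + |U j ω|) ^ 6) n :=
      div_nonneg (Finset.sum_nonneg fun j _ => by positivity) n.cast_nonneg
    simp only [Pi.zero_apply]
    positivity

/-- The mean square of the linearization error is bounded uniformly in the sample size. -/
theorem lintegral_linearizationError_le {U : ℕ → Ω → ℝ} (hU : ∀ j, Measurable (U j))
    (hindep : iIndepFun U P) (hlaw : ∀ j, HasLaw (U j) (gaussianReal 0 1) P) {n : ℕ} (hn : 3 ≤ n)
    (t : ℝ) :
    ∫⁻ ω, ENNReal.ofReal (linearizationError (fun j => U j ω) n t ^ 2) ∂P ≤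
      ENNReal.ofReal (10 + 30 * t ^ 2) := by
  obtain ⟨iW, lW⟩ := integral_residualProcess_sq_le hU hindep hlaw hn t
  obtain ⟨iG, lG⟩ := memLp_sqrt_mul_sampleMean hindep hlaw (hasTemperateGrowth_linearTerm t)
    (integral_linearTerm t) n
  have hK : ∫ x, linearTerm t x ^ 2 ∂(gaussianReal 0 1) ≤ 1 + t ^ 2 := by
    simp_rw [pow_two]
    rw [integral_linearTerm_mul_linearTerm, limitKernel, sub_self]
    have := Real.exp_pos (-(t ^ 2 + t ^ 2) / 2)
    have h0 : -(0 : ℝ) ^ 2 / 2 = 0 := by norm_num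
    rw [h0, Real.exp_zero]
    nlinarith [sq_nonneg t]
  have hi : Integrable (fun ω => 2 * residualProcess (fun j => U j ω) n t ^ 2 +
      2 * (√(n : ℝ) * sampleMean (fun j => linearTerm t (U j ω)) n) ^ 2) P :=
    (iW.const_mul 2).add (iG.integrable_sq.const_mul 2)
  calc _ ≤ ∫⁻ ω, ENNReal.ofReal (2 * residualProcess (fun j => U j ω) n t ^ 2 +
        2 * (√(n : ℝ) * sampleMean (fun j => linearTerm t (U j ω)) n) ^ 2) ∂P := by
        refine lintegral_mono fun ω => ENNReal.ofReal_le_ofReal ?_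
        rw [linearizationError, ← sqrt_mul_sampleMean]
        nlinarith [sq_nonneg (residualProcess (fun j => U j ω) n t +
          √(n : ℝ) * sampleMean (fun j => linearTerm t (U j ω)) n)]
    _ = ENNReal.ofReal (∫ ω, (2 * residualProcess (fun j => U j ω) n t ^ 2 +
        2 * (√(n : ℝ) * sampleMean (fun j => linearTerm t (U j ω)) n) ^ 2) ∂P) :=
        (ofReal_integral_eq_lintegral_ofReal hi (ae_of_all _ fun ω => by positivity)).symm
    _ ≤ _ := by
        refine ENNReal.ofReal_le_ofReal ?_
        rw [integral_add (iW.const_mul 2) (iG.integrable_sq.const_mul 2), integral_const_mul,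
          integral_const_mul]
        linarith

/-- The mean squared `L²(μ)` norm of the linearization error, restricted to the event of bounded
moments, tends to zero: its value at each `t` does, and is dominated by a multiple of
`1 + t ^ 2`. -/
theorem tendsto_setLIntegral_linearizationError {U : ℕ → Ω → ℝ} (hU : ∀ j, Measurable (U j))
    (hindep : iIndepFun U P) (hlaw : ∀ j, HasLaw (U j) (gaussianReal 0 1) P) {μ : Measure ℝ}
    [IsFiniteMeasure μ] (hμ : MemLp (fun t : ℝ => t) 2 μ) {B : ℝ} (hB : 0 ≤ B) :
    Tendsto (fun n => ∫⁻ ω in momentEvent U B n,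
      ∫⁻ t, ENNReal.ofReal (linearizationError (fun j => U j ω) n t ^ 2) ∂μ ∂P) atTop (𝓝 0) := by
  have hUm : Measurable fun ω j => U j ω := measurable_pi_lambda _ hU
  have hm : ∀ n, Measurable fun p : Ω × ℝ =>
      ENNReal.ofReal (linearizationError (fun j => U j p.1) n p.2 ^ 2) := fun n =>
    (((measurable_linearizationError n).comp
      ((hUm.comp measurable_fst).prodMk measurable_snd)).pow_const 2).ennreal_ofReal
  have hswap : ∀ n, ∫⁻ ω in momentEvent U B n,
      ∫⁻ t, ENNReal.ofReal (linearizationError (fun j => U j ω) n t ^ 2) ∂μ ∂P =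
      ∫⁻ t, ∫⁻ ω in momentEvent U B n,
        ENNReal.ofReal (linearizationError (fun j => U j ω) n t ^ 2) ∂P ∂μ := fun n =>
    lintegral_lintegral_swap (hm n).aemeasurable
  simp_rw [hswap]
  rw [← lintegral_zero (μ := μ)]
  refine tendsto_lintegral_filter_of_dominated_convergence
    (fun t => ENNReal.ofReal (10 + 30 * t ^ 2)) (Eventually.of_forall fun n => ?_) ?_ ?_ ?_
  · exact (hm n).lintegral_prod_left'
  · filter_upwards [eventually_ge_atTop 3] with n hn
    exact ae_of_all _ fun t => (setLIntegral_le_lintegral _ _).trans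
      (lintegral_linearizationError_le hU hindep hlaw hn t)
  · have hi : Integrable (fun t : ℝ => 10 + 30 * t ^ 2) μ :=
      (integrable_const _).add (hμ.integrable_sq.const_mul 30)
    exact hi.lintegral_lt_top.ne
  · refine ae_of_all _ fun t => ?_
    obtain ⟨K, hK⟩ := exists_lintegral_linearizationError_le hU hindep hlaw hB t
    have hlim : Tendsto (fun n : ℕ => ENNReal.ofReal (K / n)) atTop (𝓝 0) := by
      rw [← ENNReal.ofReal_zero]
      exact ENNReal.tendsto_ofReal (tendsto_const_div_atTop_nhds_zero_nat K)
    refine tendsto_of_tendsto_of_tendsto_of_le_of_le' tendsto_const_nhds hlim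
      (Eventually.of_forall fun n => zero_le) ?_
    have hsqrt : Tendsto (fun n : ℕ => √(n : ℝ)) atTop atTop :=
      Real.tendsto_sqrt_atTop.comp tendsto_natCast_atTop_atTop
    filter_upwards [eventually_gt_atTop 0, hsqrt.eventually_ge_atTop (2 * (B + B ^ 2))] with n h1 h2
    exact hK n h1 h2

/-- The linearization error tends to zero in `L²(μ)`, in probability. -/
theorem tendsto_measure_le_lintegral_linearizationError {U : ℕ → Ω → ℝ}
    (hU : ∀ j, Measurable (U j)) (hindep : iIndepFun U P)
    (hlaw : ∀ j, HasLaw (U j) (gaussianReal 0 1) P) {μ : Measure ℝ}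
    [IsFiniteMeasure μ] (hμ : MemLp (fun t : ℝ => t) 2 μ) {ε : ℝ≥0∞} (hε : ε ≠ 0) (hε' : ε ≠ ∞) :
    Tendsto (fun n => P {ω | ε ≤
      ∫⁻ t, ENNReal.ofReal (linearizationError (fun j => U j ω) n t ^ 2) ∂μ}) atTop (𝓝 0) := by
  have hUm : Measurable fun ω j => U j ω := measurable_pi_lambda _ hU
  have hm : ∀ n, Measurable fun p : Ω × ℝ =>
      ENNReal.ofReal (linearizationError (fun j => U j p.1) n p.2 ^ 2) := fun n =>
    (((measurable_linearizationError n).comp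
      ((hUm.comp measurable_fst).prodMk measurable_snd)).pow_const 2).ennreal_ofReal
  obtain ⟨c, hc, hcB⟩ := exists_measure_compl_momentEvent_le hindep hlaw
  have hB : Tendsto (fun B : ℝ => ENNReal.ofReal (c / B ^ 2)) atTop (𝓝 0) := by
    rw [← ENNReal.ofReal_zero]
    exact ENNReal.tendsto_ofReal ((tendsto_pow_atTop two_ne_zero).const_div_atTop c)
  refine ENNReal.tendsto_nhds_zero.2 fun δ hδ => ?_
  have hδ2 : 0 < δ / 2 := ENNReal.half_pos hδ.ne'
  -- the event of bounded moments is chosen with complement of probability at most `δ / 2`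
  obtain ⟨B, hB1, hB2⟩ := ((eventually_gt_atTop 0).and
    (ENNReal.tendsto_nhds_zero.1 hB (δ / 2) hδ2)).exists
  -- on that event, Markov's inequality
  have hlim : Tendsto (fun n => (∫⁻ ω in momentEvent U B n,
      ∫⁻ t, ENNReal.ofReal (linearizationError (fun j => U j ω) n t ^ 2) ∂μ ∂P) / ε) atTop
      (𝓝 0) := by
    have := ENNReal.Tendsto.div_const
      (tendsto_setLIntegral_linearizationError hU hindep hlaw hμ hB1.le) (b := ε) (Or.inr hε)
    rwa [ENNReal.zero_div] at this
  filter_upwards [ENNReal.tendsto_nhds_zero.1 hlim (δ / 2) hδ2] with n hn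
  set F : Ω → ℝ≥0∞ := fun ω =>
    ∫⁻ t, ENNReal.ofReal (linearizationError (fun j => U j ω) n t ^ 2) ∂μ with hF
  have hFm : Measurable F := (hm n).lintegral_prod_right'
  have hAm := measurableSet_momentEvent hU B n
  calc P {ω | ε ≤ F ω} ≤ P ({ω | ε ≤ F ω} ∩ momentEvent U B n) + P (momentEvent U B n)ᶜ := by
        refine (measure_le_inter_add_sdiff P _ (momentEvent U B n)).trans ?_
        exact add_le_add le_rfl (measure_mono fun ω hω => hω.2)
    _ ≤ δ / 2 + δ / 2 := by
        refine add_le_add ?_ ((hcB B hB1 n).trans hB2)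
        rw [← Measure.restrict_apply (measurableSet_le measurable_const hFm)]
        exact (meas_ge_le_lintegral_div hFm.aemeasurable hε hε').trans hn
    _ = δ := ENNReal.add_halves δ

end RemainderBound

/-! ### Random elements of the weighted L² space -/

section RandomElements

instance fact_two_ne_top : Fact ((2 : ℝ≥0∞) ≠ ∞) := ⟨by simp⟩

variable {α : Type*} [MeasurableSpace α] {μ : Measure ℝ}

/-- In a second countable space, open sets are countable unions of balls, so measurability of the
distances to all points is enough. -/
theorem measurable_of_measurable_edist {H : Type*} [PseudoEMetricSpace H]
    [SecondCountableTopology H] [MeasurableSpace H] [BorelSpace H] {f : α → H}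
    (hf : ∀ y, Measurable fun a => edist (f a) y) : Measurable f := by
  refine measurable_of_isOpen fun s hs => ?_
  choose! r hr0 hr using fun x (hx : x ∈ s) => EMetric.isOpen_iff.1 hs x hx
  obtain ⟨T, hTs, hT, hU⟩ := TopologicalSpace.isOpen_biUnion_countable s
    (fun x => Metric.eball x (r x)) fun x _ => Metric.isOpen_eball
  have hs' : s = ⋃ x ∈ T, Metric.eball x (r x) := by
    rw [hU]
    refine Set.Subset.antisymm (fun x hx => Set.mem_biUnion hx ?_) (Set.iUnion₂_subset hr)
    exact Metric.mem_eball_self (hr0 x hx)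
  rw [hs', Set.preimage_iUnion₂]
  exact MeasurableSet.biUnion hT fun x _ => measurableSet_lt (hf x) measurable_const

theorem eLpNorm_two_sq (f : ℝ → ℝ) :
    eLpNorm f 2 μ = (∫⁻ t, ‖f t‖ₑ ^ 2 ∂μ) ^ (1 / 2 : ℝ) := by
  rw [eLpNorm_eq_lintegral_rpow_enorm_toReal (by simp) (by simp)]
  simp

theorem inner_toLp {Z : ℝ → ℝ} (hL : MemLp Z 2 μ) (g : Lp ℝ 2 μ) :
    ⟪g, hL.toLp Z⟫ = ∫ t, g t * Z t ∂μ := by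
  rw [L2.inner_def]
  refine integral_congr_ae ?_
  filter_upwards [hL.coeFn_toLp] with t ht
  rw [ht]
  simp [mul_comm]

variable {ρ : Measure α} {Z : α → ℝ → ℝ} {φ : α → ℝ} {ψ : ℝ → ℝ}

theorem memLp_path (hZ : Measurable fun p : α × ℝ => Z p.1 p.2) (hψ : MemLp ψ 2 μ)
    (hb : ∀ a t, |Z a t| ≤ φ a * ψ t) (a : α) : MemLp (Z a) 2 μ :=
  (hψ.const_mul (φ a)).of_le (hZ.comp measurable_prodMk_left).aestronglyMeasurable
    (ae_of_all _ fun t => (hb a t).trans (le_abs_self _))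

variable [IsProbabilityMeasure ρ]

theorem integrable_path_mul (hZ : Measurable fun p : α × ℝ => Z p.1 p.2) (hφ : MemLp φ 2 ρ)
    (hψ : MemLp ψ 2 μ) (hb : ∀ a t, |Z a t| ≤ φ a * ψ t) (g : Lp ℝ 2 μ) :
    Integrable (fun p : α × ℝ => g p.2 * Z p.1 p.2) (ρ.prod μ) := by
  have hg : Measurable g := (Lp.stronglyMeasurable g).measurable
  have h1 : Integrable (fun t => g t * ψ t) μ := (Lp.memLp g).integrable_mul hψ
  have h2 : Integrable φ ρ := hφ.integrable (by norm_num)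
  refine (h2.mul_prod h1).mono ((hg.comp measurable_snd).mul hZ).aestronglyMeasurable
    (ae_of_all _ fun p => ?_)
  simp only [Real.norm_eq_abs, abs_mul]
  calc |g p.2| * |Z p.1 p.2| ≤ |g p.2| * |φ p.1 * ψ p.2| :=
        mul_le_mul_of_nonneg_left ((hb _ _).trans (le_abs_self _)) (abs_nonneg _)
    _ = _ := by rw [abs_mul]; ring

variable [IsFiniteMeasure μ]

/-- The covariance of the inner products of a process with two functions is the integral of its
covariance function against them. -/
theorem integral_inner_toLp_mul_inner_toLp (hZ : Measurable fun p : α × ℝ => Z p.1 p.2)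
    (hφ : MemLp φ 2 ρ) (hψ : MemLp ψ 2 μ) (hb : ∀ a t, |Z a t| ≤ φ a * ψ t)
    (hL : ∀ a, MemLp (Z a) 2 μ) (f g : Lp ℝ 2 μ) :
    Integrable (fun p : ℝ × ℝ => (∫ a, Z a p.1 * Z a p.2 ∂ρ) * f p.1 * g p.2) (μ.prod μ) ∧
    ∫ a, ⟪f, (hL a).toLp (Z a)⟫ * ⟪g, (hL a).toLp (Z a)⟫ ∂ρ =
      ∫ p : ℝ × ℝ, (∫ a, Z a p.1 * Z a p.2 ∂ρ) * f p.1 * g p.2 ∂(μ.prod μ) := by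
  have hfm : Measurable f := (Lp.stronglyMeasurable f).measurable
  have hgm : Measurable g := (Lp.stronglyMeasurable g).measurable
  have hf1 : Integrable (fun t => f t * ψ t) μ := (Lp.memLp f).integrable_mul hψ
  have hg1 : Integrable (fun t => g t * ψ t) μ := (Lp.memLp g).integrable_mul hψ
  have hZ1 : Measurable fun q : α × (ℝ × ℝ) => Z q.1 q.2.1 :=
    hZ.comp (measurable_fst.prodMk (measurable_fst.comp measurable_snd))
  have hZ2 : Measurable fun q : α × (ℝ × ℝ) => Z q.1 q.2.2 :=
    hZ.comp (measurable_fst.prodMk (measurable_snd.comp measurable_snd))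
  have hI : Integrable (fun q : α × (ℝ × ℝ) => (f q.2.1 * Z q.1 q.2.1) * (g q.2.2 * Z q.1 q.2.2))
      (ρ.prod (μ.prod μ)) := by
    refine (hφ.integrable_sq.mul_prod (hf1.mul_prod hg1)).mono
      (Measurable.aestronglyMeasurable (by fun_prop)) (ae_of_all _ fun q => ?_)
    simp only [Real.norm_eq_abs, abs_mul, abs_pow]
    calc |f q.2.1| * |Z q.1 q.2.1| * (|g q.2.2| * |Z q.1 q.2.2|) ≤
          |f q.2.1| * |φ q.1 * ψ q.2.1| * (|g q.2.2| * |φ q.1 * ψ q.2.2|) :=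
          mul_le_mul
            (mul_le_mul_of_nonneg_left ((hb _ _).trans (le_abs_self _)) (abs_nonneg _))
            (mul_le_mul_of_nonneg_left ((hb _ _).trans (le_abs_self _)) (abs_nonneg _))
            (by positivity) (by positivity)
      _ = _ := by
          rw [abs_mul, abs_mul]
          ring
  have hK : ∀ p : ℝ × ℝ, ∫ a, (f p.1 * Z a p.1) * (g p.2 * Z a p.2) ∂ρ =
      (∫ a, Z a p.1 * Z a p.2 ∂ρ) * f p.1 * g p.2 := fun p => by
    rw [mul_assoc, ← integral_mul_const]
    refine integral_congr_ae (ae_of_all _ fun a => ?_)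
    ring
  constructor
  · simp_rw [← hK]
    exact hI.integral_prod_right
  · simp_rw [← hK, inner_toLp, ← integral_prod_mul]
    exact integral_integral_swap hI

variable [MeasurableSpace (Lp ℝ 2 μ)] [BorelSpace (Lp ℝ 2 μ)]

/-- A jointly measurable process with square integrable paths is a random element of `L²`. -/
theorem measurable_toLp {Z : α → ℝ → ℝ} (hZ : Measurable fun p : α × ℝ => Z p.1 p.2)
    (hL : ∀ a, MemLp (Z a) 2 μ) : Measurable fun a => (hL a).toLp (Z a) := by
  refine measurable_of_measurable_edist fun y => ?_
  have hy : Measurable y := (Lp.stronglyMeasurable y).measurable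
  have h : ∀ a, edist ((hL a).toLp (Z a)) y =
      (∫⁻ t, ‖Z a t - y t‖ₑ ^ 2 ∂μ) ^ (1 / 2 : ℝ) := fun a => by
    nth_rw 1 [← Lp.toLp_coeFn y (Lp.memLp y)]
    rw [Lp.edist_toLp_toLp, eLpNorm_two_sq]
    rfl
  simp_rw [h]
  have hm : Measurable fun p : α × ℝ => ‖Z p.1 p.2 - y p.2‖ₑ ^ 2 := by fun_prop
  exact hm.lintegral_prod_right'.pow_const _

theorem memLp_toLp {ρ : Measure α} (hZ : Measurable fun p : α × ℝ => Z p.1 p.2) (hφ : MemLp φ 2 ρ)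
    (hψ : MemLp ψ 2 μ) (hb : ∀ a t, |Z a t| ≤ φ a * ψ t) (hL : ∀ a, MemLp (Z a) 2 μ) :
    MemLp (fun a => (hL a).toLp (Z a)) 2 ρ := by
  refine (hφ.abs.mul_const ‖hψ.toLp ψ‖).of_le
    (measurable_toLp hZ hL).aestronglyMeasurable (ae_of_all _ fun a => ?_)
  refine le_trans ?_ (le_abs_self _)
  refine Lp.norm_le_mul_norm_of_ae_le_mul ?_
  filter_upwards [(hL a).coeFn_toLp, hψ.coeFn_toLp] with t h1 h2
  rw [h1, h2]
  refine (hb a t).trans ((le_abs_self _).trans_eq ?_)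
  rw [abs_mul]
  rfl

/-- A process centred at each time is centred as a random element of `L²`. -/
theorem integral_toLp_eq_zero (hZ : Measurable fun p : α × ℝ => Z p.1 p.2) (hφ : MemLp φ 2 ρ)
    (hψ : MemLp ψ 2 μ) (hb : ∀ a t, |Z a t| ≤ φ a * ψ t) (hL : ∀ a, MemLp (Z a) 2 μ)
    (h0 : ∀ t, ∫ a, Z a t ∂ρ = 0) : ∫ a, (hL a).toLp (Z a) ∂ρ = 0 := by
  refine ext_inner_left ℝ fun g => ?_
  rw [inner_zero_right, ← integral_inner ((memLp_toLp hZ hφ hψ hb hL).integrable (by norm_num))]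
  simp_rw [inner_toLp]
  rw [integral_integral_swap (integrable_path_mul hZ hφ hψ hb g)]
  simp_rw [integral_const_mul, h0]
  simp

end RandomElements

section LinearElement

theorem abs_linearTerm_le (u t : ℝ) : |linearTerm t u| ≤ 3 * (1 + u ^ 2) * (1 + |t|) := by
  have h1 : |steinTerm t u| ≤ 2 * (|t| + |u|) :=
    abs_add_mul_cos_sin_le _ _ _ _ ((abs_add_le _ _).trans_eq (add_comm _ _)) (abs_sub _ _)
  have h2 : |gaussExp t * (u - t * (u ^ 2 - 1))| ≤ |u| + |t| * (u ^ 2 + 1) := by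
    rw [abs_mul, abs_of_pos (gaussExp_pos t)]
    refine (mul_le_of_le_one_left (abs_nonneg _) (gaussExp_le_one t)).trans
      ((abs_sub _ _).trans (add_le_add le_rfl ?_))
    rw [abs_mul]
    exact mul_le_mul_of_nonneg_left ((abs_sub _ _).trans (by simp)) (abs_nonneg _)
  have h3 : 2 * |u| ≤ 1 + u ^ 2 := by nlinarith [sq_nonneg (|u| - 1), sq_abs u]
  have h4 : 0 ≤ |t| * u ^ 2 := by positivity
  have h5 : 0 ≤ |t| := abs_nonneg t
  have h6 : |linearTerm t u| ≤ |steinTerm t u| + |gaussExp t * (u - t * (u ^ 2 - 1))| :=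
    abs_sub _ _
  nlinarith

theorem measurable_linearTerm : Measurable fun p : ℝ × ℝ => linearTerm p.2 p.1 := by
  unfold linearTerm steinTerm gaussExp
  fun_prop

variable {w : ℝ → ℝ}

theorem IsWeight.memLp_linear_growth (hw : IsWeight w) :
    MemLp (fun t : ℝ => 1 + |t|) 2 (weightMeasure w) := by
  have := hw.isFiniteMeasure
  have h1 : MemLp (fun _ : ℝ => (1 : ℝ)) 2 (weightMeasure w) := memLp_const 1
  exact h1.add hw.memLp_id.abs

theorem IsWeight.memLp_linearTerm (hw : IsWeight w) (u : ℝ) :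
    MemLp (fun t => linearTerm t u) 2 (weightMeasure w) := by
  have := hw.isFiniteMeasure
  exact memLp_path (Z := fun u t => linearTerm t u) measurable_linearTerm hw.memLp_linear_growth
    abs_linearTerm_le u

/-- The linearized summand, as an element of the weighted `L²` space. -/
noncomputable def linearElement (hw : IsWeight w) (u : ℝ) : WeightedL2 w :=
  (hw.memLp_linearTerm u).toLp fun t => linearTerm t u

theorem measurable_linearElement (hw : IsWeight w) : Measurable (linearElement hw) := by
  have := hw.isFiniteMeasure
  exact measurable_toLp measurable_linearTerm hw.memLp_linearTerm

theorem memLp_quadratic_gaussianReal :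
    MemLp (fun u : ℝ => 3 * (1 + u ^ 2)) 2 (gaussianReal 0 1) :=
  Function.HasTemperateGrowth.memLp_two_comp (f := fun u : ℝ => 3 * (1 + u ^ 2)) (by fun_prop)
    HasLaw.id

theorem memLp_linearElement (hw : IsWeight w) :
    MemLp (linearElement hw) 2 (gaussianReal 0 1) := by
  have := hw.isFiniteMeasure
  exact memLp_toLp measurable_linearTerm memLp_quadratic_gaussianReal hw.memLp_linear_growth
    abs_linearTerm_le hw.memLp_linearTerm

theorem integral_linearElement (hw : IsWeight w) :
    ∫ u, linearElement hw u ∂(gaussianReal 0 1) = 0 := by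
  have := hw.isFiniteMeasure
  exact integral_toLp_eq_zero measurable_linearTerm memLp_quadratic_gaussianReal
    hw.memLp_linear_growth abs_linearTerm_le hw.memLp_linearTerm integral_linearTerm

theorem integral_inner_linearElement_mul_inner (hw : IsWeight w) (f g : WeightedL2 w) :
    Integrable (fun p : ℝ × ℝ => limitKernel p.1 p.2 * f p.1 * g p.2)
      ((weightMeasure w).prod (weightMeasure w)) ∧
    ∫ u, ⟪f, linearElement hw u⟫ * ⟪g, linearElement hw u⟫ ∂(gaussianReal 0 1) =
      ∫ p : ℝ × ℝ, limitKernel p.1 p.2 * f p.1 * g p.2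
        ∂((weightMeasure w).prod (weightMeasure w)) := by
  have := hw.isFiniteMeasure
  have h := integral_inner_toLp_mul_inner_toLp measurable_linearTerm memLp_quadratic_gaussianReal
    hw.memLp_linear_growth abs_linearTerm_le hw.memLp_linearTerm f g
  simp_rw [integral_linearTerm_mul_linearTerm] at h
  exact h

theorem measurable_residualElement (hw : IsWeight w) (n : ℕ) :
    Measurable fun x : ℕ → ℝ => residualElement hw x n := by
  have := hw.isFiniteMeasure
  exact measurable_toLp (measurable_residualProcess n) fun x => hw.memLp_residualProcess x n

/-- The squared distance between `W_n` and its linearization in the weighted `L²` space. -/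
theorem enorm_residualElement_sub_sq (hw : IsWeight w) (x : ℕ → ℝ) (n : ℕ) :
    ‖residualElement hw x n - (√(n : ℝ))⁻¹ • ∑ j ∈ Finset.range n, linearElement hw (x j)‖ₑ ^ 2 =
      ∫⁻ t, ENNReal.ofReal (linearizationError x n t ^ 2) ∂(weightMeasure w) := by
  have := hw.isFiniteMeasure
  have hae : ⇑(residualElement hw x n -
      (√(n : ℝ))⁻¹ • ∑ j ∈ Finset.range n, linearElement hw (x j)) =ᵐ[weightMeasure w]
      linearizationError x n := by
    have hall : ∀ᵐ t ∂(weightMeasure w), ∀ j, linearElement hw (x j) t = linearTerm t (x j) :=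
      ae_all_iff.2 fun j => (hw.memLp_linearTerm (x j)).coeFn_toLp
    filter_upwards [Lp.coeFn_sub (residualElement hw x n)
      ((√(n : ℝ))⁻¹ • ∑ j ∈ Finset.range n, linearElement hw (x j)),
      Lp.coeFn_smul (√(n : ℝ))⁻¹ (∑ j ∈ Finset.range n, linearElement hw (x j)),
      Lp.coeFn_finsetSum (Finset.range n) fun j => linearElement hw (x j),
      (hw.memLp_residualProcess x n).coeFn_toLp, hall] with t h1 h2 h3 h4 h5
    rw [h1, Pi.sub_apply, h2, Pi.smul_apply, h3, Finset.sum_apply, linearizationError]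
    simp only [h5, smul_eq_mul]
    rw [residualElement, h4]
  rw [Lp.enorm_def, eLpNorm_congr_ae hae, eLpNorm_two_sq, ← ENNReal.rpow_natCast,
    ← ENNReal.rpow_mul]
  norm_num
  refine lintegral_congr fun t => ?_
  rw [← sq_abs, ENNReal.ofReal_pow (abs_nonneg _), Real.enorm_eq_ofReal_abs]

end LinearElement

/-! ### The limit theorem for standardized samples -/

section Limit

variable {w : ℝ → ℝ} {Ω : Type*} [MeasurableSpace Ω] {P : Measure Ω}

theorem covarianceBilin_map_linearElement (hw : IsWeight w) (f g : WeightedL2 w) :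
    covarianceBilin ((gaussianReal 0 1).map (linearElement hw)) f g =
      ∫ p : ℝ × ℝ, limitKernel p.1 p.2 * f p.1 * g p.2
        ∂((weightMeasure w).prod (weightMeasure w)) := by
  have := hw.isFiniteMeasure
  have hm := (measurable_linearElement hw).aemeasurable (μ := gaussianReal 0 1)
  have : IsProbabilityMeasure ((gaussianReal 0 1).map (linearElement hw)) :=
    Measure.isProbabilityMeasure_map hm
  have hid : MemLp id 2 ((gaussianReal 0 1).map (linearElement hw)) :=
    (memLp_map_measure_iff aestronglyMeasurable_id hm).2 (memLp_linearElement hw)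
  have hmean : ∫ x, id x ∂((gaussianReal 0 1).map (linearElement hw)) = 0 := by
    rw [integral_map hm aestronglyMeasurable_id]
    exact integral_linearElement hw
  rw [covarianceBilin_apply hid, hmean, integral_map hm (by fun_prop)]
  simp only [sub_zero]
  exact (integral_inner_linearElement_mul_inner hw f g).2

/-- Normal variables can be standardized, after a modification on a null set which makes them
measurable. -/
theorem exists_standardization {X : ℕ → Ω → ℝ} {m : ℝ} {v : ℝ≥0} (hv : v ≠ 0)
    (hindep : iIndepFun X P) (hlaw : ∀ j, HasLaw (X j) (gaussianReal m v) P) :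
    ∃ U : ℕ → Ω → ℝ, (∀ j, Measurable (U j)) ∧ iIndepFun U P ∧
      (∀ j, HasLaw (U j) (gaussianReal 0 1) P) ∧
      ∀ᵐ ω ∂P, ∀ j, X j ω = m + √(v : ℝ) * U j ω := by
  have hX := fun j => (hlaw j).aemeasurable
  have hv0 : (0 : ℝ) < v := by exact_mod_cast pos_iff_ne_zero.2 hv
  have hs : √(v : ℝ) ≠ 0 := (Real.sqrt_pos.2 hv0).ne'
  have hstd : ∀ j, HasLaw (fun ω => (X j ω - m) / √(v : ℝ)) (gaussianReal 0 1) P := fun j => by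
    have h := gaussianReal_div_const (gaussianReal_sub_const (hlaw j) m) √(v : ℝ)
    have hone : v / .mk (√(v : ℝ) ^ 2) (sq_nonneg _) = (1 : ℝ≥0) := by
      refine NNReal.eq ?_
      rw [NNReal.coe_div, NNReal.coe_mk, Real.sq_sqrt v.coe_nonneg, div_self hv0.ne',
        NNReal.coe_one]
    rwa [sub_self, zero_div, hone] at h
  have hae : ∀ j, (fun ω => (X j ω - m) / √(v : ℝ)) =ᵐ[P]
      fun ω => ((hX j).mk (X j) ω - m) / √(v : ℝ) := fun j => by
    filter_upwards [(hX j).ae_eq_mk] with ω hω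
    rw [hω]
  refine ⟨fun j ω => ((hX j).mk (X j) ω - m) / √(v : ℝ),
    fun j => ((hX j).measurable_mk.sub_const m).div_const _, ?_, fun j => ?_, ?_⟩
  · exact iIndepFun.congr hae
      (hindep.comp (fun _ x => (x - m) / √(v : ℝ)) fun _ => by fun_prop)
  · exact (hstd j).congr (hae j).symm
  · refine ae_all_iff.2 fun j => ?_
    filter_upwards [(hX j).ae_eq_mk] with ω hω
    rw [← hω, mul_div_cancel₀ _ hs, add_sub_cancel]

variable [IsProbabilityMeasure P]

/-- The difference between the process and its linearization tends to zero in probability in the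
weighted `L²` space. -/
theorem tendstoInMeasure_residualElement_sub (hw : IsWeight w) {U : ℕ → Ω → ℝ}
    (hU : ∀ j, Measurable (U j)) (hindep : iIndepFun U P)
    (hlaw : ∀ j, HasLaw (U j) (gaussianReal 0 1) P) :
    TendstoInMeasure P ((fun n ω => residualElement hw (fun j => U j ω) n) -
      fun (n : ℕ) ω => (√(n : ℝ))⁻¹ • ∑ j ∈ Finset.range n, linearElement hw (U j ω)) atTop 0 := by
  have := hw.isFiniteMeasure
  refine tendstoInMeasure_of_ne_top fun ε hε hε' => ?_
  have h := tendsto_measure_le_lintegral_linearizationError hU hindep hlaw hw.memLp_id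
    (ε := ε ^ 2) (pow_ne_zero 2 hε.ne') (ENNReal.pow_ne_top hε')
  refine h.congr fun n => ?_
  congr 1
  ext ω
  simp only [Set.mem_ofPred_eq, Pi.sub_apply, Pi.zero_apply, edist_zero_right]
  rw [← enorm_residualElement_sub_sq hw (fun j => U j ω) n, ENNReal.pow_le_pow_left_iff two_ne_zero]

/-- The limit theorem for standard normal samples, with the limit given by its law. -/
theorem exists_isGaussian_tendsto_residualElement (hw : IsWeight w) {U : ℕ → Ω → ℝ}
    (hU : ∀ j, Measurable (U j)) (hindep : iIndepFun U P)
    (hlaw : ∀ j, HasLaw (U j) (gaussianReal 0 1) P) :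
    ∃ (ν : Measure (WeightedL2 w)) (_ : IsProbabilityMeasure ν), IsGaussian ν ∧ ∫ x, x ∂ν = 0 ∧
      (∀ f g : WeightedL2 w, covarianceBilin ν f g =
        ∫ p : ℝ × ℝ, limitKernel p.1 p.2 * f p.1 * g p.2
          ∂((weightMeasure w).prod (weightMeasure w))) ∧
      TendstoInDistribution (fun (n : ℕ) (ω : Ω) => residualElement hw (fun j => U j ω) n) atTop
        id (fun _ => P) ν := by
  have := hw.isFiniteMeasure
  have hm := measurable_linearElement hw
  have hlawL : ∀ j, HasLaw (fun ω => linearElement hw (U j ω))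
      ((gaussianReal 0 1).map (linearElement hw)) P := fun j =>
    HasLaw.comp ⟨hm.aemeasurable, rfl⟩ (hlaw j)
  have hL : MemLp (fun ω => linearElement hw (U 0 ω)) 2 P := by
    have h := memLp_linearElement hw
    rw [← (hlaw 0).map_eq] at h
    exact h.comp_of_map (hlaw 0).aemeasurable
  have h0 : ∫ ω, linearElement hw (U 0 ω) ∂P = 0 :=
    ((hlaw 0).integral_comp hm.aestronglyMeasurable).trans (integral_linearElement hw)
  obtain ⟨ν, hν, hG, hmean, hcov, hlim⟩ :=
    exists_isGaussian_tendsto_inv_sqrt_smul_sum (ξ := fun j ω => linearElement hw (U j ω))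
      (hindep.comp (fun _ => linearElement hw) fun _ => hm)
      (fun j => ⟨(hlawL j).aemeasurable, (hlawL 0).aemeasurable,
        (hlawL j).map_eq.trans (hlawL 0).map_eq.symm⟩) hL h0
  refine ⟨ν, hν, hG, hmean, fun f g => ?_, ?_⟩
  · rw [hcov, (hlawL 0).map_eq, covarianceBilin_map_linearElement]
  · exact tendstoInDistribution_of_tendstoInMeasure_sub _ _ hlim
      (tendstoInMeasure_residualElement_sub hw hU hindep hlaw) fun n =>
        ((measurable_residualElement hw n).comp (measurable_pi_lambda _ hU)).aemeasurable

end Limit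

end SteinNormality

theorem mainTheorem1 {w : ℝ → ℝ} (hw : SteinNormality.IsWeight w)
    {Ω : Type*} [MeasurableSpace Ω] (P : Measure Ω) [IsProbabilityMeasure P]
    (X : ℕ → Ω → ℝ) (m : ℝ) (v : ℝ≥0) (hv : v ≠ 0)
    (hindep : iIndepFun X P) (hlaw : ∀ j, HasLaw (X j) (gaussianReal m v) P) :
    ∃ (Ω' : Type) (_ : MeasurableSpace Ω') (P' : Measure Ω') (_ : IsProbabilityMeasure P')
      (W : Ω' → SteinNormality.WeightedL2 w),
      HasGaussianLaw W P' ∧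
      Integrable W P' ∧ ∫ ω, W ω ∂P' = 0 ∧
      SteinNormality.HasCovarianceKernel P' W SteinNormality.limitKernel ∧
      TendstoInDistribution
        (fun (n : ℕ) (ω : Ω) => SteinNormality.residualElement hw (fun j => X j ω) n)
        atTop W (fun _ => P) P' := by
  have := hw.isFiniteMeasure
  obtain ⟨U, hU, hUindep, hUlaw, hXU⟩ := SteinNormality.exists_standardization hv hindep hlaw
  obtain ⟨ν, hν, hG, hmean, hcov, hlim⟩ :=
    SteinNormality.exists_isGaussian_tendsto_residualElement hw hU hUindep hUlaw
  have hL : MemLp id 2 ν := IsGaussian.memLp_two_id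
  refine ⟨SteinNormality.WeightedL2 w, inferInstance, ν, hν, id, IsGaussian.hasGaussianLaw_id,
    IsGaussian.integrable_id, hmean, fun f g => ⟨hL.const_inner f, ?_, ?_⟩, ?_⟩
  · exact (SteinNormality.integral_inner_linearElement_mul_inner hw f g).1
  · rw [← hcov f g, covarianceBilin_apply_eq_cov hL]
    rfl
  · have hs : 0 < √(v : ℝ) := Real.sqrt_pos.2 (by exact_mod_cast pos_iff_ne_zero.2 hv)
    refine hlim.congr (fun n => ?_) Filter.EventuallyEq.rfl
    filter_upwards [hXU] with ω hω
    have h : SteinNormality.residualProcess (fun j => U j ω) n =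
        SteinNormality.residualProcess (fun j => X j ω) n := funext fun t => by
      simp only [hω]
      exact (SteinNormality.residualProcess_affine _ m hs n t).symm
    simp only [SteinNormality.residualElement, h]
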